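/- Let $\sigma,\tau\in\mathbb R$, put $\rho=\tau-2\sigma$, and assume $\rho>0$, $\tau+\rho>1$ and $\tau>0$. Consider the infinite matrices $$E(\sigma,\tau)=\Bigl\{\frac{n^\sigma m^\sigma}{[n,m]^\tau}\Bigr\}_{n,m=1}^\infty,\qquad E_p(\sigma,\tau)=\bigl\{p^{\sigma j}p^{-\tau\max(j,k)}p^{\sigma k}\bigr\}_{j,k=0}^\infty\quad(p\text{ prime}),$$ where $[n,m]$ is the least common multiple, as operators on $\ell^2$. In the two cases below these are bounded, compact, positive operators with trivial kernel; let $\lambda_1(E)\ge\lambda_2(E)\ge\dots$ and $\lambda_0(E_p)\ge\lambda_1(E_p)\ge\dots$ be their eigenvalues, repeated according to multiplicity. Moreover, the eigenvalue asymptotics $$\lambda_n(E(\sigma,\tau))=\frac{\varkappa(\sigma,\tau)}{n^\rho}+o(n^{-\rho}),\qquad n\to\infty,$$ hold with a constant $\varkappa(\sigma,\tau)>0$ which satisfies $$\varkappa(\sigma,\tau)=g^{\rho},\qquad g=\prod_{p\text{ prime}}\Bigl(1-\frac1p\Bigr)\sum_{k=0}^\infty\lambda_k(E_p(\sigma,\tau))^{1/\rho},$$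 the sums and the product being convergent, and which is given explicitly as follows. 1. If $\rho=1$ (that is, $\tau=1+2\sigma$), then $g=1$ and $\varkappa(\sigma,1+2\sigma)=1$. 2. If $\rho=\frac12$ (that is, $\tau=\frac12+2\sigma$), then $$g=\frac{\zeta(1+2\sigma)^2}{\zeta(2+4\sigma)},\qquad g^{-\rho}=\frac{\sqrt{\zeta(2+4\sigma)}}{\zeta(1+2\sigma)},\qquad \varkappa(\sigma,\tfrac12+2\sigma)=g^{\rho}=\frac{\zeta(1+2\sigma)}{\sqrt{\zeta(2+4\sigma)}}\ne1,$$ where $\zeta$ is the Riemann zeta function. On the other hand, the eigenvalues of the diagonal part $\mathrm{diag}(n^{-\rho})$ of $E(\sigma,\tau)$ obey the same kind of asymptotics with the constant $1$; so the off-diagonal part of $E(\sigma,\tau)$ affects the leading eigenvalue asymptotics. -/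

import Mathlib

open Filter Topology Asymptotics
open scoped lp

/-- The infinite matrix `n ^ σ * m ^ σ / [n, m] ^ τ`, indexed by the positive integers. -/
noncomputable def lcmMatrix (σ τ : ℝ) (n m : ℕ+) : ℝ :=
  (n : ℝ) ^ σ * (m : ℝ) ^ σ / ((Nat.lcm n m : ℕ) : ℝ) ^ τ

/-- The local matrix `p ^ (σ j) * p ^ (-τ max(j, k)) * p ^ (σ k)`, `j, k = 0, 1, 2, …`. -/
noncomputable def localMatrix (σ τ : ℝ) (p : ℕ) (j k : ℕ) : ℝ :=
  (p : ℝ) ^ (σ * j) * (p : ℝ) ^ (-τ * (max j k : ℕ)) * (p : ℝ) ^ (σ * k)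

/-- The diagonal part of a matrix. -/
def diagonalPart {ι : Type} [DecidableEq ι] (A : ι → ι → ℝ) (i j : ι) : ℝ :=
  if i = j then A i j else 0

/-- The bounded operator `T` on (complex) `ℓ²` acts by the matrix `A`:
`(T x) i = ∑ j, A i j * x j` for all `x` and `i`.  The matrix `A` determines `T`. -/
def ActsByMatrix {ι : Type} (A : ι → ι → ℝ) (T : ℓ²(ι, ℂ) →L[ℂ] ℓ²(ι, ℂ)) : Prop :=
  ∀ (x : ℓ²(ι, ℂ)) (i : ι), HasSum (fun j => (A i j : ℂ) * x j) (T x i)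

/-- `lam 0 ≥ lam 1 ≥ …` lists all the eigenvalues of `T`, in non-increasing order, each one
as often as its multiplicity (the dimension of its eigenspace).  Complex numbers that are not
eigenvalues do not occur in the list, since their eigenspace has dimension `0`. -/
def ListsEigenvalues {ι : Type} (T : ℓ²(ι, ℂ) →L[ℂ] ℓ²(ι, ℂ)) (lam : ℕ → ℝ) : Prop :=
  Antitone lam ∧
    ∀ z : ℂ, Module.rank ℂ (Module.End.eigenspace (T : ℓ²(ι, ℂ) →ₗ[ℂ] ℓ²(ι, ℂ)) z) =
      Cardinal.mk {n : ℕ // (lam n : ℂ) = z}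

/-- The matrix `A` defines a bounded operator on `ℓ²`, this operator is compact, positive
(semi-definite) and has trivial kernel, and `lam` is the non-increasing sequence of its
eigenvalues, repeated according to multiplicity. -/
def HasEigenvalueSequence {ι : Type} (A : ι → ι → ℝ) (lam : ℕ → ℝ) : Prop :=
  ∃ T : ℓ²(ι, ℂ) →L[ℂ] ℓ²(ι, ℂ), ActsByMatrix A T ∧ IsCompactOperator T ∧ T.IsPositive ∧
    (∀ x, T x = 0 → x = 0) ∧ ListsEigenvalues T lam

/-- The eigenvalues `λ_1 ≥ λ_2 ≥ …` of the matrix `A` satisfy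
`λ_n = κ / n ^ ρ + o(n ^ (-ρ))` with `κ > 0`; here `λ_n = lam (n - 1)`. -/
def HasEigenvalueAsymptotics {ι : Type} (A : ι → ι → ℝ) (ρ κ : ℝ) : Prop :=
  0 < κ ∧ ∃ lam : ℕ → ℝ, HasEigenvalueSequence A lam ∧
    (fun n : ℕ => lam n - κ / ((n : ℝ) + 1) ^ ρ) =o[atTop] fun n : ℕ => ((n : ℝ) + 1) ^ (-ρ)

/-- `g = ∏_p (1 - 1/p) ∑_k λ_k(E_p) ^ (1/ρ)`, where `ρ = τ - 2σ` and `λ_0(E_p) ≥ λ_1(E_p) ≥ …`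
are the eigenvalues of the local matrix at the prime `p`; the sums and the product converge. -/
def IsEulerConstant (σ τ g : ℝ) : Prop :=
  ∃ lam : Nat.Primes → ℕ → ℝ,
    (∀ p : Nat.Primes, HasEigenvalueSequence (localMatrix σ τ p) (lam p)) ∧
    (∀ p : Nat.Primes, Summable fun k : ℕ => lam p k ^ (1 / (τ - 2 * σ))) ∧
    HasProd (fun p : Nat.Primes =>
      (1 - 1 / ((p : ℕ) : ℝ)) * ∑' k : ℕ, lam p k ^ (1 / (τ - 2 * σ))) g

/-- The Riemann zeta function at a real argument, as a real number. -/
noncomputable def realZeta (s : ℝ) : ℝ := (riemannZeta (s : ℂ)).re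

/-- For `s > 1`, the case of interest, no information is lost by taking the real part. -/
theorem ofReal_realZeta {s : ℝ} (hs : 1 < s) : (realZeta s : ℂ) = riemannZeta (s : ℂ) := by
  have h : riemannZeta (s : ℂ) = ((∑' n : ℕ, 1 / ((n : ℝ) + 1) ^ s : ℝ) : ℂ) := by
    rw [zeta_eq_tsum_one_div_nat_add_one_cpow (by simpa using hs), Complex.ofReal_tsum]
    refine tsum_congr fun n => ?_
    rw [Complex.ofReal_div, Complex.ofReal_cpow (by positivity)]
    push_cast
    rfl
  rw [realZeta, h, Complex.ofReal_re]

/-! Exponents in a least common multiple are maxima of exponents, so every entry of E is the product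
over p of entries of E_p (`lcmMatrix_eq_tprod`): E is the infinite tensor product of the E_p. Its
eigenvalues are therefore Λ(n) = ∏_p λ_{v_p(n)}(E_p) (`IsPrimeSpectralData.diagonalizes`). Tensor
products of Hilbert spaces are avoided: `Diagonalizes` speaks of entries only, the eigenvectors of E
have infinite products of entries of local eigenvectors as coordinates, and orthogonality,
completeness and diagonalisation follow by expanding infinite products of series
(`hasSum_tprod_finsupp`). Convergence requires λ_0(E_p) - 1 and 1 - |V_p(0,0)|² to be summable over
p, and the phase of V_p(0,0) to be normalised. Both quantities are O(p^(-(τ+ρ))) by a variance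
argument (`Diagonalizes.top_bounds`), whence the condition τ + ρ > 1.

The local matrix is r^(j+k) q^|j-k| with r = p^(-ρ/2) and q = p^(-τ/2). It factors explicitly as
G*G, which shows through min-max that λ_k(E_p) lies between (1-q)/(1+q) · p^(-ρk) and (1-q)^(-2) ·
p^(-ρk) (`exists_operator_weightedToeplitz`, `exists_diagonalizes`).

Put b_p(k) = p^k λ_k(E_p)^(1/ρ) and B(n) = ∏_p b_p(v_p(n)). Then Λ(n)^(1/ρ) = B(n)/n, and counting
eigenvalues means counting the n with n < xB(n). If B involves only finitely many primes, sorting by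
the exponent of each prime gives the density ∏ (1-1/p) ∑_k b_p(k)/p^k
(`tendsto_ncard_weightedBelow`). The remaining primes change B(n) by a factor close to 1 except for
few n, by first and second moments of a product over the prime divisors of n
(`IsTameWeight.tendsto_ncard`). The count is thus asymptotic to gx; inverting it gives λ_n ~
(g/n)^ρ.

For ρ = 1 the sum over k is the trace of E_p, which makes every Euler factor equal to 1. For ρ = 1/2
it is the squared Hilbert–Schmidt norm, and the Euler factor is (1+p^(-s))/(1-p^(-s)) with s = 1+2σ,
whose product is ζ(s)²/ζ(2s) > 1. -/

/-- A real function on an infinite type which is bounded below by each positive `ε` only on a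
finite set can be listed in non-increasing order. -/
theorem exists_equiv_nat_antitone {ι : Type*} [Infinite ι] (Λ : ι → ℝ) (hpos : ∀ i, 0 < Λ i)
    (hfin : ∀ ε > 0, {i | ε ≤ Λ i}.Finite) : ∃ e : ℕ ≃ ι, Antitone (Λ ∘ e) := by
  classical
  -- Ties are broken by a well-order, so `r` is a strict total order; its initial segments are
  -- finite by `hfin`, and the position of an element is the number of its predecessors.
  let r : ι → ι → Prop := fun j i => Λ i < Λ j ∨ (Λ i = Λ j ∧ WellOrderingRel j i)
  have r_fin : ∀ i, {j | r j i}.Finite := fun i => (hfin (Λ i) (hpos i)).subset (by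
    rintro j (h | h)
    · exact h.le
    · exact h.1.le)
  have r_trans : ∀ i j k, r i j → r j k → r i k := by
    rintro i j k (h | h) (h' | h')
    · exact Or.inl (h'.trans h)
    · exact Or.inl (h'.1 ▸ h)
    · exact Or.inl (h.1 ▸ h')
    · exact Or.inr ⟨h'.1.trans h.1, trans_of WellOrderingRel h.2 h'.2⟩
  have r_irrefl : ∀ i, ¬ r i i := by
    rintro i (h | h)
    · exact lt_irrefl _ h
    · exact irrefl_of WellOrderingRel i h.2
  have r_total : ∀ i j, r i j ∨ i = j ∨ r j i := by
    intro i j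
    rcases lt_trichotomy (Λ i) (Λ j) with h | h | h
    · exact Or.inr (Or.inr (Or.inl h))
    · rcases trichotomous_of WellOrderingRel i j with h' | h' | h'
      · exact Or.inl (Or.inr ⟨h.symm, h'⟩)
      · exact Or.inr (Or.inl h')
      · exact Or.inr (Or.inr (Or.inr ⟨h, h'⟩))
    · exact Or.inl (Or.inl h)
  let rank : ι → ℕ := fun i => {j | r j i}.ncard
  have rank_lt : ∀ {i j}, r i j → rank i < rank j := by
    intro i j hij
    refine Set.ncard_lt_ncard ⟨fun k hk => r_trans _ _ _ hk hij, fun h => ?_⟩ (r_fin j)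
    exact r_irrefl i (h hij)
  have rank_inj : Function.Injective rank := by
    intro i j h
    rcases r_total i j with h' | h' | h'
    · exact absurd h (rank_lt h').ne
    · exact h'
    · exact absurd h (rank_lt h').ne'
  have rank_surj : Function.Surjective rank := by
    intro m
    obtain ⟨n, ⟨i, rfl⟩, hm⟩ := (Set.infinite_range_of_injective rank_inj).exists_gt m
    -- The predecessors of `i` are mapped injectively into the numbers below `rank i`, and there are
    -- exactly as many of them; so every smaller rank is attained.
    have himg : rank '' {j | r j i} = Set.Iio (rank i) := by
      refine Set.eq_of_subset_of_ncard_le ?_ ?_ (Set.finite_Iio _)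
      · rintro _ ⟨j, hj, rfl⟩
        exact rank_lt hj
      · rw [Set.ncard_image_of_injective _ rank_inj, ← Finset.coe_Iio, Set.ncard_coe_finset,
          Nat.card_Iio]
    obtain ⟨j, -, hj⟩ := himg.ge (show m ∈ Set.Iio (rank i) from hm)
    exact ⟨j, hj⟩
  refine ⟨(Equiv.ofBijective rank ⟨rank_inj, rank_surj⟩).symm, fun m n hmn => ?_⟩
  set e := Equiv.ofBijective rank ⟨rank_inj, rank_surj⟩
  by_contra! hlt
  have h := rank_lt (show r (e.symm n) (e.symm m) from Or.inl hlt)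
  have h1 : rank (e.symm n) = n := e.apply_symm_apply n
  have h2 : rank (e.symm m) = m := e.apply_symm_apply m
  omega

/-! ### Diagonal operators on ℓ² -/

/-- Multiplication of square summable sequences by a bounded real sequence. -/
noncomputable def diagOp {κ : Type} (a : κ → ℝ) (C : ℝ) (h : ∀ i, |a i| ≤ C) :
    ℓ²(κ, ℂ) →L[ℂ] ℓ²(κ, ℂ) :=
  LinearMap.mkContinuous
    { toFun := fun x => ⟨fun i => (a i : ℂ) * x i, by
        refine memℓp_gen (Summable.of_nonneg_of_le (fun i => by positivity) (fun i => ?_)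
          ((lp.memℓp x).summable (by norm_num) |>.mul_left (C ^ (2 : ENNReal).toReal)))
        rw [norm_mul, Real.mul_rpow (norm_nonneg _) (norm_nonneg _)]
        gcongr
        simpa using h i⟩
      map_add' := fun x y => by ext i; simp [mul_add]; rfl
      -- The absolute value is taken because `C` may be negative when the index type is empty.
      map_smul' := fun c x => by ext i; simp; ring } |C| (by
    intro x
    have h2 : (0 : ℝ) < (2 : ENNReal).toReal := by norm_num
    refine lp.norm_le_of_forall_sum_le h2 (by positivity) (fun s => ?_)
    rw [Real.mul_rpow (abs_nonneg _) (norm_nonneg _)]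
    calc _ ≤ ∑ i ∈ s, |C| ^ (2 : ENNReal).toReal * ‖x i‖ ^ (2 : ENNReal).toReal := by
          refine Finset.sum_le_sum fun i _ => ?_
          simp only [LinearMap.coe_mk, AddHom.coe_mk]
          rw [norm_mul, Real.mul_rpow (norm_nonneg _) (norm_nonneg _)]
          gcongr
          simpa using (h i).trans (le_abs_self C)
      _ ≤ _ := by
          rw [← Finset.mul_sum]
          gcongr
          exact lp.sum_rpow_le_norm_rpow h2 x s)

@[simp]
theorem diagOp_apply {κ : Type} (a : κ → ℝ) (C : ℝ) (h : ∀ i, |a i| ≤ C) (x : ℓ²(κ, ℂ)) (i : κ) :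
    diagOp a C h x i = a i * x i := rfl

theorem norm_diagOp_le {κ : Type} (a : κ → ℝ) (C : ℝ) (h : ∀ i, |a i| ≤ C) {K : ℝ} (hK : 0 ≤ K)
    (h' : ∀ i, |a i| ≤ K) : ‖diagOp a C h‖ ≤ K := by
  have : diagOp a C h = diagOp a K h' := by ext x i; simp
  rw [this]
  exact (LinearMap.mkContinuous_norm_le _ (abs_nonneg K) _).trans_eq (abs_of_nonneg hK)

theorem diagOp_isPositive {κ : Type} (a : κ → ℝ) (C : ℝ) (h : ∀ i, |a i| ≤ C)
    (h0 : ∀ i, 0 ≤ a i) : (diagOp a C h).IsPositive := by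
  rw [ContinuousLinearMap.isPositive_def]
  refine ⟨fun x y => ?_, fun x => ?_⟩
  · simp only [ContinuousLinearMap.coe_coe, lp.inner_eq_tsum, diagOp_apply, RCLike.inner_apply,
      map_mul]
    refine tsum_congr fun i => ?_
    simp
    ring
  · rw [ContinuousLinearMap.reApplyInnerSelf_apply, lp.inner_eq_tsum]
    simp only [diagOp_apply, RCLike.inner_apply, map_mul]
    have hs := lp.summable_inner (𝕜 := ℂ) (diagOp a C h x) x
    rw [RCLike.re_tsum]
    · refine tsum_nonneg fun i => ?_
      have : x i * ((starRingEnd ℂ) (a i : ℂ) * (starRingEnd ℂ) (x i)) =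
          ((a i * ‖x i‖ ^ 2 : ℝ) : ℂ) := by
        rw [mul_left_comm, Complex.mul_conj']; simp
      rw [this]
      rw [RCLike.re_eq_complex_re, Complex.ofReal_re]
      exact mul_nonneg (h0 i) (sq_nonneg ‖x i‖)
    · simpa [RCLike.inner_apply] using hs

/-- Truncation to finitely many coordinates gives finite rank operators, and these converge in norm
because only finitely many entries exceed any given ε. -/
theorem diagOp_isCompactOperator {κ : Type} (a : κ → ℝ) (C : ℝ) (h : ∀ i, |a i| ≤ C)
    (h0 : ∀ ε > 0, {i | ε ≤ |a i|}.Finite) : IsCompactOperator (diagOp a C h) := by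
  classical
  have hC : ∀ (s : Finset κ) i, |if i ∈ s then a i else 0| ≤ |C| := fun s i => by
    split_ifs
    · exact (h i).trans (le_abs_self C)
    · simp
  have hC' : ∀ (s : Finset κ) i, |if i ∈ s then 0 else a i| ≤ |C| := fun s i => by
    split_ifs
    · simp
    · exact (h i).trans (le_abs_self C)
  refine isCompactOperator_of_tendsto (l := (atTop : Filter (Finset κ)))
    (F := fun s => diagOp (fun i => if i ∈ s then a i else 0) |C| (hC s)) ?_ ?_
  · rw [tendsto_iff_norm_sub_tendsto_zero]
    have hsub : ∀ s : Finset κ, ‖diagOp (fun i => if i ∈ s then a i else 0) |C| (hC s) -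
        diagOp a C h‖ = ‖diagOp (fun i => if i ∈ s then 0 else a i) |C| (hC' s)‖ := by
      intro s
      rw [← norm_neg]
      congr 1
      ext x i
      simp only [neg_apply, sub_apply, lp.coeFn_neg,
        lp.coeFn_sub, Pi.neg_apply, Pi.sub_apply, diagOp_apply]
      split_ifs <;> simp
    simp only [hsub]
    rw [Metric.tendsto_atTop]
    intro ε hε
    refine ⟨(h0 (ε / 2) (by positivity)).toFinset, fun s hs => ?_⟩
    rw [Real.dist_eq, sub_zero, abs_of_nonneg (norm_nonneg _)]
    refine (norm_diagOp_le _ _ _ (by positivity : 0 ≤ ε / 2) fun i => ?_).trans_lt (by linarith)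
    split_ifs with hi
    · simpa using (half_pos hε).le
    · by_contra! hlt
      exact hi (hs (by simpa using hlt.le))
  · refine Eventually.of_forall fun s => ?_
    have : (diagOp (fun i => if i ∈ s then a i else 0) |C| (hC s) : ℓ²(κ, ℂ) →L[ℂ] ℓ²(κ, ℂ)) =
        ∑ i ∈ s, ((innerSL ℂ (lp.single 2 i (1 : ℂ) : ℓ²(κ, ℂ))).smulRight
          ((a i : ℂ) • (lp.single 2 i (1 : ℂ) : ℓ²(κ, ℂ)))) := by
      ext x i
      simp only [diagOp_apply, sum_apply, lp.coeFn_sum, Finset.sum_apply,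
        ContinuousLinearMap.smulRight_apply, lp.coeFn_smul, Pi.smul_apply, innerSL_apply_apply,
        lp.inner_single_left, lp.single_apply, Pi.single_apply]
      simp
      split_ifs <;> simp [mul_comm]
    rw [this]
    refine Submodule.sum_mem (compactOperator (RingHom.id ℂ) ℓ²(κ, ℂ) ℓ²(κ, ℂ)) fun i _ => ?_
    exact (isCompactOperator_of_locallyCompactSpace_rng
      (T := ContinuousLinearMap.toSpanSingleton ℂ
        ((a i : ℂ) • (lp.single 2 i (1 : ℂ) : ℓ²(κ, ℂ))))).comp_clm
      (innerSL ℂ (lp.single 2 i (1 : ℂ) : ℓ²(κ, ℂ)))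


theorem HasSum.of_forall_eq {ι M : Type*} [AddCommMonoid M] [TopologicalSpace M] {f g : ι → M}
    {a : M} (h : HasSum f a) (hfg : ∀ i, g i = f i) : HasSum g a := by
  rwa [funext hfg]

/-! ### From entrywise diagonalisation to operators and lists of eigenvalues -/

/-- Eigenvalues of an operator which is diagonal with respect to a Hilbert basis. -/
theorem listsEigenvalues_of_hilbertBasis {ι : Type} {T : ℓ²(ι, ℂ) →L[ℂ] ℓ²(ι, ℂ)}
    (hT : T.IsPositive) {lam : ℕ → ℝ} (b : HilbertBasis ℕ ℂ ℓ²(ι, ℂ))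
    (hb : ∀ n, T (b n) = (lam n : ℂ) • b n) (hanti : Antitone lam) (hpos : ∀ n, 0 < lam n)
    (hlim : Tendsto lam atTop (𝓝 0)) : ListsEigenvalues T lam := by
  classical
  refine ⟨hanti, fun z => ?_⟩
  -- Finite multiplicity turns the expansion of an eigenvector in the Hilbert basis into a finite
  -- sum, so the eigenspace is an algebraic span and its rank can be read off.
  have hfin : {n : ℕ | (lam n : ℂ) = z}.Finite := by
    by_cases hz : z = 0
    · convert Set.finite_empty (α := ℕ)
      ext n
      simp [hz, (hpos n).ne']
    · have hz' : 0 < ‖z‖ := norm_pos_iff.mpr hz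
      have := hlim.eventually (gt_mem_nhds hz')
      rw [eventually_atTop] at this
      obtain ⟨N, hN⟩ := this
      refine (Set.finite_Iio N).subset fun n hn => ?_
      by_contra! h
      have h1 := hN n (by simpa using h)
      rw [← (show (lam n : ℂ) = z from hn), Complex.norm_real, Real.norm_eq_abs,
        abs_of_pos (hpos n)] at h1
      exact lt_irrefl _ h1
  have hspan : Module.End.eigenspace (T : ℓ²(ι, ℂ) →ₗ[ℂ] ℓ²(ι, ℂ)) z =
      Submodule.span ℂ (Set.range fun n : {n : ℕ // (lam n : ℂ) = z} => b n) := by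
    apply le_antisymm
    · intro x hx
      rw [Module.End.mem_eigenspace_iff] at hx
      have hx' : T x = z • x := hx
      have hcoord : ∀ n, (lam n : ℂ) ≠ z → b.repr x n = 0 := by
        intro n hn
        rw [b.repr_apply_apply]
        have h1 : inner ℂ (T (b n)) x = inner ℂ (b n) (T x) := hT.inner_left_eq_inner_right _ _
        rw [hb, hx', inner_smul_left, inner_smul_right, Complex.conj_ofReal] at h1
        by_contra h0
        exact hn (mul_right_cancel₀ h0 h1)
      have hs := b.hasSum_repr x
      have h2 := hs.unique (hasSum_sum_of_ne_finset_zero (s := hfin.toFinset) fun n hn => by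
        rw [hcoord n (by simpa using hn), zero_smul])
      rw [h2]
      refine Submodule.sum_mem _ fun n hn => Submodule.smul_mem _ _ (Submodule.subset_span ?_)
      exact ⟨⟨n, by simpa using hn⟩, rfl⟩
    · rw [Submodule.span_le]
      rintro _ ⟨n, rfl⟩
      rw [SetLike.mem_coe, Module.End.mem_eigenspace_iff]
      have := hb n
      rw [n.2] at this
      exact this
  have hli : LinearIndependent ℂ (fun n : {n : ℕ // (lam n : ℂ) = z} => b n) :=
    b.orthonormal.linearIndependent.comp _ Subtype.val_injective
  rw [hspan, rank_span hli, Cardinal.mk_range_eq _ hli.injective]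

/-- The matrix `A` is diagonalised by the unitary matrix `V` with the eigenvalues `lam`. -/
structure Diagonalizes {ι κ : Type} (A : ι → ι → ℝ) (lam : κ → ℝ) (V : κ → ι → ℂ) : Prop where
  rows : ∀ k l, HasSum (fun i => V k i * (starRingEnd ℂ) (V l i)) (open Classical in if k = l then 1 else 0)
  cols : ∀ i j, HasSum (fun k => V k i * (starRingEnd ℂ) (V k j)) (open Classical in if i = j then 1 else 0)
  diag : ∀ i j, HasSum (fun k => lam k * (V k i * (starRingEnd ℂ) (V k j))) (A i j : ℂ)

theorem Diagonalizes.hasSum_norm_sq_row {ι κ : Type} {A : ι → ι → ℝ} {lam : κ → ℝ}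
    {V : κ → ι → ℂ} (h : Diagonalizes A lam V) (k : κ) : HasSum (fun i => ‖V k i‖ ^ 2) 1 := by
  have := h.rows k k
  simp only [Complex.mul_conj', if_true] at this
  rw [← Complex.hasSum_ofReal]
  simpa using this

theorem Diagonalizes.hasSum_norm_sq_col {ι κ : Type} {A : ι → ι → ℝ} {lam : κ → ℝ}
    {V : κ → ι → ℂ} (h : Diagonalizes A lam V) (i : ι) : HasSum (fun k => ‖V k i‖ ^ 2) 1 := by
  have := h.cols i i
  simp only [Complex.mul_conj', if_true] at this
  rw [← Complex.hasSum_ofReal]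
  simpa using this

theorem Diagonalizes.hasSum_mul_norm_sq {ι κ : Type} {A : ι → ι → ℝ} {lam : κ → ℝ}
    {V : κ → ι → ℂ} (h : Diagonalizes A lam V) (i : ι) :
    HasSum (fun k => lam k * ‖V k i‖ ^ 2) (A i i) := by
  have := h.diag i i
  simp only [Complex.mul_conj'] at this
  rw [← Complex.hasSum_ofReal]
  simpa using this

theorem Diagonalizes.comp_equiv {ι κ ι' κ' : Type} {A : ι → ι → ℝ} {lam : κ → ℝ}
    {V : κ → ι → ℂ} (h : Diagonalizes A lam V) (e : ι' ≃ ι) (f : κ' ≃ κ) :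
    Diagonalizes (fun i j => A (e i) (e j)) (lam ∘ f) (fun k i => V (f k) (e i)) where
  rows k l := by
    have := (e.hasSum_iff).mpr (h.rows (f k) (f l))
    by_cases hkl : k = l
    · subst hkl; simpa [Function.comp_def] using this
    · simpa [Function.comp_def, hkl] using this
  cols i j := by
    have := (f.hasSum_iff).mpr (h.cols (e i) (e j))
    by_cases hij : i = j
    · subst hij; simpa [Function.comp_def] using this
    · simpa [Function.comp_def, hij] using this
  diag i j := (f.hasSum_iff).mpr (h.diag (e i) (e j))

/-- An orthonormal family in `ℓ²` which satisfies Parseval's identity for the unit vectors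
is total. -/
theorem span_orthogonal_eq_bot_of_hasSum {ι κ : Type} {v : κ → ℓ²(ι, ℂ)} (hv : Orthonormal ℂ v)
    (hp : ∀ i, HasSum (fun k => ‖v k i‖ ^ 2) 1) : (Submodule.span ℂ (Set.range v))ᗮ = ⊥ := by
  classical
  rw [Submodule.eq_bot_iff]
  intro x hx
  by_contra hx0
  have hnorm : ‖x‖ ≠ 0 := norm_ne_zero_iff.mpr hx0
  have hperp : ∀ k, inner ℂ (v k) x = 0 := fun k =>
    (Submodule.mem_orthogonal _ _).mp hx _ (Submodule.subset_span ⟨k, rfl⟩)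
  let u : ℓ²(ι, ℂ) := (‖x‖⁻¹ : ℂ) • x
  have hu : ∀ k, inner ℂ (v k) u = 0 := fun k => by rw [inner_smul_right, hperp k, mul_zero]
  have hu1 : ‖u‖ = 1 := by simp [u, norm_smul, hnorm]
  -- Adjoining a unit vector `u` orthogonal to the family keeps it orthonormal. Bessel's inequality
  -- for the i-th unit vector then reads |u_i|² + 1 ≤ 1.
  have hort : Orthonormal ℂ (fun o : Option κ => o.elim u v) := by
    constructor
    · rintro (_ | k)
      · exact hu1
      · exact hv.1 k
    · rintro (_ | k) (_ | l) hkl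
      · exact absurd rfl hkl
      · change inner ℂ u (v l) = 0
        rw [← inner_conj_symm, hu, map_zero]
      · exact hu k
      · exact hv.2 (fun h => hkl (congrArg some h))
  have hcoord : ∀ (y : ℓ²(ι, ℂ)) (i : ι), ‖inner ℂ y (lp.single 2 i (1 : ℂ) : ℓ²(ι, ℂ))‖ = ‖y i‖ :=
    fun y i => by rw [lp.inner_single_right]; simp
  have hzero : ∀ i, u i = 0 := by
    intro i
    have h1 := hort.tsum_inner_products_le (lp.single 2 i (1 : ℂ) : ℓ²(ι, ℂ))
    have h2 := hort.inner_products_summable (lp.single 2 i (1 : ℂ) : ℓ²(ι, ℂ))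
    have h3 : HasSum (fun o : Option κ => ‖(o.elim u v : ℓ²(ι, ℂ)) i‖ ^ 2) (‖u i‖ ^ 2 + 1) := by
      rw [← (Equiv.optionEquivSumPUnit.{0} κ).symm.hasSum_iff, add_comm]
      refine HasSum.sum ?_ ?_
      · exact hp i
      · exact hasSum_unique _
    simp only [hcoord] at h1
    rw [h3.tsum_eq, lp.norm_single (by norm_num)] at h1
    have : ‖u i‖ ^ 2 ≤ 0 := by simpa using h1
    have := pow_eq_zero_iff (two_ne_zero) |>.mp (le_antisymm this (sq_nonneg _))
    simpa using this
  have : u = 0 := by ext i; simpa using hzero i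
  rw [this, norm_zero] at hu1
  exact zero_ne_one hu1

/-- Row orthogonality is orthonormality of the family; the diagonal column relations are Parseval's
identity for the unit vectors, which forces totality. -/
theorem Diagonalizes.exists_hilbertBasis {ι κ : Type} {A : ι → ι → ℝ} {lam : κ → ℝ}
    {V : κ → ι → ℂ} (h : Diagonalizes A lam V) :
    ∃ b : HilbertBasis κ ℂ ℓ²(ι, ℂ), ∀ k i, b k i = V k i := by
  classical
  let v : κ → ℓ²(ι, ℂ) := fun k => ⟨V k, memℓp_gen (by
    simpa using (h.hasSum_norm_sq_row k).summable)⟩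
  have hv : Orthonormal ℂ v := by
    rw [orthonormal_iff_ite]
    intro k l
    rw [lp.inner_eq_tsum]
    simp only [RCLike.inner_apply, v]
    have := (h.rows l k).tsum_eq
    rw [this]
    congr 1
    exact propext eq_comm
  refine ⟨HilbertBasis.mkOfOrthogonalEqBot hv
    (span_orthogonal_eq_bot_of_hasSum hv h.hasSum_norm_sq_col), fun k i => ?_⟩
  rw [HilbertBasis.coe_mkOfOrthogonalEqBot]

/-- The entries of an operator acting by a real matrix which is symmetric. -/
theorem actsByMatrix_of_hasSum {ι κ : Type} {A : ι → ι → ℝ} {lam : κ → ℝ}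
    {T : ℓ²(ι, ℂ) →L[ℂ] ℓ²(ι, ℂ)} (hT : T.IsPositive) (b : HilbertBasis κ ℂ ℓ²(ι, ℂ))
    (hb : ∀ n, T (b n) = (lam n : ℂ) • b n)
    (hA : ∀ i j, HasSum (fun k => lam k * (b k i * (starRingEnd ℂ) (b k j))) (A i j : ℂ)) :
    ActsByMatrix A T := by
  classical
  intro x i
  let e : ι → ℓ²(ι, ℂ) := fun i => lp.single 2 i (1 : ℂ)
  have he : ∀ (y : ℓ²(ι, ℂ)) i, inner ℂ (e i) y = y i := fun y i => by
    simp [e, lp.inner_single_left]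
  have he' : ∀ (y : ℓ²(ι, ℂ)) i, inner ℂ y (e i) = (starRingEnd ℂ) (y i) := fun y i => by
    rw [← inner_conj_symm, he]
  have hcol : ∀ j, (starRingEnd ℂ) (T (e i) j) = A i j := by
    intro j
    have h1 := b.hasSum_inner_mul_inner (T (e i)) (e j)
    rw [he'] at h1
    refine h1.unique ?_
    refine (hA i j).of_forall_eq fun k => ?_
    rw [hT.inner_left_eq_inner_right, hb, inner_smul_right, he, he', mul_assoc]
  have h2 := lp.hasSum_inner (𝕜 := ℂ) (T (e i)) x
  rw [hT.inner_left_eq_inner_right, he] at h2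
  refine h2.of_forall_eq fun j => ?_
  rw [RCLike.inner_apply, hcol, mul_comm]

/-- The operator is the diagonal operator of `lam` conjugated by the coordinate isometry of the
eigenbasis, from which it inherits compactness, positivity and injectivity. -/
theorem Diagonalizes.hasEigenvalueSequence {ι : Type} {A : ι → ι → ℝ} {lam : ℕ → ℝ}
    {V : ℕ → ι → ℂ} (h : Diagonalizes A lam V) (hanti : Antitone lam) (hpos : ∀ n, 0 < lam n)
    (hlim : Tendsto lam atTop (𝓝 0)) : HasEigenvalueSequence A lam := by
  classical
  obtain ⟨b, hbV⟩ := h.exists_hilbertBasis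
  have habs : ∀ n, |lam n| ≤ lam 0 := fun n => by
    rw [abs_of_pos (hpos n)]; exact hanti (Nat.zero_le n)
  let D := diagOp lam (lam 0) habs
  let R : ℓ²(ι, ℂ) →L[ℂ] ℓ²(ℕ, ℂ) := b.repr.toContinuousLinearEquiv
  let R' : ℓ²(ℕ, ℂ) →L[ℂ] ℓ²(ι, ℂ) := b.repr.symm.toContinuousLinearEquiv
  let T : ℓ²(ι, ℂ) →L[ℂ] ℓ²(ι, ℂ) := R' ∘L D ∘L R
  have hTapp : ∀ x, T x = b.repr.symm (D (b.repr x)) := fun x => rfl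
  have hDpos : D.IsPositive := diagOp_isPositive _ _ _ fun n => (hpos n).le
  have hTpos : T.IsPositive := by
    rw [ContinuousLinearMap.isPositive_def]
    have key : ∀ x y, inner ℂ (T x) y = inner ℂ (D (b.repr x)) (b.repr y) := fun x y => by
      rw [hTapp, ← b.repr.inner_map_map, LinearIsometryEquiv.apply_symm_apply]
    refine ⟨fun x y => ?_, fun x => ?_⟩
    · change inner ℂ (T x) y = inner ℂ x (T y)
      rw [key, ← inner_conj_symm x, key, hDpos.inner_left_eq_inner_right, inner_conj_symm]
    · rw [ContinuousLinearMap.reApplyInnerSelf_apply, key]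
      exact hDpos.re_inner_nonneg_left _
  have hTb : ∀ n, T (b n) = (lam n : ℂ) • b n := by
    intro n
    apply b.repr.injective
    rw [hTapp, LinearIsometryEquiv.apply_symm_apply, map_smul, b.repr_self]
    ext i
    simp only [D, diagOp_apply, lp.single_apply, lp.coeFn_smul, Pi.smul_apply, Pi.single_apply,
      smul_eq_mul]
    split_ifs with hi
    · rw [hi]
    · simp
  have hTc : IsCompactOperator T := by
    refine ((diagOp_isCompactOperator lam (lam 0) habs fun ε hε => ?_).comp_clm R).clm_comp R'
    obtain ⟨N, hN⟩ := eventually_atTop.mp (hlim.eventually (gt_mem_nhds hε))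
    refine (Set.finite_Iio N).subset fun n hn => ?_
    by_contra! h
    have h1 : ε ≤ |lam n| := hn
    rw [abs_of_pos (hpos n)] at h1
    exact absurd (hN n (by simpa using h)) (not_lt.mpr h1)
  refine ⟨T, ?_, hTc, hTpos, fun x hx => ?_, listsEigenvalues_of_hilbertBasis hTpos b hTb hanti
    hpos hlim⟩
  · refine actsByMatrix_of_hasSum hTpos b hTb fun i j => ?_
    simpa only [hbV] using h.diag i j
  · rw [hTapp, LinearIsometryEquiv.map_eq_zero_iff] at hx
    rw [← b.repr.map_eq_zero_iff]
    ext n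
    have := congrArg (fun y : ℓ²(ℕ, ℂ) => y n) hx
    simpa [D, (hpos n).ne'] using this



/-! ### The spectral theorem and min-max bounds -/

/-- An orthonormal family of eigenvectors of a compact operator has only finitely many members
with eigenvalue at least `ε`. -/
theorem finite_setOf_le_eigenvalue {K H : Type*} [NormedAddCommGroup H] [InnerProductSpace ℂ H]
    {T : H →L[ℂ] H} (hc : IsCompactOperator T) {v : K → H} (hv : Orthonormal ℂ v) {μ : K → ℝ}
    (hT : ∀ k, T (v k) = (μ k : ℂ) • v k) {ε : ℝ} (hε : 0 < ε) : {k : K | ε ≤ μ k}.Finite := by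
  by_contra hinf
  obtain ⟨f⟩ : Nonempty (ℕ ↪ {k : K | ε ≤ μ k}) := ⟨Set.Infinite.natEmbedding _ hinf⟩
  obtain ⟨S, hS, hsub⟩ := hc.image_closedBall_subset_compact 1
  obtain ⟨y, -, φ, hφ, hlim⟩ := hS.tendsto_subseq (x := fun n => T (v (f n).1)) fun n =>
    hsub ⟨v (f n).1, by simp [hv.1], rfl⟩
  have hcau := hlim.cauchySeq
  rw [Metric.cauchySeq_iff] at hcau
  obtain ⟨N, hN⟩ := hcau ε hε
  have h1 := hN N le_rfl (N + 1) (Nat.le_succ N)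
  have hne : (f (φ N)).1 ≠ (f (φ (N + 1))).1 := fun h => by
    have := hφ.injective (f.injective (Subtype.ext h))
    omega
  simp only [Function.comp] at h1
  rw [dist_eq_norm] at h1
  -- The images of distinct eigenvectors are orthogonal, each of norm at least ε, hence at distance
  -- at least ε; no subsequence of them is Cauchy.
  have h2 : ‖T (v (f (φ N)).1) - T (v (f (φ (N + 1))).1)‖ ^ 2 =
      ‖T (v (f (φ N)).1)‖ ^ 2 + ‖T (v (f (φ (N + 1))).1)‖ ^ 2 := by
    have := norm_sub_sq (𝕜 := ℂ) (T (v (f (φ N)).1)) (T (v (f (φ (N + 1))).1))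
    rw [this, hT, hT, inner_smul_left, inner_smul_right, hv.2 hne]
    simp
  have h3 : ε ≤ ‖T (v (f (φ N)).1)‖ := by
    rw [hT, norm_smul, hv.1, mul_one, Complex.norm_real, Real.norm_eq_abs]
    exact (f (φ N)).2.trans (le_abs_self _)
  nlinarith [norm_nonneg (T (v (f (φ N)).1) - T (v (f (φ (N + 1))).1)),
    norm_nonneg (T (v (f (φ (N + 1))).1))]

theorem infinite_of_hilbertBasis_nat {K : Type*} (b : HilbertBasis K ℂ ℓ²(ℕ, ℂ)) : Infinite K := by
  classical
  by_contra hK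
  rw [not_infinite_iff_finite] at hK
  have : Fintype K := Fintype.ofFinite K
  have h1 : FiniteDimensional ℂ ℓ²(ℕ, ℂ) :=
    b.toOrthonormalBasis.toBasis.finiteDimensional_of_finite
  have h2 := (HilbertBasis.ofRepr
    (LinearIsometryEquiv.refl ℂ ℓ²(ℕ, ℂ))).orthonormal.linearIndependent
  exact not_finite_iff_infinite.mpr inferInstance h2.finite

/-- The eigenvectors of a compact positive operator are total. -/
theorem exists_orthonormal_eigenvectors {H : Type} [NormedAddCommGroup H]
    [InnerProductSpace ℂ H] [CompleteSpace H] {T : H →L[ℂ] H}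
    (hc : IsCompactOperator T) (hp : T.IsPositive) :
    ∃ (K : Type) (μ : K → ℂ) (v : K → H), Orthonormal ℂ v ∧
      (Submodule.span ℂ (Set.range v))ᗮ = ⊥ ∧ ∀ k, T (v k) = μ k • v k := by
  classical
  let G : ℂ → Submodule ℂ H := fun z =>
    Module.End.eigenspace (T : H →ₗ[ℂ] H) z
  have hsymm : (T : H →ₗ[ℂ] H).IsSymmetric := hp.isSymmetric
  have hfam : OrthogonalFamily ℂ (fun z => G z) fun z => (G z).subtypeₗᵢ :=
    hsymm.orthogonalFamily_eigenspaces
  have hG : ∀ z x, x ∈ G z ↔ T x = z • x := fun z x => Module.End.mem_eigenspace_iff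
  have hcomplete : ∀ z, CompleteSpace (G z) := fun z => by
    have : IsClosed (G z : Set H) := by
      have : (G z : Set H) = {x | T x = z • x} := by ext x; exact hG z x
      rw [this]
      exact isClosed_eq T.continuous (continuous_const_smul z)
    exact this.completeSpace_coe
  -- Eigenspaces are closed and mutually orthogonal, so the union of orthonormal bases of all of
  -- them is orthonormal.
  choose w B hB using fun z => exists_hilbertBasis ℂ (G z)
  let K := Σ z, w z
  let v : K → H := fun k => ((B k.1 k.2 : G k.1) : H)
  have hv : Orthonormal ℂ v := hfam.orthonormal_sigma_orthonormal fun z => (B z).orthonormal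
  have hvT : ∀ k, T (v k) = k.1 • v k := fun k => (hG _ _).mp (B k.1 k.2).2
  have htot : (Submodule.span ℂ (Set.range v))ᗮ = ⊥ := by
    rw [eq_bot_iff, ← ContinuousLinearMap.orthogonalComplement_iSup_eigenspaces_eq_bot hc hsymm]
    intro x hx
    rw [Submodule.mem_orthogonal] at hx
    rw [← Submodule.iInf_orthogonal, Submodule.mem_iInf]
    intro z
    rw [Submodule.mem_orthogonal]
    intro y hy
    have h1 := (B z).hasSum_repr ⟨y, hy⟩
    have h2 := ((innerSL ℂ x).comp (G z).subtypeL).hasSum h1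
    rw [← inner_conj_symm]
    have h3 : ∀ i, inner ℂ x ((B z i : G z) : H) = 0 := fun i => by
      rw [← inner_conj_symm, hx _ (Submodule.subset_span ⟨⟨z, i⟩, rfl⟩), map_zero]
    have h4 := h2.unique (by
      convert hasSum_zero using 2 with i
      simp [h3])
    simp at h4
    rw [h4, map_zero]
  exact ⟨K, fun k => k.1, v, hv, htot, hvT⟩

/-- The spectral theorem for compact positive injective operators on `ℓ²(ℕ)`. -/
theorem exists_hilbertBasis_eigenvectors {T : ℓ²(ℕ, ℂ) →L[ℂ] ℓ²(ℕ, ℂ)}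
    (hc : IsCompactOperator T) (hp : T.IsPositive) (h0 : ∀ x, T x = 0 → x = 0) :
    ∃ (lam : ℕ → ℝ) (b : HilbertBasis ℕ ℂ ℓ²(ℕ, ℂ)), Antitone lam ∧ (∀ n, 0 < lam n) ∧
      Tendsto lam atTop (𝓝 0) ∧ ∀ n, T (b n) = (lam n : ℂ) • b n := by
  obtain ⟨K, μ, v, hv, htot, hvT⟩ := exists_orthonormal_eigenvectors hc hp
  have hvne : ∀ k, v k ≠ 0 := fun k => hv.ne_zero k
  have hreal : ∀ k, (((μ k).re : ℝ) : ℂ) = μ k := by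
    intro k
    have h1 : inner ℂ (T (v k)) (v k) = inner ℂ (v k) (T (v k)) :=
      hp.inner_left_eq_inner_right _ _
    rw [hvT, inner_smul_left, inner_smul_right] at h1
    have := mul_right_cancel₀ (inner_self_ne_zero.mpr (hvne k)) h1
    exact (Complex.conj_eq_iff_re.mp this)
  have hpos : ∀ k, 0 < (μ k).re := by
    intro k
    have h1 := hp.re_inner_nonneg_right (v k)
    rw [hvT, inner_smul_right, inner_self_eq_norm_sq_to_K, hv.1 k] at h1
    have h2 : 0 ≤ (μ k).re := by simpa using h1
    refine lt_of_le_of_ne h2 fun h3 => hvne k (h0 _ ?_)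
    rw [hvT, ← hreal, ← h3]
    simp
  have hTr : ∀ k, T (v k) = (((μ k).re : ℝ) : ℂ) • v k := fun k => by rw [hreal, hvT]
  have hfin : ∀ ε > 0, {k : K | ε ≤ (μ k).re}.Finite := fun ε hε =>
    finite_setOf_le_eigenvalue hc hv hTr hε
  have hinf : Infinite K :=
    infinite_of_hilbertBasis_nat (HilbertBasis.mkOfOrthogonalEqBot hv htot)
  obtain ⟨e, he⟩ := exists_equiv_nat_antitone (fun k : K => (μ k).re) hpos hfin
  have hort : Orthonormal ℂ fun n => v (e n) := hv.comp _ e.injective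
  have htot' : (Submodule.span ℂ (Set.range fun n => v (e n)))ᗮ = ⊥ := by
    rw [← htot]
    congr 2
    exact e.surjective.range_comp v
  refine ⟨fun n => (μ (e n)).re, HilbertBasis.mkOfOrthogonalEqBot hort htot', he, fun n => hpos _,
    ?_, fun n => ?_⟩
  · rw [Metric.tendsto_atTop]
    intro ε hε
    have := ((hfin ε hε).preimage e.injective.injOn)
    obtain ⟨N, hN⟩ := this.bddAbove
    refine ⟨N + 1, fun n hn => ?_⟩
    rw [Real.dist_eq, sub_zero, abs_of_pos (hpos _)]
    by_contra! h
    have := hN (show n ∈ e ⁻¹' {k : K | ε ≤ (μ k).re} from h)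
    omega
  · rw [HilbertBasis.coe_mkOfOrthogonalEqBot]
    exact hTr _


/-- For two Hilbert bases some nonzero vector is orthogonal to the first `k` vectors of one of
them and to all but the first `k + 1` vectors of the other. -/
theorem exists_ne_zero_inner_eq_zero {H : Type*} [NormedAddCommGroup H] [InnerProductSpace ℂ H]
    (b b' : HilbertBasis ℕ ℂ H) (k : ℕ) :
    ∃ x : H, x ≠ 0 ∧ (∀ j < k, inner ℂ (b j) x = 0) ∧ ∀ j > k, inner ℂ (b' j) x = 0 := by
  let S : (Fin (k + 1) → ℂ) →ₗ[ℂ] H := Fintype.linearCombination ℂ fun i : Fin (k + 1) => b' i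
  let F : H →ₗ[ℂ] (Fin k → ℂ) := LinearMap.pi fun i : Fin k => (innerSL ℂ (b i)).toLinearMap
  -- A vector in the span of the first k + 1 members of `b'` has k + 1 free coefficients, against k
  -- orthogonality conditions.
  have hker : LinearMap.ker (F ∘ₗ S) ≠ ⊥ := LinearMap.ker_ne_bot_of_finrank_lt (by simp)
  obtain ⟨c, hc, hc0⟩ := Submodule.exists_mem_ne_zero_of_ne_bot hker
  have hli : LinearIndependent ℂ fun i : Fin (k + 1) => b' i :=
    b'.orthonormal.linearIndependent.comp _ Fin.val_injective
  refine ⟨S c, fun h => hc0 ?_, fun j hj => ?_, fun j hj => ?_⟩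
  · exact (linearIndependent_iff_injective_fintypeLinearCombination.mp hli) (by rw [map_zero]; exact h)
  · exact congrFun (LinearMap.mem_ker.mp hc) ⟨j, hj⟩
  · simp only [S, Fintype.linearCombination_apply, inner_sum, inner_smul_right]
    refine Finset.sum_eq_zero fun i _ => ?_
    rw [b'.orthonormal.2 (by have := i.2; omega), mul_zero]

theorem hasSum_norm_sq_inner {H κ : Type*} [NormedAddCommGroup H] [InnerProductSpace ℂ H]
    (b : HilbertBasis κ ℂ H) (x : H) : HasSum (fun k => ‖inner ℂ (b k) x‖ ^ 2) (‖x‖ ^ 2) := by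
  have h := b.hasSum_inner_mul_inner x x
  rw [← Complex.hasSum_ofReal]
  rw [inner_self_eq_norm_sq_to_K] at h
  convert! h using 1
  · funext k
    rw [← inner_conj_symm x, mul_comm, Complex.mul_conj']
    simp
  · simp

theorem hasSum_mul_norm_sq_inner {H κ : Type*} [NormedAddCommGroup H] [InnerProductSpace ℂ H]
    [CompleteSpace H] {T : H →L[ℂ] H} (hT : T.IsPositive) (b : HilbertBasis κ ℂ H) {lam : κ → ℝ}
    (hb : ∀ n, T (b n) = (lam n : ℂ) • b n) (x : H) :
    HasSum (fun k => lam k * ‖inner ℂ (b k) x‖ ^ 2) (RCLike.re (inner ℂ (T x) x)) := by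
  have h := b.hasSum_inner_mul_inner (T x) x
  have h2 := Complex.hasSum_re h
  refine h2.of_forall_eq fun k => ?_
  rw [hT.inner_left_eq_inner_right, hb, inner_smul_right, ← inner_conj_symm x, mul_assoc,
    mul_comm ((starRingEnd ℂ) _), Complex.mul_conj', ← Complex.ofReal_pow, ← Complex.ofReal_mul,
    Complex.ofReal_re]

/-- The standard Hilbert basis of `ℓ²`. -/
noncomputable def stdHilbertBasis (ι : Type) : HilbertBasis ι ℂ ℓ²(ι, ℂ) :=
  HilbertBasis.ofRepr (LinearIsometryEquiv.refl ℂ _)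

theorem inner_stdHilbertBasis {ι : Type} (i : ι) (x : ℓ²(ι, ℂ)) :
    inner ℂ (stdHilbertBasis ι i) x = x i := by
  rw [← HilbertBasis.repr_apply_apply]
  rfl

theorem inner_stdHilbertBasis_right {ι : Type} (i : ι) (x : ℓ²(ι, ℂ)) :
    inner ℂ x (stdHilbertBasis ι i) = (starRingEnd ℂ) (x i) := by
  rw [← inner_conj_symm, inner_stdHilbertBasis]

theorem stdHilbertBasis_apply {ι : Type} [DecidableEq ι] (i j : ι) :
    stdHilbertBasis ι i j = if i = j then 1 else 0 := by
  rw [← inner_stdHilbertBasis, orthonormal_iff_ite.mp (stdHilbertBasis ι).orthonormal]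
  simp [eq_comm]

theorem ActsByMatrix.apply_std {ι : Type} {A : ι → ι → ℝ} {T : ℓ²(ι, ℂ) →L[ℂ] ℓ²(ι, ℂ)}
    (hA : ActsByMatrix A T) (i j : ι) : T (stdHilbertBasis ι i) j = A j i := by
  classical
  refine (hA (stdHilbertBasis ι i) j).unique ?_
  convert! hasSum_ite_eq i (A j i : ℂ) using 2 with k
  rw [stdHilbertBasis_apply]
  by_cases h : k = i
  · simp [h]
  · simp [h, Ne.symm h]

theorem ActsByMatrix.hasSum_sq {A : ℕ → ℕ → ℝ} {T : ℓ²(ℕ, ℂ) →L[ℂ] ℓ²(ℕ, ℂ)}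
    (hA : ActsByMatrix A T) (j : ℕ) :
    HasSum (fun i => A i j ^ 2) (‖T (stdHilbertBasis ℕ j)‖ ^ 2) := by
  refine (hasSum_norm_sq_inner (stdHilbertBasis ℕ) _).of_forall_eq fun i => ?_
  rw [inner_stdHilbertBasis, hA.apply_std]
  simp

/-- Spectral decomposition of a compact positive injective operator given by a matrix, together
with the min-max bounds with respect to the coordinate subspaces. -/
theorem exists_diagonalizes {A : ℕ → ℕ → ℝ} {T : ℓ²(ℕ, ℂ) →L[ℂ] ℓ²(ℕ, ℂ)}
    (hA : ActsByMatrix A T) (hc : IsCompactOperator T) (hp : T.IsPositive)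
    (h0 : ∀ x, T x = 0 → x = 0) :
    ∃ (lam : ℕ → ℝ) (V : ℕ → ℕ → ℂ), Antitone lam ∧ (∀ n, 0 < lam n) ∧
      Tendsto lam atTop (𝓝 0) ∧ Diagonalizes A lam V ∧
      (∀ j, HasSum (fun k => lam k ^ 2 * ‖V k j‖ ^ 2) (∑' i, A i j ^ 2)) ∧
      (∀ k C, (∀ x : ℓ²(ℕ, ℂ), (∀ i < k, x i = 0) →
        RCLike.re (inner ℂ (T x) x) ≤ C * ‖x‖ ^ 2) → lam k ≤ C) ∧
      (∀ k C, (∀ x : ℓ²(ℕ, ℂ), (∀ i > k, x i = 0) →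
        C * ‖x‖ ^ 2 ≤ RCLike.re (inner ℂ (T x) x)) → C ≤ lam k) := by
  classical
  obtain ⟨lam, b, hanti, hpos, hlim, hb⟩ := exists_hilbertBasis_eigenvectors hc hp h0
  have hinner : ∀ k j, inner ℂ (b k) (stdHilbertBasis ℕ j) = (starRingEnd ℂ) (b k j) :=
    fun k j => inner_stdHilbertBasis_right _ _
  refine ⟨lam, fun k i => b k i, hanti, hpos, hlim, ⟨fun k l => ?_, fun i j => ?_, fun i j => ?_⟩,
    fun j => ?_, fun k C hC => ?_, fun k C hC => ?_⟩
  · have h := lp.hasSum_inner (𝕜 := ℂ) (b l) (b k)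
    rw [orthonormal_iff_ite.mp b.orthonormal] at h
    simp only [eq_comm (a := l)] at h
    convert! h using 2
  · have h := b.hasSum_inner_mul_inner (stdHilbertBasis ℕ i) (stdHilbertBasis ℕ j)
    rw [orthonormal_iff_ite.mp (stdHilbertBasis ℕ).orthonormal] at h
    convert! h using 2
    rw [inner_stdHilbertBasis, hinner]
  · have h := b.hasSum_inner_mul_inner (stdHilbertBasis ℕ i) (T (stdHilbertBasis ℕ j))
    rw [inner_stdHilbertBasis, hA.apply_std] at h
    refine h.of_forall_eq fun k => ?_
    rw [inner_stdHilbertBasis, ← hp.inner_left_eq_inner_right, hb, inner_smul_left, hinner,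
      Complex.conj_ofReal]
    ring
  -- Both sides are the squared norm of the image of the j-th unit vector, computed in the
  -- coordinate basis and in the eigenbasis.
  · rw [(hA.hasSum_sq j).tsum_eq]
    refine (hasSum_norm_sq_inner b _).of_forall_eq fun k => ?_
    rw [← hp.inner_left_eq_inner_right, hb, inner_smul_left, hinner, Complex.conj_ofReal, norm_mul,
      RCLike.norm_conj, mul_pow, Complex.norm_real, Real.norm_eq_abs, sq_abs]
  -- Courant–Fischer: `x` is killed by the first k coordinates and involves only the eigenvectors 0,
  -- …, k, so its quadratic form is at least λ_k‖x‖². The second bound exchanges the two bases.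
  · obtain ⟨x, hx0, hx1, hx2⟩ := exists_ne_zero_inner_eq_zero (stdHilbertBasis ℕ) b k
    have hx : 0 < ‖x‖ ^ 2 := by positivity
    have h1 := hC x fun i hi => by rw [← inner_stdHilbertBasis]; exact hx1 i hi
    refine le_of_mul_le_mul_right (le_trans ?_ h1) hx
    refine hasSum_le (fun j => ?_) ((hasSum_norm_sq_inner b x).mul_left (lam k))
      (hasSum_mul_norm_sq_inner hp b hb x)
    rcases le_or_gt j k with hj | hj
    · exact mul_le_mul_of_nonneg_right (hanti hj) (by positivity)
    · simp [hx2 j hj]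
  · obtain ⟨x, hx0, hx1, hx2⟩ := exists_ne_zero_inner_eq_zero b (stdHilbertBasis ℕ) k
    have hx : 0 < ‖x‖ ^ 2 := by positivity
    have h1 := hC x fun i hi => by rw [← inner_stdHilbertBasis]; exact hx2 i hi
    refine le_of_mul_le_mul_right (le_trans h1 ?_) hx
    refine hasSum_le (fun j => ?_) (hasSum_mul_norm_sq_inner hp b hb x)
      ((hasSum_norm_sq_inner b x).mul_left (lam k))
    rcases lt_or_ge j k with hj | hj
    · simp [hx1 j hj]
    · exact mul_le_mul_of_nonneg_right (hanti hj) (by positivity)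


/-! ### The local matrices: explicit factorisation and two-sided bounds -/

/-- The left shift on `ℓ²(ℕ)`. -/
noncomputable def leftShift : ℓ²(ℕ, ℂ) →L[ℂ] ℓ²(ℕ, ℂ) :=
  LinearMap.mkContinuous
    { toFun := fun x => ⟨fun i => x (i + 1), memℓp_gen
        ((summable_nat_add_iff 1).mpr ((lp.memℓp x).summable (by norm_num)))⟩
      map_add' := fun x y => by ext i; simp; rfl
      map_smul' := fun c x => by ext i; simp } 1 (by
    intro x
    have h2 : (0 : ℝ) < (2 : ENNReal).toReal := by norm_num
    refine lp.norm_le_of_forall_sum_le h2 (by positivity) (fun s => ?_)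
    rw [one_mul]
    refine le_trans (le_of_eq ?_) (lp.sum_rpow_le_norm_rpow h2 x (s.map (addRightEmbedding 1)))
    rw [Finset.sum_map]
    rfl)

theorem norm_leftShift_le : ‖leftShift‖ ≤ 1 := LinearMap.mkContinuous_norm_le _ zero_le_one _

/-- The operator with the entries `q ^ (j - i)` for `i ≤ j`, and `0` for `i > j`. -/
theorem exists_geometric_triangular {q : ℝ} (hq0 : 0 < q) (hq1 : q < 1) :
    ∃ B : ℓ²(ℕ, ℂ) →L[ℂ] ℓ²(ℕ, ℂ),
      (∀ j i, B (stdHilbertBasis ℕ j) i = if i ≤ j then (q : ℂ) ^ (j - i) else 0) ∧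
      (∀ x, (1 - q) * ‖B x‖ ≤ ‖x‖) ∧ ∀ x, ‖x‖ ≤ (1 + q) * ‖B x‖ := by
  -- `B` is the Neumann series of (1 - t)⁻¹ with ‖t‖ ≤ q; both norm bounds follow from x = Bx - tBx.
  let t : ℓ²(ℕ, ℂ) →L[ℂ] ℓ²(ℕ, ℂ) := (q : ℂ) • leftShift
  have htx : ∀ x, ‖t x‖ ≤ q * ‖x‖ := fun x => by
    change ‖(q : ℂ) • leftShift x‖ ≤ _
    rw [norm_smul, Complex.norm_real, Real.norm_eq_abs, abs_of_pos hq0]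
    gcongr
    exact (leftShift.le_opNorm x).trans
      (mul_le_of_le_one_left (norm_nonneg _) norm_leftShift_le)
  have ht : ‖t‖ < 1 := (t.opNorm_le_bound hq0.le htx).trans_lt hq1
  let B := ∑' n : ℕ, t ^ n
  have h1 : ∀ x, B (x - t x) = x := fun x => by
    have := congrArg (fun F : ℓ²(ℕ, ℂ) →L[ℂ] ℓ²(ℕ, ℂ) => F x) (geom_series_mul_neg t ht)
    simpa using this
  have h2 : ∀ x, B x - t (B x) = x := fun x => by
    have := congrArg (fun F : ℓ²(ℕ, ℂ) →L[ℂ] ℓ²(ℕ, ℂ) => F x) (mul_neg_geom_series t ht)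
    simpa using this
  have htapp : ∀ x i, t x i = (q : ℂ) * x (i + 1) := fun x i => rfl
  have e0 : t (stdHilbertBasis ℕ 0) = 0 := by
    ext i
    simp [htapp, stdHilbertBasis_apply]
  have e1 : ∀ j, t (stdHilbertBasis ℕ (j + 1)) = (q : ℂ) • stdHilbertBasis ℕ j := fun j => by
    ext i
    rw [htapp, lp.coeFn_smul, Pi.smul_apply, smul_eq_mul, stdHilbertBasis_apply,
      stdHilbertBasis_apply]
    simp
  have b0 : B (stdHilbertBasis ℕ 0) = stdHilbertBasis ℕ 0 := by
    simpa [e0] using h1 (stdHilbertBasis ℕ 0)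
  have b1 : ∀ j, B (stdHilbertBasis ℕ (j + 1)) =
      stdHilbertBasis ℕ (j + 1) + (q : ℂ) • B (stdHilbertBasis ℕ j) := fun j => by
    have := h1 (stdHilbertBasis ℕ (j + 1))
    rw [e1, map_sub, map_smul] at this
    exact sub_eq_iff_eq_add.mp this
  refine ⟨B, fun j => ?_, fun x => ?_, fun x => ?_⟩
  · induction j with
    | zero => intro i; rw [b0, stdHilbertBasis_apply]; rcases i with _ | i <;> simp
    | succ j ih =>
      intro i
      rw [b1, lp.coeFn_add, Pi.add_apply, lp.coeFn_smul, Pi.smul_apply, ih, stdHilbertBasis_apply,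
        smul_eq_mul]
      rcases lt_trichotomy i (j + 1) with h | h | h
      · have h' : i ≤ j := by omega
        rw [if_neg (by omega), if_pos h', if_pos h.le, Nat.succ_sub h', pow_succ]
        ring
      · simp [h]
      · rw [if_neg (by omega), if_neg (by omega), if_neg (by omega)]
        simp
  · have := norm_sub_norm_le (B x) (t (B x))
    rw [h2] at this
    linarith [htx (B x)]
  · have := norm_sub_le (B x) (t (B x))
    rw [h2] at this
    linarith [htx (B x)]

/-- The terms l = 1, …, m telescope to q^(a+b)(1 - q^(2m)), and the term l = 0, whose weight is 1
instead of 1 - q², supplies the missing q^(a+b+2m). It evaluates the inner product of two columns of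
a weighted triangular matrix. -/
theorem sum_range_geometric_eq (q : ℝ) (a b m : ℕ) :
    ∑ l ∈ Finset.range (m + 1),
      (if l = 0 then 1 else 1 - q ^ 2) * (q ^ (m + a - l) * q ^ (m + b - l)) = q ^ (a + b) := by
  induction m generalizing a b with
  | zero => simp [pow_add]
  | succ m ih =>
    rw [Finset.sum_range_succ, ← sub_eq_zero]
    have h := ih (a + 1) (b + 1)
    have e1 : m + 1 + a = m + (a + 1) := by ring
    have e2 : m + 1 + b = m + (b + 1) := by ring
    rw [e1, e2, h, if_neg (Nat.succ_ne_zero m), show m + (a + 1) - (m + 1) = a by omega,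
      show m + (b + 1) - (m + 1) = b by omega]
    ring

/-- The matrix `r ^ (j + k) * q ^ |j - k|`. -/
def weightedToeplitz (r q : ℝ) (j k : ℕ) : ℝ := r ^ (j + k) * q ^ (max j k - min j k)

theorem norm_sq_eq_tsum {ι : Type} (x : ℓ²(ι, ℂ)) : HasSum (fun i => ‖x i‖ ^ 2) (‖x‖ ^ 2) :=
  (hasSum_norm_sq_inner (stdHilbertBasis ι) x).of_forall_eq fun i => by
    rw [inner_stdHilbertBasis]

/-- The operator is G*G with G = SBD: D is diagonal with entries r^j, B is the geometric triangular
operator, and S rescales its rows. Since S and B are bounded above and below, the quadratic form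
‖Gx‖² is comparable with ‖Dx‖². -/
theorem exists_operator_weightedToeplitz {r q : ℝ} (hr0 : 0 < r) (hr1 : r < 1) (hq0 : 0 < q)
    (hq1 : q < 1) :
    ∃ T : ℓ²(ℕ, ℂ) →L[ℂ] ℓ²(ℕ, ℂ), ActsByMatrix (weightedToeplitz r q) T ∧ IsCompactOperator T ∧
      T.IsPositive ∧ (∀ x, T x = 0 → x = 0) ∧
      (∀ k (x : ℓ²(ℕ, ℂ)), (∀ i < k, x i = 0) →
        RCLike.re (inner ℂ (T x) x) ≤ (1 - q)⁻¹ ^ 2 * r ^ (2 * k) * ‖x‖ ^ 2) ∧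
      (∀ k (x : ℓ²(ℕ, ℂ)), (∀ i > k, x i = 0) →
        (1 - q) / (1 + q) * r ^ (2 * k) * ‖x‖ ^ 2 ≤ RCLike.re (inner ℂ (T x) x)) := by
  classical
  obtain ⟨B, hB, hBle, hBge⟩ := exists_geometric_triangular hq0 hq1
  have hq2 : 0 < 1 - q ^ 2 := by nlinarith
  have hrpow : ∀ j, |r ^ j| ≤ 1 := fun j => by
    rw [abs_of_pos (by positivity)]; exact pow_le_one₀ hr0.le hr1.le
  -- These row weights are the square roots of the weights in `sum_range_geometric_eq`.
  let c : ℕ → ℝ := fun l => if l = 0 then 1 else √(1 - q ^ 2)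
  have hc2 : ∀ l, c l ^ 2 = if l = 0 then 1 else 1 - q ^ 2 := fun l => by
    simp only [c]; split_ifs
    · simp
    · exact Real.sq_sqrt hq2.le
  have hc0 : ∀ l, 0 ≤ c l := fun l => by simp only [c]; split_ifs <;> positivity
  have hc1 : ∀ l, |c l| ≤ 1 := fun l => by
    rw [abs_of_nonneg (hc0 l), ← sq_le_one_iff₀ (hc0 l), hc2]
    split_ifs
    · exact le_rfl
    · nlinarith
  let D := diagOp (fun j => r ^ j) 1 hrpow
  let S := diagOp c 1 hc1
  let G := S ∘L B ∘L D
  have hDc : IsCompactOperator D := diagOp_isCompactOperator _ _ _ fun ε hε => by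
    obtain ⟨N, hN⟩ := eventually_atTop.mp
      ((tendsto_pow_atTop_nhds_zero_of_lt_one hr0.le hr1).eventually (gt_mem_nhds hε))
    refine (Set.finite_Iio N).subset fun n hn => ?_
    by_contra! h
    have h1 : ε ≤ |r ^ n| := hn
    rw [abs_of_pos (by positivity)] at h1
    exact absurd (hN n (by simpa using h)) (not_lt.mpr h1)
  let T := ContinuousLinearMap.adjoint G ∘L G
  have hT : ∀ x y, inner ℂ (T x) y = inner ℂ (G x) (G y) := fun x y =>
    ContinuousLinearMap.adjoint_inner_left G y (G x)
  have hTp : T.IsPositive := ContinuousLinearMap.isPositive_adjoint_comp_self G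
  have hre : ∀ x, RCLike.re (inner ℂ (T x) x) = ‖G x‖ ^ 2 := fun x => by
    rw [hT, inner_self_eq_norm_sq]
  have hDe : ∀ j, D (stdHilbertBasis ℕ j) = ((r ^ j : ℝ) : ℂ) • stdHilbertBasis ℕ j := fun j => by
    ext i
    simp only [D, diagOp_apply, lp.coeFn_smul, Pi.smul_apply, stdHilbertBasis_apply, smul_eq_mul]
    split_ifs with h
    · rw [h]
    · simp
  have hGe : ∀ j i, G (stdHilbertBasis ℕ j) i =
      ((c i * (r ^ j * if i ≤ j then q ^ (j - i) else 0) : ℝ) : ℂ) := fun j i => by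
    change S (B (D (stdHilbertBasis ℕ j))) i = _
    rw [hDe, map_smul, diagOp_apply, lp.coeFn_smul, Pi.smul_apply, hB]
    split_ifs <;> simp
  have hentry : ∀ i j, inner ℂ (G (stdHilbertBasis ℕ i)) (G (stdHilbertBasis ℕ j)) =
      (weightedToeplitz r q i j : ℂ) := fun i j => by
    rw [lp.inner_eq_tsum]
    simp only [RCLike.inner_apply, hGe, Complex.conj_ofReal, ← Complex.ofReal_mul]
    rw [tsum_eq_sum (s := Finset.range (min i j + 1)), ← Complex.ofReal_sum]
    · congr 1
      obtain ⟨a, ha⟩ := Nat.exists_eq_add_of_le (min_le_left i j)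
      obtain ⟨b, hb⟩ := Nat.exists_eq_add_of_le (min_le_right i j)
      have h := sum_range_geometric_eq q a b (min i j)
      have hab : max i j - min i j = a + b := by omega
      rw [weightedToeplitz, hab, ← h, Finset.mul_sum, ← ha, ← hb]
      refine Finset.sum_congr rfl fun l hl => ?_
      rw [Finset.mem_range] at hl
      rw [if_pos (by omega), if_pos (by omega), ← hc2, pow_add]
      ring
    · intro l hl
      rw [Finset.mem_range] at hl
      rcases le_total i j with h | h
      · have : ¬ l ≤ i := by omega
        simp [this]
      · have : ¬ l ≤ j := by omega
        simp [this]
  have hacts : ActsByMatrix (weightedToeplitz r q) T := fun x i => by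
    have h := lp.hasSum_inner (𝕜 := ℂ) (T (stdHilbertBasis ℕ i)) x
    rw [hTp.inner_left_eq_inner_right, inner_stdHilbertBasis] at h
    refine h.of_forall_eq fun j => ?_
    rw [RCLike.inner_apply, ← inner_stdHilbertBasis_right, hT, hentry, mul_comm]
  have hGle : ∀ x, ‖G x‖ ^ 2 ≤ (1 - q)⁻¹ ^ 2 * ‖D x‖ ^ 2 := fun x => by
    have h1 : ‖G x‖ ≤ ‖B (D x)‖ := by
      refine (S.le_opNorm _).trans (mul_le_of_le_one_left (norm_nonneg _) ?_)
      exact norm_diagOp_le _ _ _ zero_le_one hc1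
    have h2 : ‖B (D x)‖ ≤ (1 - q)⁻¹ * ‖D x‖ := by
      rw [inv_mul_eq_div, le_div_iff₀ (by linarith), mul_comm]
      exact hBle _
    rw [← mul_pow]
    exact pow_le_pow_left₀ (norm_nonneg _) (h1.trans h2) 2
  -- The constant is (1 - q²)/(1 + q)²: the squared row weights are at least 1 - q², and ‖x‖ ≤ (1 +
  -- q)‖Bx‖.
  have hGge : ∀ x, (1 - q) / (1 + q) * ‖D x‖ ^ 2 ≤ ‖G x‖ ^ 2 := fun x => by
    have h1 : (1 - q ^ 2) * ‖B (D x)‖ ^ 2 ≤ ‖G x‖ ^ 2 := by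
      refine hasSum_le (fun i => ?_) ((norm_sq_eq_tsum (B (D x))).mul_left (1 - q ^ 2))
        (norm_sq_eq_tsum (G x))
      change _ ≤ ‖(c i : ℂ) * B (D x) i‖ ^ 2
      rw [norm_mul, mul_pow, Complex.norm_real, Real.norm_eq_abs, sq_abs, hc2]
      gcongr
      split_ifs
      · nlinarith
      · exact le_rfl
    have h2 : ‖D x‖ ^ 2 ≤ (1 + q) ^ 2 * ‖B (D x)‖ ^ 2 := by
      rw [← mul_pow]
      exact pow_le_pow_left₀ (norm_nonneg _) (hBge _) 2
    refine le_trans ?_ h1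
    rw [div_mul_eq_mul_div, div_le_iff₀ (by linarith)]
    nlinarith
  refine ⟨T, hacts, ?_, hTp, fun x hx => ?_, fun k x hx => ?_, fun k x hx => ?_⟩
  · exact (hDc.clm_comp (S ∘L B)).clm_comp (ContinuousLinearMap.adjoint G)
  · have h1 := hre x
    rw [hx, inner_zero_left, map_zero] at h1
    have h2 := hGge x
    rw [← h1] at h2
    have h3 : 0 < (1 - q) / (1 + q) := div_pos (by linarith) (by linarith)
    have h4 : ‖D x‖ ^ 2 = 0 := le_antisymm (by nlinarith) (by positivity)
    have h5 : D x = 0 := norm_eq_zero.mp (pow_eq_zero_iff two_ne_zero |>.mp h4)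
    ext i
    have h6 := congrArg (fun y : ℓ²(ℕ, ℂ) => y i) h5
    simpa [D, hr0.ne'] using h6
  · rw [hre, mul_assoc]
    refine (hGle x).trans ?_
    gcongr
    refine hasSum_le (fun i => ?_) (norm_sq_eq_tsum (D x))
      ((norm_sq_eq_tsum x).mul_left (r ^ (2 * k)))
    rw [diagOp_apply, norm_mul, mul_pow, Complex.norm_real, Real.norm_eq_abs, sq_abs, ← pow_mul,
      mul_comm i]
    rcases lt_or_ge i k with hi | hi
    · simp [hx i hi]
    · gcongr ?_ * _
      exact pow_le_pow_of_le_one hr0.le hr1.le (by omega)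
  · rw [hre, mul_assoc]
    refine le_trans ?_ (hGge x)
    have h3 : 0 < (1 - q) / (1 + q) := div_pos (by linarith) (by linarith)
    gcongr
    refine hasSum_le (fun i => ?_) ((norm_sq_eq_tsum x).mul_left (r ^ (2 * k)))
      (norm_sq_eq_tsum (D x))
    rw [diagOp_apply, norm_mul, mul_pow, Complex.norm_real, Real.norm_eq_abs, sq_abs, ← pow_mul,
      mul_comm i]
    rcases lt_or_ge k i with hi | hi
    · simp [hx i hi]
    · gcongr ?_ * _
      exact pow_le_pow_of_le_one hr0.le hr1.le (by omega)


/-! ### Trace, Hilbert–Schmidt norm and top eigenvalue of the local matrices -/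

/-- Rows have norm 1, so summing μ_k|V_ki|² over i and k in either order compares ∑ μ_k with ∑ s_i.
It yields the trace formula for μ = λ and the Hilbert–Schmidt formula for μ = λ². -/
theorem Diagonalizes.hasSum_of_hasSum_hasSum {ι κ : Type} {A : ι → ι → ℝ} {lam : κ → ℝ}
    {V : κ → ι → ℂ} (h : Diagonalizes A lam V) {μ : κ → ℝ} (hμ : ∀ k, 0 ≤ μ k) {s : ι → ℝ} {D : ℝ}
    (hs : ∀ i, HasSum (fun k => μ k * ‖V k i‖ ^ 2) (s i)) (hD : HasSum s D) : HasSum μ D := by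
  have hsum : Summable fun x : ι × κ => μ x.2 * ‖V x.2 x.1‖ ^ 2 := by
    rw [summable_prod_of_nonneg (fun x => mul_nonneg (hμ _) (by positivity))]
    exact ⟨fun i => (hs i).summable, by simpa only [(hs _).tsum_eq] using hD.summable⟩
  have h1 : HasSum (fun x : ι × κ => μ x.2 * ‖V x.2 x.1‖ ^ 2) D := by
    have := hsum.hasSum.prod_fiberwise hs
    rw [← this.unique hD]
    exact hsum.hasSum
  have h2 := ((Equiv.prodComm κ ι).hasSum_iff.mpr h1).prod_fiberwise
    (g := μ) (fun k => by simpa using (h.hasSum_norm_sq_row k).mul_left (μ k))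
  exact h2

/-- Multiplying all the eigenvectors by a common phase makes the first entry non-negative. -/
theorem Diagonalizes.exists_nonneg {A : ℕ → ℕ → ℝ} {lam : ℕ → ℝ} {V : ℕ → ℕ → ℂ}
    (h : Diagonalizes A lam V) :
    ∃ V' : ℕ → ℕ → ℂ, Diagonalizes A lam V' ∧ (∀ k i, ‖V' k i‖ = ‖V k i‖) ∧
      V' 0 0 = (‖V' 0 0‖ : ℂ) := by
  obtain ⟨u, hu, hu'⟩ : ∃ u : ℂ, ‖u‖ = 1 ∧ u * V 0 0 = (‖V 0 0‖ : ℂ) := by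
    by_cases h0 : V 0 0 = 0
    · exact ⟨1, by simp, by simp [h0]⟩
    · have hn : (‖V 0 0‖ : ℂ) ≠ 0 := by simpa using h0
      refine ⟨(starRingEnd ℂ) (V 0 0) / ‖V 0 0‖, ?_, ?_⟩
      · rw [norm_div, RCLike.norm_conj, Complex.norm_real, norm_norm, div_self (by simpa using h0)]
      · rw [div_mul_eq_mul_div, mul_comm, Complex.mul_conj', sq, mul_div_assoc, div_self hn,
          mul_one]
  have key : ∀ a b : ℂ, u * a * (starRingEnd ℂ) (u * b) = a * (starRingEnd ℂ) b := fun a b => by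
    have : u * (starRingEnd ℂ) u = 1 := by rw [Complex.mul_conj', hu]; simp
    calc _ = (u * (starRingEnd ℂ) u) * (a * (starRingEnd ℂ) b) := by rw [map_mul]; ring
      _ = _ := by rw [this, one_mul]
  refine ⟨fun k i => u * V k i, ⟨fun k l => ?_, fun i j => ?_, fun i j => ?_⟩, fun k i => ?_, ?_⟩
  · simpa only [key] using h.rows k l
  · simpa only [key] using h.cols i j
  · simpa only [key] using h.diag i j
  · rw [norm_mul, hu, one_mul]
  · change u * V 0 0 = (‖u * V 0 0‖ : ℂ)
    rw [norm_mul, hu, one_mul, hu']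

/-- Perturbation bounds for the top eigenvalue and the top eigenvector. -/
theorem Diagonalizes.top_bounds {A : ℕ → ℕ → ℝ} {lam : ℕ → ℝ} {V : ℕ → ℕ → ℂ}
    (h : Diagonalizes A lam V) (hanti : Antitone lam) (hpos : ∀ k, 0 < lam k) (h00 : A 0 0 = 1)
    {ω : ℝ} (hω : HasSum (fun k => lam k ^ 2 * ‖V k 0‖ ^ 2) (1 + ω)) :
    1 ≤ lam 0 ∧ (lam 1 ≤ 1 / 2 → 1 - ‖V 0 0‖ ^ 2 ≤ 4 * ω ∧ (ω ≤ 1 / 8 → lam 0 ≤ 1 + 8 * ω)) := by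
  have h0 := h.hasSum_norm_sq_col 0
  have h1 := h.hasSum_mul_norm_sq 0
  rw [h00] at h1
  refine ⟨?_, fun hhalf => ?_⟩
  · have := hasSum_le (fun k => mul_le_mul_of_nonneg_right (hanti (Nat.zero_le k)) (sq_nonneg _)) h1
      (h0.mul_left (lam 0))
    simpa using this
  · have hvar : HasSum (fun k => (lam k - 1) ^ 2 * ‖V k 0‖ ^ 2) ω := by
      have := (hω.sub (h1.mul_left 2)).add h0
      convert! this using 1
      · funext k; ring
      · ring
    have hlam : ∀ k, lam (k + 1) ≤ 1 / 2 := fun k => (hanti (by omega)).trans hhalf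
    have htail := (hasSum_nat_add_iff' 1).mpr h0
    have hvtail := (hasSum_nat_add_iff' 1).mpr hvar
    have h1tail := (hasSum_nat_add_iff' 1).mpr h1
    simp only [Finset.range_one, Finset.sum_singleton] at htail hvtail h1tail
    -- Chebyshev: away from the top eigenvalue (λ_k - 1)² ≥ 1/4, so the mass there is at most four
    -- times the variance.
    have hA : 1 - ‖V 0 0‖ ^ 2 ≤ 4 * (ω - (lam 0 - 1) ^ 2 * ‖V 0 0‖ ^ 2) := by
      refine hasSum_le (fun k => ?_) htail (hvtail.mul_left 4)
      have := hlam k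
      have h2 : 1 ≤ 4 * (lam (k + 1) - 1) ^ 2 := by nlinarith
      nlinarith [sq_nonneg ‖V (k + 1) 0‖]
    have hB : 1 - ‖V 0 0‖ ^ 2 ≤ 4 * ω := by nlinarith [mul_nonneg (sq_nonneg (lam 0 - 1)) (sq_nonneg ‖V 0 0‖)]
    refine ⟨hB, fun hsmall => ?_⟩
    have hC : 0 ≤ 1 - lam 0 * ‖V 0 0‖ ^ 2 :=
      h1tail.nonneg fun k => mul_nonneg (hpos _).le (sq_nonneg _)
    have hω0 : 0 ≤ ω := hvar.nonneg fun k => by positivity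
    have hD : lam 0 * (1 - 4 * ω) ≤ 1 := by
      have := mul_le_mul_of_nonneg_left (show 1 - 4 * ω ≤ ‖V 0 0‖ ^ 2 by linarith) (hpos 0).le
      linarith
    -- The product is 1 + 4ω(1 - 8ω), which is where ω ≤ 1/8 enters.
    have hE : 1 ≤ (1 + 8 * ω) * (1 - 4 * ω) := by nlinarith
    exact le_of_mul_le_mul_right (hD.trans hE) (by linarith)

/-- Squared entries have the same shape, so Hilbert–Schmidt norms reduce to plain sums of entries.
-/
theorem weightedToeplitz_sq (r q : ℝ) (i j : ℕ) :
    weightedToeplitz r q i j ^ 2 = weightedToeplitz (r ^ 2) (q ^ 2) i j := by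
  simp only [weightedToeplitz, mul_pow, ← pow_mul, mul_comm]

theorem hasSum_weightedToeplitz_diag {r q : ℝ} (hr0 : 0 < r) (hr1 : r < 1) :
    HasSum (fun j => weightedToeplitz r q j j) (1 - r ^ 2)⁻¹ := by
  refine (hasSum_geometric_of_lt_one (sq_nonneg r) (by nlinarith)).of_forall_eq fun j => ?_
  simp [weightedToeplitz, ← pow_mul, two_mul]

theorem hasSum_weightedToeplitz_zero {r q : ℝ} (hr0 : 0 < r) (hr1 : r < 1) (hq0 : 0 < q)
    (hq1 : q < 1) : HasSum (fun i => weightedToeplitz r q i 0) (1 - r * q)⁻¹ := by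
  refine (hasSum_geometric_of_lt_one (by positivity) (by nlinarith)).of_forall_eq fun i => ?_
  simp [weightedToeplitz, mul_pow]

/-- Shifting along the diagonal multiplies entries by r², so the column sums satisfy C_{j+1} =
(rq)^(j+1) + r² C_j; summing over j gives a linear equation for the total. -/
theorem hasSum_tsum_weightedToeplitz {r q : ℝ} (hr0 : 0 < r) (hr1 : r < 1) (hq0 : 0 < q)
    (hq1 : q < 1) : HasSum (fun j => ∑' i, weightedToeplitz r q i j)
      ((1 - r ^ 2)⁻¹ * ((1 + r * q) / (1 - r * q))) := by
  have hr2 : 0 < 1 - r ^ 2 := by nlinarith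
  have hrq : 0 < 1 - r * q := by nlinarith
  have hprod : Summable fun x : ℕ × ℕ => weightedToeplitz r q x.2 x.1 := by
    have hg := summable_geometric_of_lt_one hr0.le hr1
    refine Summable.of_nonneg_of_le (fun x => ?_) (fun x => ?_)
      (hg.mul_of_nonneg hg (fun _ => by positivity) (fun _ => by positivity))
    · unfold weightedToeplitz; positivity
    · rw [weightedToeplitz, pow_add, mul_comm (r ^ x.2)]
      exact mul_le_of_le_one_right (by positivity) (pow_le_one₀ hq0.le hq1.le)
  have hs := hprod.prod
  have hf := hprod.prod_factor
  have hrec : ∀ j, ∑' i, weightedToeplitz r q i (j + 1) =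
      (r * q) * (r * q) ^ j + r ^ 2 * ∑' i, weightedToeplitz r q i j := fun j => by
    rw [(hf (j + 1)).tsum_eq_zero_add, ← tsum_mul_left]
    congr 1
    · simp [weightedToeplitz, mul_pow]; ring
    · refine tsum_congr fun i => ?_
      simp only [weightedToeplitz]
      have : max (i + 1) (j + 1) - min (i + 1) (j + 1) = max i j - min i j := by omega
      rw [this]; ring
  obtain ⟨S, hS⟩ : ∃ S, HasSum (fun j => ∑' i, weightedToeplitz r q i j) S := hs
  have h1 : S = (1 - r * q)⁻¹ + ((r * q) * (1 - r * q)⁻¹ + r ^ 2 * S) := by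
    have hgeo := hasSum_geometric_of_lt_one (r := r * q) (by positivity) (by nlinarith)
    have h := ((hgeo.mul_left (r * q)).add (hS.mul_left (r ^ 2))).of_forall_eq hrec
    have h' := (hasSum_nat_add_iff (f := fun j => ∑' i, weightedToeplitz r q i j) 1).mp h
    rw [Finset.sum_range_one, (hasSum_weightedToeplitz_zero hr0 hr1 hq0 hq1).tsum_eq] at h'
    linarith [hS.unique h']
  have h2 : S = (1 - r ^ 2)⁻¹ * ((1 + r * q) / (1 - r * q)) := by
    rw [inv_mul_eq_div, eq_div_iff hr2.ne', div_eq_mul_inv]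
    linear_combination h1
  rwa [← h2]

/-- The spectral data of the matrix `r ^ (j + k) * q ^ |j - k|`. -/
structure IsSpectralData (r q : ℝ) (lam : ℕ → ℝ) (V : ℕ → ℕ → ℂ) : Prop where
  antitone : Antitone lam
  pos : ∀ k, 0 < lam k
  tendsto : Tendsto lam atTop (𝓝 0)
  diagonalizes : Diagonalizes (weightedToeplitz r q) lam V
  phase : V 0 0 = (‖V 0 0‖ : ℂ)
  upper : ∀ k, lam k ≤ (1 - q)⁻¹ ^ 2 * r ^ (2 * k)
  lower : ∀ k, (1 - q) / (1 + q) * r ^ (2 * k) ≤ lam k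
  hasSum_one : HasSum lam (1 - r ^ 2)⁻¹
  hasSum_two : HasSum (fun k => lam k ^ 2)
    ((1 - r ^ 4)⁻¹ * ((1 + (r * q) ^ 2) / (1 - (r * q) ^ 2)))
  one_le : 1 ≤ lam 0
  top : lam 1 ≤ 1 / 2 → (r * q) ^ 2 ≤ 1 / 9 →
    1 - ‖V 0 0‖ ^ 2 ≤ 8 * (r * q) ^ 2 ∧ lam 0 ≤ 1 + 16 * (r * q) ^ 2

theorem exists_isSpectralData {r q : ℝ} (hr0 : 0 < r) (hr1 : r < 1) (hq0 : 0 < q) (hq1 : q < 1) :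
    ∃ lam V, IsSpectralData r q lam V := by
  obtain ⟨T, hacts, hc, hp, h0, hup, hlo⟩ := exists_operator_weightedToeplitz hr0 hr1 hq0 hq1
  obtain ⟨lam, V, hanti, hpos, hlim, hD, hsq, hle, hge⟩ := exists_diagonalizes hacts hc hp h0
  obtain ⟨V', hD', hV', hphase⟩ := hD.exists_nonneg
  simp only [← hV'] at hsq
  have hr20 : 0 < r ^ 2 := by positivity
  have hr21 : r ^ 2 < 1 := by nlinarith
  have hq20 : 0 < q ^ 2 := by positivity
  have hq21 : q ^ 2 < 1 := by nlinarith
  simp only [weightedToeplitz_sq] at hsq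
  have hu0 : 0 < (r * q) ^ 2 := by positivity
  have hw := hsq 0
  rw [(hasSum_weightedToeplitz_zero hr20 hr21 hq20 hq21).tsum_eq, ← mul_pow] at hw
  have hu1 : (r * q) ^ 2 < 1 := by rw [mul_pow]; nlinarith
  have hw' : (1 - (r * q) ^ 2)⁻¹ = 1 + (r * q) ^ 2 / (1 - (r * q) ^ 2) := by
    have : 1 - (r * q) ^ 2 ≠ 0 := by linarith
    rw [eq_comm, inv_eq_one_div, eq_div_iff this, add_mul, div_mul_cancel₀ _ this]
    ring
  rw [hw'] at hw
  obtain ⟨hone, htop⟩ := hD'.top_bounds hanti hpos (by simp [weightedToeplitz]) hw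
  refine ⟨lam, V', hanti, hpos, hlim, hD', hphase, fun k => hle k _ (hup k),
    fun k => hge k _ (hlo k), ?_, ?_, hone, fun h1 h2 => ?_⟩
  · exact hD'.hasSum_of_hasSum_hasSum (fun k => (hpos k).le) hD'.hasSum_mul_norm_sq
      (hasSum_weightedToeplitz_diag hr0 hr1)
  · refine hD'.hasSum_of_hasSum_hasSum (fun k => sq_nonneg _) hsq ?_
    have := hasSum_tsum_weightedToeplitz hr20 hr21 hq20 hq21
    rw [← mul_pow, ← pow_mul] at this
    exact this
  · obtain ⟨h3, h4⟩ := htop h1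
    -- Here ω = u/(1 - u) with u = (rq)². For u ≤ 1/9 this gives ω ≤ 9u/8 ≤ 1/8, as the perturbation
    -- bound requires.
    have h5 : (r * q) ^ 2 / (1 - (r * q) ^ 2) ≤ 9 / 8 * (r * q) ^ 2 := by
      rw [div_le_iff₀ (by linarith)]
      nlinarith
    exact ⟨by linarith, by linarith [h4 (by linarith)]⟩


/-! ### Expanding infinite products of series -/

/-- Splitting off the exponent at `p`. -/
noncomputable def finsuppInsertEquiv {α : Type*} [DecidableEq α] {S : Finset α} {p : α} (hp : p ∉ S) :
    ℕ × {f : α →₀ ℕ // ∀ x ∉ S, f x = 0} ≃ {f : α →₀ ℕ // ∀ x ∉ insert p S, f x = 0} where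
  toFun x := ⟨x.2.1.update p x.1, fun y hy => by
    rw [Finset.mem_insert, not_or] at hy
    rw [Finsupp.update_apply, if_neg hy.1, x.2.2 y hy.2]⟩
  invFun f := (f.1 p, ⟨f.1.erase p, fun y hy => by
    rw [Finsupp.erase_apply]
    split_ifs with h
    · rfl
    · exact f.2 y (by simp [h, hy])⟩)
  left_inv x := by
    rcases x with ⟨k, f, hf⟩
    refine Prod.ext (by simp) (Subtype.ext ?_)
    simp only [Finsupp.erase_update_eq_erase]
    exact Finsupp.erase_of_notMem_support (by simpa using hf p hp)
  right_inv f := by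
    refine Subtype.ext ?_
    simp

theorem prod_finsuppInsertEquiv {α R : Type*} [DecidableEq α] [CommMonoid R] {S : Finset α} {p : α}
    (hp : p ∉ S) (φ : α → ℕ → R) (x : ℕ × {f : α →₀ ℕ // ∀ x ∉ S, f x = 0}) :
    ∏ y ∈ insert p S, φ y ((finsuppInsertEquiv hp x).1 y) = φ p x.1 * ∏ y ∈ S, φ y (x.2.1 y) := by
  rw [Finset.prod_insert hp]
  congr 1
  · simp [finsuppInsertEquiv]
  · refine Finset.prod_congr rfl fun y hy => ?_
    have : y ≠ p := fun h => hp (h ▸ hy)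
    simp [finsuppInsertEquiv, Finsupp.update_apply, this]

/-- A finite product of absolutely convergent series is the sum of the products. -/
theorem hasSum_finset_prod {α R : Type*} [NormedField R] [CompleteSpace R] (S : Finset α)
    {φ : α → ℕ → R} {a : α → R} (hs : ∀ p ∈ S, Summable fun k => ‖φ p k‖)
    (ha : ∀ p ∈ S, HasSum (φ p) (a p)) :
    (Summable fun f : {f : α →₀ ℕ // ∀ x ∉ S, f x = 0} => ‖∏ p ∈ S, φ p (f.1 p)‖) ∧
      HasSum (fun f : {f : α →₀ ℕ // ∀ x ∉ S, f x = 0} => ∏ p ∈ S, φ p (f.1 p)) (∏ p ∈ S, a p) := by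
  classical
  induction S using Finset.induction_on with
  | empty =>
    have : Unique {f : α →₀ ℕ // ∀ x ∉ (∅ : Finset α), f x = 0} :=
      { default := ⟨0, fun _ _ => rfl⟩
        uniq := fun f => Subtype.ext (Finsupp.ext fun x => f.2 x (Finset.notMem_empty x)) }
    have : Finite {f : α →₀ ℕ // ∀ x ∉ (∅ : Finset α), f x = 0} := inferInstance
    refine ⟨Summable.of_finite, ?_⟩
    convert! hasSum_unique (fun f : {f : α →₀ ℕ // ∀ x ∉ (∅ : Finset α), f x = 0} =>
      ∏ p ∈ ∅, φ p (f.1 p)) using 1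
  | insert p S hp ih =>
    obtain ⟨h1, h2⟩ := ih (fun x hx => hs x (Finset.mem_insert_of_mem hx))
      (fun x hx => ha x (Finset.mem_insert_of_mem hx))
    have hsp := hs p (Finset.mem_insert_self p S)
    have hap := ha p (Finset.mem_insert_self p S)
    rw [← (finsuppInsertEquiv hp).hasSum_iff, ← (finsuppInsertEquiv hp).summable_iff]
    rw [Finset.prod_insert hp]
    simp only [Function.comp_def, prod_finsuppInsertEquiv hp]
    let F : {f : α →₀ ℕ // ∀ x ∉ S, f x = 0} → R := fun f => ∏ y ∈ S, φ y (f.1 y)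
    exact ⟨Summable.mul_norm (f := φ p) (g := F) hsp h1,
      HasSum.mul (f := φ p) (g := F) hap h2 (summable_mul_of_summable_norm (f := φ p) (g := F) hsp h1)⟩

theorem Real.prod_le_exp_sum {α : Type*} (S : Finset α) {x y : α → ℝ} (hx : ∀ p ∈ S, 0 ≤ x p)
    (h : ∀ p ∈ S, x p ≤ 1 + y p) : ∏ p ∈ S, x p ≤ Real.exp (∑ p ∈ S, y p) := by
  rw [Real.exp_sum]
  exact Finset.prod_le_prod hx fun p hp => (h p hp).trans (by
    rw [add_comm]; exact Real.add_one_le_exp _)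

/-- The products over the support are summable if the exponents different from `0` contribute a
summable amount. -/
theorem summable_prod_support {α : Type*} {φ : α → ℕ → ℝ} (h0 : ∀ p k, 0 ≤ φ p k)
    (hs : ∀ p, Summable (φ p)) (h1 : Summable fun p => ∑' k, φ p (k + 1)) :
    Summable fun f : α →₀ ℕ => ∏ p ∈ f.support, φ p (f p) := by
  classical
  refine summable_of_sum_le (c := Real.exp (∑' p, ∑' k, φ p (k + 1)))
    (fun f => Finset.prod_nonneg fun p _ => h0 _ _) fun u => ?_
  let S := u.biUnion fun f => f.support
  -- With the value at exponent 0 replaced by 1, the product over a varying support becomes a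
  -- product over the fixed finite set `S`.
  let χ : α → ℕ → ℝ := fun p k => if k = 0 then 1 else φ p k
  have hχ0 : ∀ p k, 0 ≤ χ p k := fun p k => by
    simp only [χ]; split_ifs
    · exact zero_le_one
    · exact h0 _ _
  have hχs : ∀ p, HasSum (χ p) (1 + ∑' k, φ p (k + 1)) := fun p => by
    have h := ((summable_nat_add_iff 1).mpr (hs p)).hasSum
    have := (hasSum_nat_add_iff (f := χ p) 1).mp (h.of_forall_eq fun k => by simp [χ])
    simpa [χ, add_comm] using this
  obtain ⟨-, hS⟩ := hasSum_finset_prod S (φ := χ) (fun p _ => by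
    simpa [abs_of_nonneg (hχ0 _ _)] using (hχs p).summable) (fun p _ => hχs p)
  have hu : ∀ f ∈ u, ∀ x ∉ S, f x = 0 := fun f hf x hx => by
    by_contra h
    exact hx (Finset.mem_biUnion.mpr ⟨f, hf, by simpa using h⟩)
  have hprod : ∀ f ∈ u, ∏ p ∈ f.support, φ p (f p) = ∏ p ∈ S, χ p (f p) := fun f hf => by
    have hsub : f.support ⊆ S := Finset.subset_biUnion_of_mem _ hf
    rw [← Finset.prod_subset hsub fun p _ hp => by simp [χ, Finsupp.notMem_support_iff.mp hp]]
    refine Finset.prod_congr rfl fun p hp => ?_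
    simp [χ, Finsupp.mem_support_iff.mp hp]
  calc ∑ f ∈ u, ∏ p ∈ f.support, φ p (f p)
      = ∑ f ∈ u.subtype fun f => ∀ x ∉ S, f x = 0, ∏ p ∈ S, χ p (f.1 p) := by
        rw [Finset.sum_subtype_of_mem (fun f => ∏ p ∈ S, χ p (f p)) hu]
        exact Finset.sum_congr rfl hprod
    _ ≤ ∏ p ∈ S, (1 + ∑' k, φ p (k + 1)) :=
        sum_le_hasSum _ (fun f _ => Finset.prod_nonneg fun p _ => hχ0 _ _) hS
    _ ≤ Real.exp (∑ p ∈ S, ∑' k, φ p (k + 1)) := by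
        refine Real.prod_le_exp_sum S (fun p _ => ?_) fun p _ => le_rfl
        have : 0 ≤ ∑' k, φ p (k + 1) := tsum_nonneg fun k => h0 _ _
        linarith
    _ ≤ _ := by
        gcongr
        exact h1.sum_le_tsum S fun p _ => tsum_nonneg fun k => h0 _ _

theorem multipliable_of_summable_norm_sub_one {α R : Type*} [NormedCommRing R] [NormOneClass R]
    [CompleteSpace R] {x : α → R} (h : Summable fun p => ‖x p - 1‖) : Multipliable x := by
  have := multipliable_one_add_of_summable h
  simpa using this

theorem multipliable_finsupp {α R : Type*} [NormedCommRing R] [NormOneClass R] [CompleteSpace R]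
    {φ : α → ℕ → R} (h0 : Summable fun p => ‖φ p 0 - 1‖) (f : α →₀ ℕ) :
    Multipliable fun p => φ p (f p) := by
  refine multipliable_of_summable_norm_sub_one ((summable_congr_cofinite ?_).mp h0)
  filter_upwards [f.support.finite_toSet.compl_mem_cofinite] with p hp
  rw [Finsupp.notMem_support_iff.mp (by simpa using hp)]

/-- The Euler product of absolutely convergent series, without multiplicativity: infinite products
of series can be expanded. -/
theorem hasSum_tprod_finsupp {α : Type*} {φ : α → ℕ → ℂ} {a : α → ℂ} {A : ℂ}
    (ha : ∀ p, HasSum (φ p) (a p)) (hs : ∀ p, Summable fun k => ‖φ p k‖)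
    (h1 : Summable fun p => ∑' k, ‖φ p (k + 1)‖) (h0 : Summable fun p => ‖φ p 0 - 1‖)
    (hA : HasProd a A) : HasSum (fun f : α →₀ ℕ => ∏' p, φ p (f p)) A := by
  classical
  let K := Real.exp (∑' p, ‖φ p 0 - 1‖)
  -- The truncation to families supported in `S`, whose sum is a finite product of series. The limit
  -- in `S` is by dominated convergence; `K` bounds the contribution of the factors at exponent 0.
  let Ψ : Finset α → (α →₀ ℕ) → ℂ := fun S =>
    Set.indicator {f | ∀ x ∉ S, f x = 0} fun f => ∏ p ∈ S, φ p (f p)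
  have hbound := (summable_prod_support (φ := fun p k => ‖φ p k‖) (fun p k => norm_nonneg _) hs
    h1).mul_left K
  have hΨ : ∀ S f, ‖Ψ S f‖ ≤ K * ∏ p ∈ f.support, ‖φ p (f p)‖ := by
    intro S f
    by_cases hf : ∀ x ∉ S, f x = 0
    · have hsub : f.support ⊆ S := fun x hx => by
        by_contra h
        exact (Finsupp.mem_support_iff.mp hx) (hf x h)
      simp only [Ψ]
      rw [Set.indicator_of_mem (by exact hf), norm_prod, ← Finset.prod_sdiff hsub]
      refine mul_le_mul_of_nonneg_right ?_ (Finset.prod_nonneg fun _ _ => norm_nonneg _)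
      refine (Real.prod_le_exp_sum _ (y := fun p => ‖φ p 0 - 1‖) (fun p _ => norm_nonneg _)
        fun p hp => ?_).trans (Real.exp_le_exp.mpr (h0.sum_le_tsum _ fun p _ => norm_nonneg _))
      rw [Finsupp.notMem_support_iff.mp (Finset.mem_sdiff.mp hp).2]
      have := norm_add_le (φ p 0 - 1) 1
      simp only [sub_add_cancel, norm_one] at this
      linarith
    · simp only [Ψ]
      rw [Set.indicator_of_notMem (by exact hf), norm_zero]
      exact mul_nonneg (Real.exp_pos _).le (Finset.prod_nonneg fun _ _ => norm_nonneg _)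
  have hlim : ∀ f : α →₀ ℕ, Tendsto (fun S => Ψ S f) atTop (𝓝 (∏' p, φ p (f p))) := fun f => by
    refine Tendsto.congr' ?_ (multipliable_finsupp h0 f).hasProd
    filter_upwards [eventually_ge_atTop f.support] with S hS
    simp only [Ψ]
    rw [Set.indicator_of_mem]
    intro x hx
    by_contra h
    exact hx (hS (Finsupp.mem_support_iff.mpr h))
  have hsumΨ : ∀ S, ∑' f, Ψ S f = ∏ p ∈ S, a p := fun S => by
    rw [← tsum_subtype]
    exact (hasSum_finset_prod S (fun p _ => hs p) (fun p _ => ha p)).2.tsum_eq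
  have htend := tendsto_tsum_of_dominated_convergence hbound hlim (Eventually.of_forall hΨ)
  simp only [hsumΨ] at htend
  have hsum : Summable fun f : α →₀ ℕ => ∏' p, φ p (f p) :=
    hbound.of_norm_bounded fun f => le_of_tendsto (hlim f).norm (Eventually.of_forall fun S => hΨ S f)
  rw [tendsto_nhds_unique hA htend]
  exact hsum.hasSum


/-! ### Infinite tensor products of diagonalised matrices -/

theorem Complex.norm_sub_one_le_of_eq_norm {z : ℂ} (h : z = (‖z‖ : ℂ)) (h1 : ‖z‖ ≤ 1) :
    ‖z - 1‖ ≤ 1 - ‖z‖ ^ 2 := by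
  have : ‖z - 1‖ = 1 - ‖z‖ := by
    conv_lhs => rw [h]
    rw [← Complex.ofReal_one, ← Complex.ofReal_sub, Complex.norm_real, Real.norm_eq_abs,
      abs_of_nonpos (by linarith)]
    ring
  rw [this]
  nlinarith [norm_nonneg z]

/-- The infinite tensor product of matrices with orthonormal rows has orthonormal rows. -/
theorem hasSum_tprod_mul_conj {α : Type} {W : α → ℕ → ℕ → ℂ}
    (hrow : ∀ p k l, HasSum (fun i => W p k i * (starRingEnd ℂ) (W p l i))
      (@ite ℂ (k = l) (Classical.propDecidable _) 1 0))
    (hphase : ∀ p, W p 0 0 = (‖W p 0 0‖ : ℂ)) (hsum : Summable fun p => 1 - ‖W p 0 0‖ ^ 2)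
    (f g : α →₀ ℕ) :
    HasSum (fun h : α →₀ ℕ => (∏' p, W p (f p) (h p)) * (starRingEnd ℂ) (∏' p, W p (g p) (h p)))
      (@ite ℂ (f = g) (Classical.propDecidable _) 1 0) := by
  classical
  have hnorm : ∀ p k, HasSum (fun i => ‖W p k i‖ ^ 2) 1 := fun p k => by
    have := hrow p k k
    simp only [Complex.mul_conj', if_true] at this
    rw [← Complex.hasSum_ofReal]
    simpa using this
  have hle : ∀ p, ‖W p 0 0‖ ≤ 1 := fun p => by
    have := le_hasSum (hnorm p 0) 0 fun j _ => sq_nonneg _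
    exact (sq_le_one_iff₀ (norm_nonneg _)).mp this
  have h00 : Summable fun p => ‖W p 0 0 - 1‖ := by
    refine Summable.of_nonneg_of_le (fun p => norm_nonneg _) (fun p => ?_) hsum
    exact Complex.norm_sub_one_le_of_eq_norm (hphase p) (hle p)
  have hmult : ∀ (f h : α →₀ ℕ), Multipliable fun p => W p (f p) (h p) := fun f h => by
    refine multipliable_of_summable_norm_sub_one ((summable_congr_cofinite ?_).mp h00)
    filter_upwards [(f.support ∪ h.support).finite_toSet.compl_mem_cofinite] with p hp
    have hp' : f p = 0 ∧ h p = 0 := by simpa using hp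
    rw [hp'.1, hp'.2]
  -- The sum of φ_p over k is the Kronecker delta of f p and g p, and the product of these over p is
  -- the delta of f and g. At all but finitely many p the terms are |W_p(0,k)|², so `hsum` controls
  -- convergence.
  let φ : α → ℕ → ℂ := fun p k => W p (f p) k * (starRingEnd ℂ) (W p (g p) k)
  have hφ : ∀ h : α →₀ ℕ, ∏' p, φ p (h p) =
      (∏' p, W p (f p) (h p)) * (starRingEnd ℂ) (∏' p, W p (g p) (h p)) := fun h => by
    have hc : Multipliable fun p => (starRingEnd ℂ) (W p (g p) (h p)) :=
      (hmult g h).map (starRingEnd ℂ) Complex.continuous_conj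
    rw [(hmult g h).map_tprod (starRingEnd ℂ) Complex.continuous_conj,
      ← (hmult f h).tprod_mul hc]
  have hφs : ∀ p, Summable fun k => ‖φ p k‖ := fun p => by
    refine Summable.of_nonneg_of_le (fun k => norm_nonneg _) (fun k => ?_)
      ((hnorm p (f p)).summable.add (hnorm p (g p)).summable)
    rw [norm_mul, RCLike.norm_conj]
    nlinarith [sq_nonneg (‖W p (f p) k‖ - ‖W p (g p) k‖), sq_nonneg ‖W p (f p) k‖,
      sq_nonneg ‖W p (g p) k‖]
  have hzero : ∀ᶠ p in cofinite, f p = 0 ∧ g p = 0 := by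
    filter_upwards [(f.support ∪ g.support).finite_toSet.compl_mem_cofinite] with p hp
    simpa using hp
  have hval : ∀ p, f p = 0 ∧ g p = 0 → ∀ k, φ p k = ((‖W p 0 k‖ ^ 2 : ℝ) : ℂ) :=
    fun p hp k => by
      simp only [φ]
      rw [hp.1, hp.2, Complex.mul_conj']
      simp
  have key : HasSum (fun h : α →₀ ℕ => ∏' p, φ p (h p))
      (@ite ℂ (f = g) (Classical.propDecidable _) 1 0) := by
    refine hasSum_tprod_finsupp (fun p => hrow p (f p) (g p)) hφs ?_ ?_ ?_
    · refine (summable_congr_cofinite ?_).mp hsum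
      filter_upwards [hzero] with p hp
      have := (hasSum_nat_add_iff' 1).mpr (hnorm p 0)
      simp only [Finset.range_one, Finset.sum_singleton] at this
      rw [← this.tsum_eq]
      refine tsum_congr fun k => ?_
      rw [hval p hp, Complex.norm_real, Real.norm_eq_abs, abs_of_nonneg (sq_nonneg _)]
    · refine (summable_congr_cofinite ?_).mp hsum
      filter_upwards [hzero] with p hp
      rw [hval p hp, ← Complex.ofReal_one, ← Complex.ofReal_sub, Complex.norm_real,
        Real.norm_eq_abs, abs_sub_comm, abs_of_nonneg]
      have := hle p
      nlinarith [norm_nonneg (W p 0 0)]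
    · by_cases hfg : f = g
      · subst hfg
        simp [hasProd_one]
      · rw [if_neg hfg]
        obtain ⟨p, hp⟩ : ∃ p, f p ≠ g p := by
          by_contra! h
          exact hfg (Finsupp.ext h)
        exact hasProd_zero_of_exists_eq_zero ⟨p, if_neg hp⟩
  simpa only [hφ] using key

/-- The infinite tensor product of diagonalised matrices. -/
theorem diagonalizes_tprod {α : Type} {A : α → ℕ → ℕ → ℝ} {lam : α → ℕ → ℝ} {V : α → ℕ → ℕ → ℂ}
    (hD : ∀ p, Diagonalizes (A p) (lam p) (V p)) (hanti : ∀ p, Antitone (lam p))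
    (hpos : ∀ p k, 0 < lam p k) (hphase : ∀ p, V p 0 0 = (‖V p 0 0‖ : ℂ))
    (hsum : Summable fun p => 1 - ‖V p 0 0‖ ^ 2) (hone : ∀ p, 1 ≤ lam p 0)
    (hlam : Summable fun p => lam p 0 - 1) (hA : ∀ p, A p 0 0 = 1) :
    Diagonalizes (fun f g : α →₀ ℕ => ∏' p, A p (f p) (g p))
      (fun f : α →₀ ℕ => ∏' p, lam p (f p)) (fun f g : α →₀ ℕ => ∏' p, V p (f p) (g p)) where
  rows f g := hasSum_tprod_mul_conj (fun p => (hD p).rows) hphase hsum f g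
  -- Columns are the rows of the transposed matrices; the entry at (0,0), and with it the
  -- convergence condition, is unchanged.
  cols f g := hasSum_tprod_mul_conj (W := fun p k i => V p i k) (fun p => (hD p).cols) hphase
    hsum f g
  diag f g := by
    classical
    have hle : ∀ p, ‖V p 0 0‖ ^ 2 ≤ 1 := fun p =>
      le_hasSum ((hD p).hasSum_norm_sq_row 0) 0 fun j _ => sq_nonneg _
    have h00 : Summable fun p => ‖V p 0 0 - 1‖ := by
      refine Summable.of_nonneg_of_le (fun p => norm_nonneg _) (fun p => ?_) hsum
      have h1 : ‖V p 0 0‖ ≤ 1 := (sq_le_one_iff₀ (norm_nonneg _)).mp (hle p)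
      exact Complex.norm_sub_one_le_of_eq_norm (hphase p) h1
    have hmult : ∀ (f h : α →₀ ℕ), Multipliable fun p => V p (f p) (h p) := fun f h => by
      refine multipliable_of_summable_norm_sub_one ((summable_congr_cofinite ?_).mp h00)
      filter_upwards [(f.support ∪ h.support).finite_toSet.compl_mem_cofinite] with p hp
      have hp' : f p = 0 ∧ h p = 0 := by simpa using hp
      rw [hp'.1, hp'.2]
    have hlam' : Summable fun p => ‖lam p 0 - 1‖ := by
      refine hlam.congr fun p => ?_
      rw [Real.norm_eq_abs, abs_of_nonneg (by linarith [hone p])]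
    have hmultlam : ∀ h : α →₀ ℕ, Multipliable fun p => lam p (h p) :=
      fun h => multipliable_finsupp hlam' h
    let φ : α → ℕ → ℂ := fun p k => lam p k * (V p k (f p) * (starRingEnd ℂ) (V p k (g p)))
    have hφ : ∀ h : α →₀ ℕ, ∏' p, φ p (h p) = ((∏' p, lam p (h p) : ℝ) : ℂ) *
        ((∏' p, V p (h p) (f p)) * (starRingEnd ℂ) (∏' p, V p (h p) (g p))) := fun h => by
      have hc : Multipliable fun p => (starRingEnd ℂ) (V p (h p) (g p)) :=
        (hmult h g).map (starRingEnd ℂ) Complex.continuous_conj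
      have hl : Multipliable fun p => (lam p (h p) : ℂ) :=
        (hmultlam h).map Complex.ofRealHom Complex.continuous_ofReal
      have hl' := (hmultlam h).map_tprod Complex.ofRealHom Complex.continuous_ofReal
      simp only [Complex.ofRealHom_eq_coe] at hl'
      rw [(hmult h g).map_tprod (starRingEnd ℂ) Complex.continuous_conj,
        ← (hmult h f).tprod_mul hc, hl', ← hl.tprod_mul ((hmult h f).mul hc)]
    have hzero : ∀ᶠ p in cofinite, f p = 0 ∧ g p = 0 := by
      filter_upwards [(f.support ∪ g.support).finite_toSet.compl_mem_cofinite] with p hp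
      simpa using hp
    have hval : ∀ p, f p = 0 ∧ g p = 0 → ∀ k, φ p k = ((lam p k * ‖V p k 0‖ ^ 2 : ℝ) : ℂ) :=
      fun p hp k => by
        simp only [φ]
        rw [hp.1, hp.2, Complex.mul_conj']
        simp
    have hφs : ∀ p, Summable fun k => ‖φ p k‖ := fun p => by
      refine Summable.of_nonneg_of_le (fun k => norm_nonneg _) (fun k => ?_)
        ((((hD p).hasSum_norm_sq_col (f p)).summable.add
          ((hD p).hasSum_norm_sq_col (g p)).summable).mul_left (lam p 0))
      rw [norm_mul, norm_mul, RCLike.norm_conj, Complex.norm_real, Real.norm_eq_abs,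
        abs_of_pos (hpos p k)]
      refine mul_le_mul (hanti p (Nat.zero_le k)) ?_ (by positivity) (hpos p 0).le
      nlinarith [sq_nonneg (‖V p k (f p)‖ - ‖V p k (g p)‖), sq_nonneg ‖V p k (f p)‖,
        sq_nonneg ‖V p k (g p)‖]
    -- A bound uniform in p: the terms with k ≥ 1 at a prime where both exponents vanish then add up
    -- to at most L(1 - |V_p(0,0)|²).
    obtain ⟨L, hL⟩ : ∃ L, ∀ p, lam p 0 ≤ L := ⟨1 + ∑' p, (lam p 0 - 1), fun p => by
      have := hlam.le_tsum p fun q _ => by linarith [hone q]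
      linarith⟩
    have key : HasSum (fun h : α →₀ ℕ => ∏' p, φ p (h p))
        (((∏' p, A p (f p) (g p) : ℝ)) : ℂ) := by
      refine hasSum_tprod_finsupp (fun p => (hD p).diag (f p) (g p)) hφs ?_ ?_ ?_
      · have : Summable fun p => ∑' k, lam p (k + 1) * ‖V p (k + 1) 0‖ ^ 2 := by
          refine Summable.of_nonneg_of_le (fun p => tsum_nonneg fun k =>
            mul_nonneg (hpos _ _).le (sq_nonneg _)) (fun p => ?_) (hsum.mul_left L)
          have h1 := (hasSum_nat_add_iff' 1).mpr ((hD p).hasSum_norm_sq_col 0)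
          have h2 := (summable_nat_add_iff 1).mpr ((hD p).hasSum_mul_norm_sq 0).summable
          simp only [Finset.range_one, Finset.sum_singleton] at h1
          refine hasSum_le (fun k => ?_) h2.hasSum (h1.mul_left L)
          exact mul_le_mul_of_nonneg_right ((hanti p (Nat.zero_le _)).trans (hL p)) (sq_nonneg _)
        refine (summable_congr_cofinite ?_).mp this
        filter_upwards [hzero] with p hp
        refine tsum_congr fun k => ?_
        rw [hval p hp, Complex.norm_real, Real.norm_eq_abs,
          abs_of_nonneg (mul_nonneg (hpos _ _).le (sq_nonneg _))]
      · have : Summable fun p => |lam p 0 * ‖V p 0 0‖ ^ 2 - 1| := by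
          refine Summable.of_nonneg_of_le (fun p => abs_nonneg _) (fun p => ?_) (hlam.add hsum)
          rw [abs_le]
          have := hle p
          have := hone p
          have := sq_nonneg ‖V p 0 0‖
          constructor <;> nlinarith
        refine (summable_congr_cofinite ?_).mp this
        filter_upwards [hzero] with p hp
        rw [hval p hp, ← Complex.ofReal_one, ← Complex.ofReal_sub, Complex.norm_real,
          Real.norm_eq_abs]
      · have h1 : HasProd (fun p => A p (f p) (g p)) (∏' p, A p (f p) (g p)) := by
          refine (multipliable_of_ne_finset_one (s := f.support ∪ g.support) fun p hp => ?_).hasProd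
          have hp' : f p = 0 ∧ g p = 0 := by simpa using hp
          rw [hp'.1, hp'.2, hA]
        exact h1.map Complex.ofRealHom Complex.continuous_ofReal
    simpa only [hφ] using key


/-! ### Prime factorisation and the tensor structure of the lcm matrix -/

/-- The prime factorization as an equivalence. -/
noncomputable def primeExp : ℕ+ ≃ (Nat.Primes →₀ ℕ) :=
  Equiv.ofBijective
    (fun n => (n : ℕ).factorization.comapDomain (fun p : Nat.Primes => (p : ℕ))
      Subtype.val_injective.injOn) (by
    constructor
    · intro m n h
      refine PNat.eq (Nat.eq_of_factorization_eq m.ne_zero n.ne_zero fun p => ?_)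
      by_cases hp : p.Prime
      · exact DFunLike.congr_fun h (⟨p, hp⟩ : Nat.Primes)
      · rw [Nat.factorization_eq_zero_of_not_prime _ hp, Nat.factorization_eq_zero_of_not_prime _ hp]
    · intro f
      let g := f.embDomain ⟨fun p : Nat.Primes => (p : ℕ), Subtype.val_injective⟩
      have hg : ∀ p ∈ g.support, p.Prime := fun p hp => by
        rw [Finsupp.support_embDomain, Finset.mem_map] at hp
        obtain ⟨q, -, rfl⟩ := hp
        exact q.2
      refine ⟨Nat.factorizationEquiv.symm ⟨g, hg⟩, Finsupp.ext fun p => ?_⟩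
      have h1 := congrArg Subtype.val (Nat.factorizationEquiv.apply_symm_apply ⟨g, hg⟩)
      have h2 := DFunLike.congr_fun h1 (p : ℕ)
      refine h2.trans ?_
      exact Finsupp.embDomain_apply_self _ _ p)

theorem primeExp_apply (n : ℕ+) (p : Nat.Primes) : primeExp n p = (n : ℕ).factorization p := rfl

theorem primeExp_mul (m n : ℕ+) : primeExp (m * n) = primeExp m + primeExp n := by
  ext p
  simp [primeExp_apply, Nat.factorization_mul]

/-- A prime number as a positive integer. -/
def Nat.Primes.toPNat' (p : Nat.Primes) : ℕ+ := ⟨p, p.2.pos⟩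

theorem Nat.Primes.coe_toPNat'_pow (p : Nat.Primes) (k : ℕ) :
    ((p.toPNat' ^ k : ℕ+) : ℕ) = (p : ℕ) ^ k := by
  rw [PNat.pow_coe]
  rfl

theorem primeExp_prime_pow_mul_self (p : Nat.Primes) (k : ℕ) (n : ℕ+) :
    primeExp (p.toPNat' ^ k * n) p = k + primeExp n p := by
  rw [primeExp_mul, Finsupp.add_apply, primeExp_apply, p.coe_toPNat'_pow]
  simp [p.2.factorization]

theorem primeExp_prime_pow_mul_of_ne {p q : Nat.Primes} (h : q ≠ p) (k : ℕ) (n : ℕ+) :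
    primeExp (p.toPNat' ^ k * n) q = primeExp n q := by
  have : (p : ℕ) ≠ q := fun h' => h (Subtype.ext h'.symm)
  rw [primeExp_mul, Finsupp.add_apply, primeExp_apply, p.coe_toPNat'_pow]
  simp [p.2.factorization, this]

theorem exists_eq_prime_pow_mul (p : Nat.Primes) (n : ℕ+) {k : ℕ} (hk : k ≤ primeExp n p) :
    ∃ m : ℕ+, n = p.toPNat' ^ k * m := by
  have : (p : ℕ) ^ k ∣ n := (p.2.pow_dvd_iff_le_factorization n.ne_zero).mpr hk
  obtain ⟨m, hm⟩ := this
  have hm0 : 0 < m := Nat.pos_of_ne_zero fun h => n.ne_zero (by rw [hm, h, mul_zero])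
  exact ⟨Nat.toPNat m hm0, PNat.eq (by rw [PNat.mul_coe, p.coe_toPNat'_pow]; exact hm)⟩

theorem prod_pow_primeExp (n : ℕ+) {S : Finset Nat.Primes} (hS : (primeExp n).support ⊆ S) :
    ∏ p ∈ S, (p : ℕ) ^ primeExp n p = n := by
  classical
  refine Nat.eq_of_factorization_eq (Finset.prod_ne_zero_iff.mpr fun p _ =>
    pow_ne_zero _ p.2.ne_zero) n.ne_zero fun q => ?_
  rw [Nat.factorization_prod fun p _ => pow_ne_zero _ p.2.ne_zero, Finsupp.finsetSum_apply]
  by_cases hq : q.Prime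
  · refine (Finset.sum_eq_single (⟨q, hq⟩ : Nat.Primes) ?_ ?_).trans ?_
    · intro p _ hp
      have : (p : ℕ) ≠ q := fun h => hp (Subtype.ext h)
      simp [p.2.factorization, this]
    · intro h
      have := Finsupp.notMem_support_iff.mp fun h' => h (hS h')
      rw [this]; simp
    · simp [hq.factorization]
      rfl
  · rw [Nat.factorization_eq_zero_of_not_prime _ hq]
    exact Finset.sum_eq_zero fun p _ => Nat.factorization_eq_zero_of_not_prime _ hq

theorem primeExp_lcm (m n : ℕ+) (p : Nat.Primes) :
    primeExp (PNat.lcm m n) p = max (primeExp m p) (primeExp n p) := by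
  rw [primeExp_apply, PNat.lcm_coe, Nat.factorization_lcm m.ne_zero n.ne_zero]
  rfl

/-- The exponents of the lcm are the maxima of the exponents, and the local factor is 1 at every
prime dividing neither number. -/
theorem lcmMatrix_eq_tprod (σ τ : ℝ) (n m : ℕ+) :
    lcmMatrix σ τ n m = ∏' p : Nat.Primes, localMatrix σ τ p (primeExp n p) (primeExp m p) := by
  classical
  set S := (primeExp n).support ∪ (primeExp m).support with hS
  have hpow : ∀ (k : ℕ+) (s : ℝ), (primeExp k).support ⊆ S →
      (k : ℝ) ^ s = ∏ p ∈ S, ((p : ℕ) : ℝ) ^ (s * primeExp k p) := fun k s hk => by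
    rw [← prod_pow_primeExp k hk]
    push_cast
    rw [← Real.finsetProd_rpow _ _ fun p _ => by positivity]
    refine Finset.prod_congr rfl fun p _ => ?_
    rw [← Real.rpow_natCast, ← Real.rpow_mul (by positivity), mul_comm]
  have hlcm : (primeExp (PNat.lcm n m)).support ⊆ S := fun p hp => by
    rw [Finsupp.mem_support_iff, primeExp_lcm] at hp
    simp only [hS, Finset.mem_union, Finsupp.mem_support_iff]
    by_contra! h
    simp [h.1, h.2] at hp
  rw [tprod_eq_prod (s := S)]
  · rw [lcmMatrix, ← PNat.lcm_coe, hpow n σ Finset.subset_union_left,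
      hpow m σ Finset.subset_union_right, hpow _ τ hlcm, ← Finset.prod_mul_distrib,
      ← Finset.prod_div_distrib]
    refine Finset.prod_congr rfl fun p _ => ?_
    rw [localMatrix, primeExp_lcm, neg_mul, Real.rpow_neg (by positivity)]
    field_simp
  · intro p hp
    simp only [hS, Finset.mem_union, Finsupp.mem_support_iff, not_or, not_not] at hp
    simp [localMatrix, hp.1, hp.2]

/-- Substitute max(j,k) = (j + k + |j-k|)/2 in the exponent of p. -/
theorem localMatrix_eq (σ τ : ℝ) {p : ℕ} (hp : 0 < p) :
    localMatrix σ τ p = weightedToeplitz ((p : ℝ) ^ (-(τ - 2 * σ) / 2)) ((p : ℝ) ^ (-τ / 2)) := by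
  have hp' : (0 : ℝ) < p := by exact_mod_cast hp
  ext j k
  rw [localMatrix, weightedToeplitz, ← Real.rpow_natCast, ← Real.rpow_natCast,
    ← Real.rpow_mul hp'.le, ← Real.rpow_mul hp'.le, ← Real.rpow_add hp', ← Real.rpow_add hp',
    ← Real.rpow_add hp']
  congr 1
  rw [Nat.cast_sub (min_le_max)]
  have : ((max j k : ℕ) : ℝ) + (min j k : ℕ) = j + k := by exact_mod_cast max_add_min j k
  have h2 : ((min j k : ℕ) : ℝ) = j + k - (max j k : ℕ) := by linarith
  rw [h2]
  push_cast
  ring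

theorem tendsto_primes_cofinite_atTop :
    Tendsto (fun p : Nat.Primes => ((p : ℕ) : ℝ)) cofinite atTop := by
  have h : Tendsto (fun p : Nat.Primes => (p : ℕ)) cofinite cofinite :=
    Subtype.val_injective.tendsto_cofinite
  rw [Nat.cofinite_eq_atTop] at h
  exact tendsto_natCast_atTop_atTop.comp h

/-- The spectral data at the prime `p` for the parameters `σ`, `τ`. -/
def IsPrimeSpectralData (σ τ : ℝ) (lam : Nat.Primes → ℕ → ℝ) (V : Nat.Primes → ℕ → ℕ → ℂ) : Prop :=
  ∀ p : Nat.Primes, IsSpectralData (((p : ℕ) : ℝ) ^ (-(τ - 2 * σ) / 2)) (((p : ℕ) : ℝ) ^ (-τ / 2))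
    (lam p) (V p)

theorem prime_rpow_lt_one (p : Nat.Primes) {s : ℝ} (hs : s < 0) : ((p : ℕ) : ℝ) ^ s < 1 :=
  Real.rpow_lt_one_of_one_lt_of_neg (by exact_mod_cast p.2.one_lt) hs

theorem prime_rpow_le_two_rpow (p : Nat.Primes) {s : ℝ} (hs : s ≤ 0) :
    ((p : ℕ) : ℝ) ^ s ≤ (2 : ℝ) ^ s :=
  Real.rpow_le_rpow_of_nonpos (by norm_num) (by exact_mod_cast p.2.two_le) hs

theorem prime_rpow_pos (p : Nat.Primes) (s : ℝ) : 0 < ((p : ℕ) : ℝ) ^ s :=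
  Real.rpow_pos_of_pos (by exact_mod_cast p.2.pos) s

theorem exists_isPrimeSpectralData {σ τ : ℝ} (hρ : 0 < τ - 2 * σ) (hτ : 0 < τ) :
    ∃ lam V, IsPrimeSpectralData σ τ lam V := by
  choose lam V h using fun p : Nat.Primes => exists_isSpectralData
    (prime_rpow_pos p (-(τ - 2 * σ) / 2)) (prime_rpow_lt_one p (by linarith))
    (prime_rpow_pos p (-τ / 2)) (prime_rpow_lt_one p (by linarith))
  exact ⟨lam, V, h⟩

/-- For almost all p the perturbation bounds apply, because λ_1 ≤ (1-q)^(-2) p^(-ρ) tends to 0. They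
are multiples of (rq)² = p^(-(τ+ρ)), which is summable over primes since τ + ρ > 1. -/
theorem IsPrimeSpectralData.summable {σ τ : ℝ} {lam : Nat.Primes → ℕ → ℝ}
    {V : Nat.Primes → ℕ → ℕ → ℂ} (h : IsPrimeSpectralData σ τ lam V) (hρ : 0 < τ - 2 * σ)
    (hτρ : 1 < τ + (τ - 2 * σ)) (hτ : 0 < τ) :
    (Summable fun p => 1 - ‖V p 0 0‖ ^ 2) ∧ Summable fun p => lam p 0 - 1 := by
  have hu : ∀ p : Nat.Primes, ((((p : ℕ) : ℝ) ^ (-(τ - 2 * σ) / 2)) * (((p : ℕ) : ℝ) ^ (-τ / 2))) ^ 2 =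
      ((p : ℕ) : ℝ) ^ (-(τ + (τ - 2 * σ))) := fun p => by
    have hp : (0 : ℝ) < (p : ℕ) := by exact_mod_cast p.2.pos
    rw [← Real.rpow_add hp, ← Real.rpow_natCast, ← Real.rpow_mul hp.le]
    congr 1
    push_cast
    ring
  have hsum : Summable fun p : Nat.Primes => ((p : ℕ) : ℝ) ^ (-(τ + (τ - 2 * σ))) :=
    Nat.Primes.summable_rpow.mpr (by linarith)
  have hlam1 : ∀ᶠ p in cofinite, lam p 1 ≤ 1 / 2 := by
    have hq0 : (2 : ℝ) ^ (-τ / 2) < 1 := Real.rpow_lt_one_of_one_lt_of_neg (by norm_num) (by linarith)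
    have h1 : Tendsto (fun p : Nat.Primes => (1 - (2 : ℝ) ^ (-τ / 2))⁻¹ ^ 2 *
        (((p : ℕ) : ℝ) ^ (-((τ - 2 * σ) / 2))) ^ 2) cofinite (𝓝 ((1 - (2 : ℝ) ^ (-τ / 2))⁻¹ ^ 2 * 0 ^ 2)) :=
      (((tendsto_rpow_neg_atTop (by linarith)).comp tendsto_primes_cofinite_atTop).pow 2).const_mul _
    rw [zero_pow two_ne_zero, mul_zero] at h1
    filter_upwards [h1.eventually (gt_mem_nhds (show (0 : ℝ) < 1 / 2 by norm_num))] with p hp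
    refine ((h p).upper 1).trans (le_trans ?_ hp.le)
    have := prime_rpow_le_two_rpow p (show -τ / 2 ≤ 0 by linarith)
    rw [neg_div 2 (τ - 2 * σ), mul_one]
    exact mul_le_mul_of_nonneg_right (pow_le_pow_left₀ (inv_nonneg.mpr (by linarith))
      (inv_anti₀ (by linarith) (by linarith)) 2) (by positivity)
  have hsmall : ∀ᶠ p : Nat.Primes in cofinite, ((p : ℕ) : ℝ) ^ (-(τ + (τ - 2 * σ))) ≤ 1 / 9 := by
    have h1 := (tendsto_rpow_neg_atTop (show 0 < τ + (τ - 2 * σ) by linarith)).comp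
      tendsto_primes_cofinite_atTop
    filter_upwards [h1.eventually (gt_mem_nhds (show (0 : ℝ) < 1 / 9 by norm_num))] with p hp
    exact hp.le
  constructor
  · refine Summable.of_norm_bounded_eventually (hsum.mul_left 8) ?_
    filter_upwards [hlam1, hsmall] with p h1 h2
    have h3 := ((h p).top h1 (by rwa [hu])).1
    have h4 : ‖V p 0 0‖ ^ 2 ≤ 1 :=
      le_hasSum ((h p).diagonalizes.hasSum_norm_sq_row 0) 0 fun j _ => sq_nonneg _
    rw [Real.norm_eq_abs, abs_of_nonneg (by linarith), ← hu]
    exact h3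
  · refine Summable.of_norm_bounded_eventually (hsum.mul_left 16) ?_
    filter_upwards [hlam1, hsmall] with p h1 h2
    have h3 := ((h p).top h1 (by rwa [hu])).2
    rw [Real.norm_eq_abs, abs_of_nonneg (by linarith [(h p).one_le]), ← hu]
    linarith

theorem IsPrimeSpectralData.diagonalizes {σ τ : ℝ} {lam : Nat.Primes → ℕ → ℝ}
    {V : Nat.Primes → ℕ → ℕ → ℂ} (h : IsPrimeSpectralData σ τ lam V) (hρ : 0 < τ - 2 * σ)
    (hτρ : 1 < τ + (τ - 2 * σ)) (hτ : 0 < τ) :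
    Diagonalizes (lcmMatrix σ τ) (fun n => ∏' p, lam p (primeExp n p))
      (fun n m => ∏' p, V p (primeExp n p) (primeExp m p)) := by
  obtain ⟨h1, h2⟩ := h.summable hρ hτρ hτ
  have := (diagonalizes_tprod (fun p => (h p).diagonalizes) (fun p => (h p).antitone)
    (fun p => (h p).pos) (fun p => (h p).phase) h1 (fun p => (h p).one_le) h2
    (fun p => by simp [weightedToeplitz])).comp_equiv primeExp primeExp
  have hM : lcmMatrix σ τ = fun n m => ∏' p : Nat.Primes,
      weightedToeplitz (((p : ℕ) : ℝ) ^ (-(τ - 2 * σ) / 2)) (((p : ℕ) : ℝ) ^ (-τ / 2))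
        (primeExp n p) (primeExp m p) := by
    ext n m
    rw [lcmMatrix_eq_tprod]
    refine tprod_congr fun p => ?_
    rw [localMatrix_eq σ τ p.2.pos]
  rw [hM]
  exact this


/-! ### Counting integers below a weight that involves finitely many primes -/

theorem Finset.card_pnat_le {s : Finset ℕ+} {x : ℝ} (hx : 0 ≤ x) (h : ∀ n ∈ s, (n : ℝ) ≤ x) :
    (s.card : ℝ) ≤ x := by
  have h1 : s.card ≤ ⌊x⌋₊ := by
    rw [← Finset.card_map ⟨fun n : ℕ+ => (n : ℕ), PNat.coe_injective⟩, ← Nat.card_Icc 1 ⌊x⌋₊ |>.trans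
      (by omega : ⌊x⌋₊ + 1 - 1 = ⌊x⌋₊)]
    refine Finset.card_le_card fun m hm => ?_
    obtain ⟨n, hn, rfl⟩ := Finset.mem_map.mp hm
    exact Finset.mem_Icc.mpr ⟨n.pos, Nat.le_floor (h n hn)⟩
  exact (Nat.cast_le.mpr h1).trans (Nat.floor_le hx)

theorem finite_setOf_pnat_lt (x : ℝ) : {n : ℕ+ | (n : ℝ) < x}.Finite := by
  refine Set.Finite.of_finite_image (f := fun n : ℕ+ => (n : ℕ)) ?_ PNat.coe_injective.injOn
  refine (Set.finite_Iio ⌈x⌉₊).subset ?_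
  rintro _ ⟨n, hn, rfl⟩
  exact Nat.lt_ceil.mpr hn

theorem ncard_pnat_le {s : Set ℕ+} {x : ℝ} (hx : 0 ≤ x) (h : ∀ n ∈ s, (n : ℝ) < x) :
    (s.ncard : ℝ) ≤ x := by
  have hfin : s.Finite := (finite_setOf_pnat_lt x).subset h
  rw [Set.ncard_eq_toFinset_card s hfin]
  exact Finset.card_pnat_le hx fun n hn => (h n (by simpa using hn)).le

theorem le_ncard_pnat (x : ℝ) : x - 1 ≤ ({n : ℕ+ | (n : ℝ) < x}.ncard : ℝ) := by
  have h1 : ((fun n : ℕ+ => (n : ℕ)) '' {n : ℕ+ | (n : ℝ) < x}) = Finset.Ico 1 ⌈x⌉₊ := by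
    ext m
    simp only [Set.mem_image, Finset.coe_Ico, Set.mem_Ico]
    constructor
    · rintro ⟨n, hn, rfl⟩
      exact ⟨n.pos, Nat.lt_ceil.mpr hn⟩
    · rintro ⟨h1, h2⟩
      exact ⟨Nat.toPNat m h1, Nat.lt_ceil.mp h2, rfl⟩
  rw [← Set.ncard_image_of_injective _ PNat.coe_injective, h1, Set.ncard_coe_finset, Nat.card_Ico]
  have h2 := Nat.le_ceil x
  have h3 : (⌈x⌉₊ : ℝ) ≤ ((⌈x⌉₊ - 1 : ℕ) : ℝ) + 1 := by
    have : ⌈x⌉₊ ≤ (⌈x⌉₊ - 1) + 1 := by omega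
    exact_mod_cast this
  linarith

theorem tendsto_ncard_pnat_div :
    Tendsto (fun x : ℝ => ({n : ℕ+ | (n : ℝ) < x}.ncard : ℝ) / x) atTop (𝓝 1) := by
  have h1 : Tendsto (fun x : ℝ => 1 - x⁻¹) atTop (𝓝 1) := by
    simpa using tendsto_inv_atTop_zero.const_sub (1 : ℝ)
  refine tendsto_of_tendsto_of_tendsto_of_le_of_le' h1 tendsto_const_nhds ?_ ?_
  · filter_upwards [eventually_gt_atTop 0] with x hx
    rw [le_div_iff₀ hx, sub_mul, inv_mul_cancel₀ hx.ne', one_mul]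
    exact le_ncard_pnat x
  · filter_upwards [eventually_gt_atTop 0] with x hx
    rw [div_le_one hx]
    exact ncard_pnat_le hx.le fun n hn => hn

/-- The product of the local weights over the primes in a finite set. -/
noncomputable def localWeight (b : Nat.Primes → ℕ → ℝ) (S : Finset Nat.Primes) (n : ℕ+) : ℝ :=
  ∏ p ∈ S, b p (primeExp n p)

/-- The positive integers below `x` times the local weight. -/
def weightedBelow (b : Nat.Primes → ℕ → ℝ) (S : Finset Nat.Primes) (x : ℝ) : Set ℕ+ :=
  {n | (n : ℝ) < x * localWeight b S n}

theorem localWeight_nonneg {b : Nat.Primes → ℕ → ℝ} (h0 : ∀ p k, 0 < b p k) (S : Finset Nat.Primes)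
    (n : ℕ+) : 0 < localWeight b S n := Finset.prod_pos fun p _ => h0 p _

theorem localWeight_le {b : Nat.Primes → ℕ → ℝ} {a : Nat.Primes → ℝ} (h0 : ∀ p k, 0 < b p k)
    (h1 : ∀ p k, b p k ≤ a p) (S : Finset Nat.Primes) (n : ℕ+) :
    localWeight b S n ≤ ∏ p ∈ S, a p :=
  Finset.prod_le_prod (fun p _ => (h0 p _).le) fun p _ => h1 p _

theorem weightedBelow_subset {b : Nat.Primes → ℕ → ℝ} {a : Nat.Primes → ℝ} (h0 : ∀ p k, 0 < b p k)
    (h1 : ∀ p k, b p k ≤ a p) (S : Finset Nat.Primes) {x : ℝ} (hx : 0 ≤ x) :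
    weightedBelow b S x ⊆ {n | (n : ℝ) < x * ∏ p ∈ S, a p} := fun n hn =>
  lt_of_lt_of_le hn (mul_le_mul_of_nonneg_left (localWeight_le h0 h1 S n) hx)

theorem localWeight_prime_pow_mul {b : Nat.Primes → ℕ → ℝ} {S : Finset Nat.Primes} {p : Nat.Primes}
    (hp : p ∉ S) (k : ℕ) (n : ℕ+) :
    localWeight b S (p.toPNat' ^ k * n) = localWeight b S n := by
  refine Finset.prod_congr rfl fun q hq => ?_
  have hqp : q ≠ p := fun h => hp (h ▸ hq)
  rw [primeExp_prime_pow_mul_of_ne hqp]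

theorem coe_prime_pow_mul (p : Nat.Primes) (k : ℕ) (n : ℕ+) :
    ((p.toPNat' ^ k * n : ℕ+) : ℝ) = ((p : ℕ) : ℝ) ^ k * n := by
  rw [← Nat.cast_pow, ← Nat.cast_mul, ← p.coe_toPNat'_pow, ← PNat.mul_coe]

/-- Counting by the exponent of `p`. -/
theorem hasSum_ncard_fiber {X : Set ℕ+} (hX : X.Finite) (f : ℕ+ → ℕ) :
    HasSum (fun k => (({n ∈ X | f n = k}).ncard : ℝ)) X.ncard := by
  classical
  have h : (X.ncard : ℝ) = ∑ k ∈ hX.toFinset.image f, (({n ∈ X | f n = k}).ncard : ℝ) := by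
    rw [Set.ncard_eq_toFinset_card X hX, Finset.card_eq_sum_card_image f hX.toFinset, Nat.cast_sum]
    refine Finset.sum_congr rfl fun k _ => ?_
    rw [← Set.ncard_coe_finset]
    congr 2
    ext n
    simp
  rw [h]
  refine hasSum_sum_of_ne_finset_zero fun k hk => ?_
  rw [Nat.cast_eq_zero]
  have : {n ∈ X | f n = k} = ∅ := by
    ext n
    simp only [Set.mem_ofPred_eq, Set.mem_empty_iff_false, iff_false, not_and]
    rintro hn rfl
    exact hk (Finset.mem_image_of_mem f (by simpa using hn))
  rw [this, Set.ncard_empty]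

theorem prime_pow_mul_injective (p : Nat.Primes) (k : ℕ) :
    Function.Injective fun n : ℕ+ => p.toPNat' ^ k * n := fun _ _ h => mul_left_cancel h

/-- Write n = p^k m with m prime to p: the weight at p is then the constant b_p(k), and it merely
rescales x. -/
theorem ncard_fiber_eq {b : Nat.Primes → ℕ → ℝ} {S : Finset Nat.Primes} {p : Nat.Primes}
    (hp : p ∉ S) (x : ℝ) (k : ℕ) :
    {n ∈ weightedBelow b (insert p S) x | primeExp n p = k}.ncard =
      {n ∈ weightedBelow b S (x * b p k / ((p : ℕ) : ℝ) ^ k) | primeExp n p = 0}.ncard := by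
  have hpk : (0 : ℝ) < ((p : ℕ) : ℝ) ^ k := pow_pos (by exact_mod_cast p.2.pos) k
  rw [← Set.ncard_image_of_injective
    {n ∈ weightedBelow b S (x * b p k / ((p : ℕ) : ℝ) ^ k) | primeExp n p = 0}
    (prime_pow_mul_injective p k)]
  congr 1
  have key : ∀ m : ℕ+, primeExp m p = 0 → (p.toPNat' ^ k * m ∈ weightedBelow b (insert p S) x ↔
      m ∈ weightedBelow b S (x * b p k / ((p : ℕ) : ℝ) ^ k)) := fun m hm => by
    simp only [weightedBelow, Set.mem_ofPred_eq]
    rw [coe_prime_pow_mul, localWeight, Finset.prod_insert hp, ← localWeight,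
      localWeight_prime_pow_mul hp, primeExp_prime_pow_mul_self, hm, add_zero, div_mul_eq_mul_div,
      lt_div_iff₀ hpk, mul_comm (m : ℝ), mul_assoc x]
  ext n
  constructor
  · rintro ⟨hn, hk⟩
    obtain ⟨m, rfl⟩ := exists_eq_prime_pow_mul p n hk.ge
    rw [primeExp_prime_pow_mul_self] at hk
    have hm : primeExp m p = 0 := by omega
    exact ⟨m, ⟨(key m hm).mp hn, hm⟩, rfl⟩
  · rintro ⟨m, ⟨hm, hm0⟩, rfl⟩
    exact ⟨(key m hm0).mpr hm, by rw [primeExp_prime_pow_mul_self, hm0, add_zero]⟩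

/-- The multiples of p are removed by n = pm, which does not affect a weight that ignores p. This is
the source of the factor 1 - 1/p. -/
theorem ncard_fiber_zero_add {b : Nat.Primes → ℕ → ℝ} {S : Finset Nat.Primes} {p : Nat.Primes}
    (hp : p ∉ S) (x : ℝ) (hfin : (weightedBelow b S x).Finite) :
    {n ∈ weightedBelow b S x | primeExp n p = 0}.ncard +
      (weightedBelow b S (x / ((p : ℕ) : ℝ))).ncard = (weightedBelow b S x).ncard := by
  have hp0 : (0 : ℝ) < ((p : ℕ) : ℝ) := by exact_mod_cast p.2.pos
  have key : ∀ m : ℕ+, p.toPNat' ^ 1 * m ∈ weightedBelow b S x ↔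
      m ∈ weightedBelow b S (x / ((p : ℕ) : ℝ)) := fun m => by
    simp only [weightedBelow, Set.mem_ofPred_eq]
    rw [coe_prime_pow_mul, localWeight_prime_pow_mul hp, pow_one, div_mul_eq_mul_div,
      lt_div_iff₀ hp0, mul_comm (m : ℝ)]
  have himg : (fun n : ℕ+ => p.toPNat' ^ 1 * n) '' weightedBelow b S (x / ((p : ℕ) : ℝ)) =
      {n ∈ weightedBelow b S x | ¬ primeExp n p = 0} := by
    ext n
    constructor
    · rintro ⟨m, hm, rfl⟩
      exact ⟨(key m).mpr hm, by rw [primeExp_prime_pow_mul_self]; omega⟩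
    · rintro ⟨hn, h0⟩
      obtain ⟨m, rfl⟩ := exists_eq_prime_pow_mul p n (Nat.one_le_iff_ne_zero.mpr h0)
      exact ⟨m, (key m).mp hn, rfl⟩
  rw [← Set.ncard_image_of_injective (weightedBelow b S (x / ((p : ℕ) : ℝ)))
    (prime_pow_mul_injective p 1), himg,
    ← Set.ncard_union_eq ?_ (hfin.subset fun n hn => hn.1) (hfin.subset fun n hn => hn.1)]
  · congr 1
    ext n
    simp only [Set.mem_union, Set.mem_ofPred_eq]
    tauto
  · rw [Set.disjoint_left]
    rintro n ⟨-, h1⟩ ⟨-, h2⟩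
    exact h2 h1

/-- The density of the integers below a local weight which depends on finitely many primes. -/
theorem tendsto_ncard_weightedBelow {b : Nat.Primes → ℕ → ℝ} {a : Nat.Primes → ℝ}
    (h0 : ∀ p k, 0 < b p k) (h1 : ∀ p k, b p k ≤ a p) (S : Finset Nat.Primes) :
    Tendsto (fun x : ℝ => ((weightedBelow b S x).ncard : ℝ) / x) atTop
      (𝓝 (∏ p ∈ S, (1 - 1 / ((p : ℕ) : ℝ)) * ∑' k, b p k / ((p : ℕ) : ℝ) ^ k)) := by
  classical
  have ha : ∀ p, 0 < a p := fun p => (h0 p 0).trans_le (h1 p 0)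
  induction S using Finset.induction_on with
  | empty => simpa [weightedBelow, localWeight] using tendsto_ncard_pnat_div
  | insert p S hp ih =>
    set M := ∏ p ∈ S, (1 - 1 / ((p : ℕ) : ℝ)) * ∑' k, b p k / ((p : ℕ) : ℝ) ^ k with hM
    rw [Finset.prod_insert hp, ← hM]
    have hp1 : (1 : ℝ) < ((p : ℕ) : ℝ) := by exact_mod_cast p.2.one_lt
    have hp0 : (0 : ℝ) < ((p : ℕ) : ℝ) := by linarith
    have hfin : ∀ S : Finset Nat.Primes, ∀ x : ℝ, 0 ≤ x → (weightedBelow b S x).Finite :=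
      fun S x hx => (finite_setOf_pnat_lt _).subset (weightedBelow_subset h0 h1 S hx)
    let G : ℝ → ℝ := fun y => ({n ∈ weightedBelow b S y | primeExp n p = 0}.ncard : ℝ)
    have hG : ∀ y, 0 ≤ y → G y = ((weightedBelow b S y).ncard : ℝ) -
        (weightedBelow b S (y / ((p : ℕ) : ℝ))).ncard := fun y hy => by
      rw [eq_sub_iff_add_eq]
      simp only [G]
      exact_mod_cast ncard_fiber_zero_add hp y (hfin S y hy)
    have hGle : ∀ y, 0 ≤ y → G y ≤ y * ∏ p ∈ S, a p := fun y hy =>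
      ncard_pnat_le (mul_nonneg hy (Finset.prod_nonneg fun q _ => (ha q).le))
        fun n hn => weightedBelow_subset h0 h1 S hy hn.1
    have hcpos : ∀ k, 0 < b p k / ((p : ℕ) : ℝ) ^ k := fun k => div_pos (h0 p k) (by positivity)
    have hlim : ∀ c : ℝ, 0 < c → Tendsto (fun x => ((weightedBelow b S (c * x)).ncard : ℝ) / x)
        atTop (𝓝 (c * M)) := fun c hc => by
      have h := (ih.comp (tendsto_id.const_mul_atTop hc)).const_mul c
      refine h.congr' ?_
      filter_upwards [eventually_gt_atTop 0] with x hx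
      simp only [Function.comp, id]
      field_simp
    have hGlim : ∀ k, Tendsto (fun x => G (b p k / ((p : ℕ) : ℝ) ^ k * x) / x) atTop
        (𝓝 (b p k / ((p : ℕ) : ℝ) ^ k * ((1 - 1 / ((p : ℕ) : ℝ)) * M))) := fun k => by
      have h := (hlim _ (hcpos k)).sub (hlim _ (div_pos (hcpos k) hp0))
      have e : b p k / ((p : ℕ) : ℝ) ^ k * M - b p k / ((p : ℕ) : ℝ) ^ k / ((p : ℕ) : ℝ) * M =
          b p k / ((p : ℕ) : ℝ) ^ k * ((1 - 1 / ((p : ℕ) : ℝ)) * M) := by ring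
      rw [e] at h
      refine h.congr' ?_
      filter_upwards [eventually_gt_atTop 0] with x hx
      rw [hG _ (mul_nonneg (hcpos k).le hx.le), sub_div,
        div_mul_eq_mul_div _ ((p : ℕ) : ℝ) x]
    -- Dominated convergence over the exponent k of p: the bound b_p(k) ≤ a_p gives a geometric
    -- majorant independent of x.
    have hgeo : Summable fun k => (∏ q ∈ S, a q) * (a p * (((p : ℕ) : ℝ)⁻¹) ^ k) :=
      ((summable_geometric_of_lt_one (by positivity) (inv_lt_one_of_one_lt₀ hp1)).mul_left _).mul_left _
    have htan := tendsto_tsum_of_dominated_convergence (𝓕 := (atTop : Filter ℝ)) hgeo hGlim (by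
      filter_upwards [eventually_gt_atTop 0] with x hx k
      have h2 : 0 ≤ G (b p k / ((p : ℕ) : ℝ) ^ k * x) := Nat.cast_nonneg _
      rw [Real.norm_eq_abs, abs_of_nonneg (div_nonneg h2 hx.le), div_le_iff₀ hx]
      refine (hGle _ (mul_nonneg (hcpos k).le hx.le)).trans ?_
      have h3 : b p k / ((p : ℕ) : ℝ) ^ k ≤ a p * (((p : ℕ) : ℝ)⁻¹) ^ k := by
        rw [inv_pow, ← div_eq_mul_inv]
        gcongr
        exact h1 p k
      have h4 : 0 ≤ ∏ q ∈ S, a q := Finset.prod_nonneg fun q _ => (ha q).le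
      calc b p k / ((p : ℕ) : ℝ) ^ k * x * ∏ q ∈ S, a q
          ≤ (a p * (((p : ℕ) : ℝ)⁻¹) ^ k) * x * ∏ q ∈ S, a q := by gcongr
        _ = _ := by ring)
    rw [tsum_mul_right] at htan
    have e : (1 - 1 / ((p : ℕ) : ℝ)) * (∑' k, b p k / ((p : ℕ) : ℝ) ^ k) * M =
        (∑' k, b p k / ((p : ℕ) : ℝ) ^ k) * ((1 - 1 / ((p : ℕ) : ℝ)) * M) := by ring
    rw [e]
    refine htan.congr' ?_
    filter_upwards [eventually_gt_atTop 0] with x hx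
    rw [tsum_div_const]
    congr 1
    refine HasSum.tsum_eq ((hasSum_ncard_fiber (hfin (insert p S) x hx.le)
      fun n => primeExp n p).of_forall_eq fun k => ?_)
    rw [ncard_fiber_eq hp, mul_div_assoc, mul_comm x]


/-! ### Moments of products over prime divisors -/

theorem prod_dvd_of_subset_support {n : ℕ+} {D : Finset Nat.Primes}
    (hD : D ⊆ (primeExp n).support) : ∏ p ∈ D, (p : ℕ) ∣ n := by
  rw [← prod_pow_primeExp n subset_rfl]
  exact (Finset.prod_dvd_prod_of_dvd _ _ fun p hp => dvd_pow_self _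
    (Finsupp.mem_support_iff.mp (hD hp))).trans (Finset.prod_dvd_prod_of_subset _ _ _ hD)

theorem card_filter_subset_support_le {s : Finset ℕ+} {z : ℝ} (hz : 0 ≤ z)
    (h : ∀ n ∈ s, (n : ℝ) ≤ z) (D : Finset Nat.Primes) :
    (({n ∈ s | D ⊆ (primeExp n).support}.card : ℕ) : ℝ) ≤ z * ∏ p ∈ D, (1 / ((p : ℕ) : ℝ)) := by
  have h1 : {n ∈ s | D ⊆ (primeExp n).support}.card ≤ ⌊z⌋₊ / ∏ p ∈ D, (p : ℕ) := by
    rw [← Finset.card_map ⟨fun n : ℕ+ => (n : ℕ), PNat.coe_injective⟩,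
      ← Nat.Ioc_filter_dvd_card_eq_div]
    refine Finset.card_le_card fun m hm => ?_
    obtain ⟨n, hn, rfl⟩ := Finset.mem_map.mp hm
    obtain ⟨hn, hD⟩ := Finset.mem_filter.mp hn
    exact Finset.mem_filter.mpr ⟨Finset.mem_Ioc.mpr ⟨n.pos, Nat.le_floor (h n hn)⟩,
      prod_dvd_of_subset_support hD⟩
  refine (Nat.cast_le.mpr h1).trans (Nat.cast_div_le.trans ?_)
  rw [Nat.cast_prod, Finset.prod_div_distrib, Finset.prod_const_one, mul_one_div]
  gcongr
  exact Nat.floor_le hz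

/-- The mean of a product over the prime divisors outside a finite set. -/
theorem sum_prod_support_sub_one_le {c : Nat.Primes → ℝ} (hc : ∀ p, 0 ≤ c p)
    (hs : Summable fun p : Nat.Primes => c p / ((p : ℕ) : ℝ)) (S : Finset Nat.Primes)
    {s : Finset ℕ+} {z : ℝ} (hz : 0 ≤ z) (h : ∀ n ∈ s, (n : ℝ) ≤ z) :
    ∑ n ∈ s, (∏ p ∈ (primeExp n).support \ S, (1 + c p) - 1) ≤
      z * (Real.exp (∑' p : Nat.Primes, c p / ((p : ℕ) : ℝ) -
        ∑ p ∈ S, c p / ((p : ℕ) : ℝ)) - 1) := by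
  have hcp : ∀ p : Nat.Primes, 0 ≤ c p / ((p : ℕ) : ℝ) := fun p =>
    div_nonneg (hc p) (Nat.cast_nonneg _)
  set U := s.biUnion fun n => (primeExp n).support \ S with hU
  have hUS : Disjoint U S := by
    rw [Finset.disjoint_left]
    intro p hp hpS
    obtain ⟨n, -, hn⟩ := Finset.mem_biUnion.mp hp
    exact (Finset.mem_sdiff.mp hn).2 hpS
  -- The product is expanded over the sets D of prime divisors outside `S`; the empty set cancels
  -- the -1. Integers up to z divisible by all of D number at most z/∏p, and the sum over D folds
  -- back into a product.
  have hP : ∀ n ∈ s, ∏ p ∈ (primeExp n).support \ S, (1 + c p) - 1 =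
      ∑ D ∈ U.powerset.erase ∅, if D ⊆ (primeExp n).support then ∏ p ∈ D, c p else 0 := by
    intro n hn
    have hsub : (primeExp n).support \ S ⊆ U :=
      Finset.subset_biUnion_of_mem (fun n => (primeExp n).support \ S) hn
    have he : ∏ p ∈ (primeExp n).support \ S, (1 + c p) =
        ∑ D ∈ U.powerset, if D ⊆ (primeExp n).support then ∏ p ∈ D, c p else 0 := by
      rw [Finset.prod_one_add, ← Finset.sum_filter]
      refine Finset.sum_congr ?_ fun _ _ => rfl
      ext D
      simp only [Finset.mem_powerset, Finset.mem_filter]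
      constructor
      · exact fun hD => ⟨hD.trans hsub, hD.trans Finset.sdiff_subset⟩
      · exact fun hD p hp => Finset.mem_sdiff.mpr
          ⟨hD.2 hp, Finset.disjoint_left.mp hUS (hD.1 hp)⟩
    rw [he, ← Finset.add_sum_erase _ _ (Finset.empty_mem_powerset U)]
    simp
  rw [Finset.sum_congr rfl hP, Finset.sum_comm]
  calc ∑ D ∈ U.powerset.erase ∅, ∑ n ∈ s,
        (if D ⊆ (primeExp n).support then ∏ p ∈ D, c p else 0)
      ≤ ∑ D ∈ U.powerset.erase ∅, z * ∏ p ∈ D, c p / ((p : ℕ) : ℝ) := by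
        refine Finset.sum_le_sum fun D _ => ?_
        rw [← Finset.sum_filter, Finset.sum_const, nsmul_eq_mul]
        refine (mul_le_mul_of_nonneg_right (card_filter_subset_support_le hz h D)
          (Finset.prod_nonneg fun p _ => hc p)).trans_eq ?_
        rw [mul_assoc, ← Finset.prod_mul_distrib]
        simp only [one_div_mul_eq_div]
    _ = z * (∏ p ∈ U, (1 + c p / ((p : ℕ) : ℝ)) - 1) := by
        rw [Finset.prod_one_add, ← Finset.mul_sum,
          ← Finset.add_sum_erase _ _ (Finset.empty_mem_powerset U)]
        simp
    _ ≤ _ := by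
        gcongr
        refine (Real.prod_le_exp_sum U (fun p _ => by linarith [hcp p]) fun p _ => le_rfl).trans ?_
        gcongr
        rw [le_sub_iff_add_le, ← Finset.sum_union hUS]
        exact hs.sum_le_tsum _ fun p _ => hcp p

/-- The product of the values of `a` at the prime divisors of `n` outside `S`. -/
noncomputable def primeDivisorProd (a : Nat.Primes → ℝ) (S : Finset Nat.Primes) (n : ℕ+) : ℝ :=
  ∏ p ∈ (primeExp n).support \ S, a p

theorem one_le_primeDivisorProd {a : Nat.Primes → ℝ} (ha : ∀ p, 1 ≤ a p) (S : Finset Nat.Primes)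
    (n : ℕ+) : 1 ≤ primeDivisorProd a S n :=
  Finset.one_le_prod fun p _ => ha p

theorem summable_sub_one_div {a : Nat.Primes → ℝ} (ha : ∀ p, 1 ≤ a p)
    (hs : Summable fun p : Nat.Primes => (a p ^ 2 - 1) / ((p : ℕ) : ℝ)) :
    Summable fun p : Nat.Primes => (a p - 1) / ((p : ℕ) : ℝ) := by
  refine hs.of_nonneg_of_le
    (fun p => div_nonneg (by linarith [ha p]) (Nat.cast_nonneg _)) fun p => ?_
  gcongr
  nlinarith [ha p]

theorem sum_primeDivisorProd_sq_le {a : Nat.Primes → ℝ} (ha : ∀ p, 1 ≤ a p)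
    (hs : Summable fun p : Nat.Primes => (a p ^ 2 - 1) / ((p : ℕ) : ℝ))
    {s : Finset ℕ+} {z : ℝ} (hz : 0 ≤ z) (h : ∀ n ∈ s, (n : ℝ) ≤ z) :
    ∑ n ∈ s, primeDivisorProd a ∅ n ^ 2 ≤
      z * Real.exp (∑' p : Nat.Primes, (a p ^ 2 - 1) / ((p : ℕ) : ℝ)) := by
  have h1 := sum_prod_support_sub_one_le (fun p => by nlinarith [ha p]) hs ∅ hz h
  simp only [add_sub_cancel, Finset.sum_empty, sub_zero, Finset.sum_sub_distrib, Finset.sum_const,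
    nsmul_eq_mul, mul_one] at h1
  simp only [primeDivisorProd, ← Finset.prod_pow]
  linarith [Finset.card_pnat_le hz h]

/-- There are few large integers below a multiple of the product over their prime divisors. -/
theorem card_le_of_lt_mul_primeDivisorProd {a : Nat.Primes → ℝ} (ha : ∀ p, 1 ≤ a p)
    (hs : Summable fun p : Nat.Primes => (a p ^ 2 - 1) / ((p : ℕ) : ℝ))
    {s : Finset ℕ+} {w y : ℝ} (hy : 0 < y) (h : ∀ n ∈ s, y < n)
    (hw : ∀ n ∈ s, (n : ℝ) < w * primeDivisorProd a ∅ n) :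
    (s.card : ℝ) ≤
      4 * Real.exp (∑' p : Nat.Primes, (a p ^ 2 - 1) / ((p : ℕ) : ℝ)) * w ^ 2 / y := by
  set C := Real.exp (∑' p : Nat.Primes, (a p ^ 2 - 1) / ((p : ℕ) : ℝ)) with hC
  have hC0 : 0 < C := Real.exp_pos _
  -- Dyadic blocks: for 2^J y < n ≤ 2^(J+1) y one has 1 ≤ (w A(n)/(2^J y))², with A the product over
  -- prime divisors. The second moment bound then gives at most 2Cw²/y · 2^(-J) such n, and the
  -- blocks sum to 4Cw²/y.
  have key : ∀ J : ℕ, ((s.filter fun n : ℕ+ => (n : ℝ) ≤ 2 ^ J * y).card : ℝ) ≤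
      4 * C * w ^ 2 / y * (1 - (1 / 2) ^ J) := fun J => by
    induction J with
    | zero =>
      rw [Finset.filter_false_of_mem fun n hn => by simpa using h n hn]
      simp
    | succ J ih =>
      have hsplit : (s.filter fun n : ℕ+ => (n : ℝ) ≤ 2 ^ (J + 1) * y) ⊆
          (s.filter fun n : ℕ+ => (n : ℝ) ≤ 2 ^ J * y) ∪
          (s.filter fun n : ℕ+ => 2 ^ J * y < (n : ℝ) ∧ (n : ℝ) ≤ 2 ^ (J + 1) * y) := by
        intro n hn
        simp only [Finset.mem_filter, Finset.mem_union] at hn ⊢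
        rcases le_or_gt (n : ℝ) (2 ^ J * y) with h' | h'
        · exact Or.inl ⟨hn.1, h'⟩
        · exact Or.inr ⟨hn.1, h', hn.2⟩
      have h2J : (0 : ℝ) < 2 ^ J * y := by positivity
      have hblock : ((s.filter fun n : ℕ+ => 2 ^ J * y < (n : ℝ) ∧
          (n : ℝ) ≤ 2 ^ (J + 1) * y).card : ℝ) ≤ 2 * C * w ^ 2 / y * (1 / 2) ^ J := by
        calc _ = ∑ n ∈ s.filter fun n : ℕ+ => 2 ^ J * y < (n : ℝ) ∧ (n : ℝ) ≤ 2 ^ (J + 1) * y,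
              (1 : ℝ) := by simp
          _ ≤ ∑ n ∈ s.filter fun n : ℕ+ => 2 ^ J * y < (n : ℝ) ∧ (n : ℝ) ≤ 2 ^ (J + 1) * y,
              w ^ 2 / (2 ^ J * y) ^ 2 * primeDivisorProd a ∅ n ^ 2 := by
              refine Finset.sum_le_sum fun n hn => ?_
              obtain ⟨hn, h1, -⟩ := Finset.mem_filter.mp hn
              rw [div_mul_eq_mul_div, one_le_div (by positivity), ← mul_pow]
              exact pow_le_pow_left₀ h2J.le (h1.le.trans (hw n hn).le) 2
          _ ≤ w ^ 2 / (2 ^ J * y) ^ 2 * (2 ^ (J + 1) * y * C) := by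
              rw [← Finset.mul_sum]
              refine mul_le_mul_of_nonneg_left (sum_primeDivisorProd_sq_le ha hs (by positivity)
                fun n hn => (Finset.mem_filter.mp hn).2.2) (by positivity)
          _ = _ := by
              rw [one_div, inv_pow]
              field_simp
              ring
      calc _ ≤ (((s.filter fun n : ℕ+ => (n : ℝ) ≤ 2 ^ J * y).card +
          (s.filter fun n : ℕ+ => 2 ^ J * y < (n : ℝ) ∧ (n : ℝ) ≤ 2 ^ (J + 1) * y).card : ℕ) : ℝ) :=
            Nat.cast_le.mpr ((Finset.card_le_card hsplit).trans (Finset.card_union_le _ _))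
        _ ≤ 4 * C * w ^ 2 / y * (1 - (1 / 2) ^ J) + 2 * C * w ^ 2 / y * (1 / 2) ^ J := by
            rw [Nat.cast_add]
            exact add_le_add ih hblock
        _ = _ := by ring
  obtain ⟨J, hJ⟩ : ∃ J : ℕ, ∀ n ∈ s, (n : ℝ) ≤ 2 ^ J * y := by
    obtain ⟨J, hJ⟩ := pow_unbounded_of_one_lt ((∑ n ∈ s, (n : ℝ)) / y) (one_lt_two (α := ℝ))
    refine ⟨J, fun n hn => ?_⟩
    rw [div_lt_iff₀ hy] at hJ
    exact (Finset.single_le_sum (f := fun n : ℕ+ => (n : ℝ)) (fun n _ => Nat.cast_nonneg _)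
      hn).trans hJ.le
  have h1 := key J
  rw [Finset.filter_true_of_mem hJ] at h1
  refine h1.trans (mul_le_of_le_one_right (by positivity) ?_)
  have : (0 : ℝ) ≤ (1 / 2) ^ J := by positivity
  linarith

/-- Otherwise there would be finite subsets larger than the uniform bound just obtained. -/
theorem finite_setOf_lt_mul_primeDivisorProd {a : Nat.Primes → ℝ} (ha : ∀ p, 1 ≤ a p)
    (hs : Summable fun p : Nat.Primes => (a p ^ 2 - 1) / ((p : ℕ) : ℝ)) (w : ℝ) :
    {n : ℕ+ | (n : ℝ) < w * primeDivisorProd a ∅ n}.Finite := by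
  by_contra hinf
  set C := 4 * Real.exp (∑' p : Nat.Primes, (a p ^ 2 - 1) / ((p : ℕ) : ℝ)) * w ^ 2 / 1 with hC
  have hinf' : {n : ℕ+ | (1 : ℝ) < n ∧ (n : ℝ) < w * primeDivisorProd a ∅ n}.Infinite := fun hf =>
    hinf (((finite_setOf_pnat_lt 2).union hf).subset fun n hn => by
      rcases lt_or_ge (n : ℝ) 2 with h | h
      · exact Or.inl h
      · exact Or.inr ⟨by linarith, hn⟩)
  obtain ⟨t, hts, ht⟩ := hinf'.exists_subset_card_eq (⌊C⌋₊ + 1)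
  have h1 := card_le_of_lt_mul_primeDivisorProd ha hs (w := w) one_pos (fun n hn => (hts hn).1)
    fun n hn => (hts hn).2
  rw [ht, ← hC] at h1
  have := Nat.lt_floor_add_one C
  push_cast at h1
  linarith

/-- Integers up to y are handled by Markov's inequality and the first moment of the product outside
`S`, larger ones by the second moment; y remains free. -/
theorem ncard_primeDivisorProd_gt_le {a : Nat.Primes → ℝ} (ha : ∀ p, 1 ≤ a p)
    (hs : Summable fun p : Nat.Primes => (a p ^ 2 - 1) / ((p : ℕ) : ℝ)) (S : Finset Nat.Primes)
    {w y ε : ℝ} (hy : 0 < y) (hε : 0 < ε) :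
    ({n : ℕ+ | (n : ℝ) < w * primeDivisorProd a ∅ n ∧ 1 + ε < primeDivisorProd a S n}.ncard : ℝ) ≤
      y * ((Real.exp (∑' p : Nat.Primes, (a p - 1) / ((p : ℕ) : ℝ) -
        ∑ p ∈ S, (a p - 1) / ((p : ℕ) : ℝ)) - 1) / ε) +
      4 * Real.exp (∑' p : Nat.Primes, (a p ^ 2 - 1) / ((p : ℕ) : ℝ)) * w ^ 2 / y := by
  have hfin : {n : ℕ+ | (n : ℝ) < w * primeDivisorProd a ∅ n ∧
      1 + ε < primeDivisorProd a S n}.Finite :=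
    (finite_setOf_lt_mul_primeDivisorProd ha hs w).subset fun n hn => hn.1
  rw [Set.ncard_eq_toFinset_card _ hfin]
  set s := hfin.toFinset with hsdef
  have hmem : ∀ n ∈ s, (n : ℝ) < w * primeDivisorProd a ∅ n ∧ 1 + ε < primeDivisorProd a S n :=
    fun n hn => by simpa [hsdef] using hn
  rw [← Finset.card_filter_add_card_filter_not (fun n : ℕ+ => (n : ℝ) ≤ y), Nat.cast_add]
  refine add_le_add ?_ (card_le_of_lt_mul_primeDivisorProd ha hs hy (fun n hn => ?_) fun n hn =>
    (hmem n (Finset.mem_filter.mp hn).1).1)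
  · have h1 := sum_prod_support_sub_one_le (fun p => by linarith [ha p])
      (summable_sub_one_div ha hs) S hy.le
      (s := s.filter fun n : ℕ+ => (n : ℝ) ≤ y) fun n hn => (Finset.mem_filter.mp hn).2
    simp only [add_sub_cancel] at h1
    rw [← mul_div_assoc, le_div_iff₀ hε, ← nsmul_eq_mul, ← Finset.sum_const]
    refine (Finset.sum_le_sum fun n hn => ?_).trans h1
    have := (hmem n (Finset.mem_filter.mp hn).1).2
    rw [primeDivisorProd] at this
    linarith
  · exact not_le.mp (Finset.mem_filter.mp hn).2


/-! ### Passing from finitely many primes to all primes -/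

/-- Weights which differ little from `1` at the large primes. -/
structure IsTameWeight (b : Nat.Primes → ℕ → ℝ) (a : Nat.Primes → ℝ) : Prop where
  pos : ∀ p k, 0 < b p k
  one_le_zero : ∀ p, 1 ≤ b p 0
  summable_zero : Summable fun p => b p 0 - 1
  one_le : ∀ p, 1 ≤ a p
  le : ∀ p k, b p (k + 1) ≤ a p
  ge : ∀ p k, (a p)⁻¹ ≤ b p (k + 1)
  summable : Summable fun p : Nat.Primes => (a p ^ 2 - 1) / ((p : ℕ) : ℝ)

namespace IsTameWeight

variable {b : Nat.Primes → ℕ → ℝ} {a : Nat.Primes → ℝ}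

theorem primeDivisorProd_eq_prod_ite (S T : Finset Nat.Primes) (c : Nat.Primes → ℝ) (n : ℕ+) :
    ∏ p ∈ T \ S, (if p ∈ (primeExp n).support then c p else 1) =
      ∏ p ∈ (T \ S) ∩ (primeExp n).support, c p := Finset.prod_ite_mem _ _ _

theorem inter_subset (S T : Finset Nat.Primes) (n : ℕ+) :
    (T \ S) ∩ (primeExp n).support ⊆ (primeExp n).support \ S := fun p hp => by
  simp only [Finset.mem_inter, Finset.mem_sdiff] at hp ⊢
  exact ⟨hp.2, hp.1.2⟩

/-- A prime dividing n contributes at most a_p. The others contribute b_p(0), and their product is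
at most the exponential of the tail of ∑(b_p(0) - 1). -/
theorem prod_sdiff_le (h : IsTameWeight b a) (S T : Finset Nat.Primes) (n : ℕ+) :
    ∏ p ∈ T \ S, b p (primeExp n p) ≤ primeDivisorProd a S n *
      Real.exp (∑' p, (b p 0 - 1) - ∑ p ∈ S, (b p 0 - 1)) := by
  have ha0 : ∀ p, 0 < a p := fun p => one_pos.trans_le (h.one_le p)
  calc ∏ p ∈ T \ S, b p (primeExp n p)
      ≤ ∏ p ∈ T \ S, (if p ∈ (primeExp n).support then a p else 1) * b p 0 := by
        refine Finset.prod_le_prod (fun p _ => (h.pos p _).le) fun p _ => ?_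
        by_cases hp : primeExp n p = 0
        · simp [hp]
        · obtain ⟨k, hk⟩ := Nat.exists_eq_succ_of_ne_zero hp
          rw [if_pos (Finsupp.mem_support_iff.mpr hp), hk]
          exact (h.le p k).trans (le_mul_of_one_le_right (ha0 p).le (h.one_le_zero p))
    _ = (∏ p ∈ (T \ S) ∩ (primeExp n).support, a p) * ∏ p ∈ T \ S, b p 0 := by
        rw [Finset.prod_mul_distrib, primeDivisorProd_eq_prod_ite]
    _ ≤ _ := by
        refine mul_le_mul ?_ ?_ (Finset.prod_nonneg fun p _ => (h.pos p _).le)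
          (zero_le_one.trans (one_le_primeDivisorProd h.one_le S n))
        · exact Finset.prod_le_prod_of_subset_of_one_le (inter_subset S T n)
            (fun p _ => (ha0 p).le) fun p _ _ => h.one_le p
        · refine (Real.prod_le_exp_sum (T \ S) (y := fun p => b p 0 - 1)
            (fun p _ => (h.pos p 0).le) fun p _ => by linarith).trans ?_
          gcongr
          rw [le_sub_iff_add_le, ← Finset.sum_union Finset.sdiff_disjoint]
          exact h.summable_zero.sum_le_tsum _ fun p _ => by linarith [h.one_le_zero p]

theorem le_prod_sdiff (h : IsTameWeight b a) (S T : Finset Nat.Primes) (n : ℕ+) :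
    (primeDivisorProd a S n)⁻¹ ≤ ∏ p ∈ T \ S, b p (primeExp n p) := by
  have ha0 : ∀ p, 0 < a p := fun p => one_pos.trans_le (h.one_le p)
  calc (primeDivisorProd a S n)⁻¹ ≤ (∏ p ∈ (T \ S) ∩ (primeExp n).support, a p)⁻¹ :=
        inv_anti₀ (Finset.prod_pos fun p _ => ha0 p)
          (Finset.prod_le_prod_of_subset_of_one_le (inter_subset S T n)
            (fun p _ => (ha0 p).le) fun p _ _ => h.one_le p)
    _ = ∏ p ∈ T \ S, (if p ∈ (primeExp n).support then (a p)⁻¹ else 1) := by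
        rw [primeDivisorProd_eq_prod_ite, Finset.prod_inv_distrib]
    _ ≤ _ := by
        refine Finset.prod_le_prod (fun p _ => ?_) fun p _ => ?_
        · split_ifs
          · exact (inv_pos.mpr (ha0 p)).le
          · exact zero_le_one
        · by_cases hp : primeExp n p = 0
          · simp [hp, h.one_le_zero p]
          · obtain ⟨k, hk⟩ := Nat.exists_eq_succ_of_ne_zero hp
            rw [if_pos (Finsupp.mem_support_iff.mpr hp), hk]
            exact h.ge p k

theorem localWeight_le_mul (h : IsTameWeight b a) (S : Finset Nat.Primes) (n : ℕ+) :
    localWeight b S n ≤ primeDivisorProd a ∅ n * Real.exp (∑' p, (b p 0 - 1)) := by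
  simpa [localWeight] using h.prod_sdiff_le ∅ S n

variable {B : ℕ+ → ℝ}

theorem weight_le_localWeight_mul (h : IsTameWeight b a)
    (hB : ∀ n, HasProd (fun p => b p (primeExp n p)) (B n)) (S : Finset Nat.Primes) (n : ℕ+) :
    B n ≤ localWeight b S n * (primeDivisorProd a S n *
      Real.exp (∑' p, (b p 0 - 1) - ∑ p ∈ S, (b p 0 - 1))) := by
  refine le_of_tendsto (hB n) ?_
  filter_upwards [eventually_ge_atTop S] with T hT
  rw [← Finset.prod_sdiff hT, mul_comm, ← localWeight]
  exact mul_le_mul_of_nonneg_left (h.prod_sdiff_le S T n) (localWeight_nonneg h.pos S n).le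

theorem localWeight_le_weight_mul (h : IsTameWeight b a)
    (hB : ∀ n, HasProd (fun p => b p (primeExp n p)) (B n)) (S : Finset Nat.Primes) (n : ℕ+) :
    localWeight b S n ≤ B n * primeDivisorProd a S n := by
  have hA := one_pos.trans_le (one_le_primeDivisorProd h.one_le S n)
  rw [← div_le_iff₀ hA, div_eq_mul_inv]
  refine ge_of_tendsto (hB n) ?_
  filter_upwards [eventually_ge_atTop S] with T hT
  rw [← Finset.prod_sdiff hT, mul_comm, ← localWeight]
  exact mul_le_mul_of_nonneg_right (h.le_prod_sdiff S T n) (localWeight_nonneg h.pos S n).le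

theorem weight_le_mul (h : IsTameWeight b a)
    (hB : ∀ n, HasProd (fun p => b p (primeExp n p)) (B n)) (n : ℕ+) :
    B n ≤ primeDivisorProd a ∅ n * Real.exp (∑' p, (b p 0 - 1)) := by
  simpa [localWeight] using h.weight_le_localWeight_mul hB ∅ n

theorem weight_pos (h : IsTameWeight b a)
    (hB : ∀ n, HasProd (fun p => b p (primeExp n p)) (B n)) (n : ℕ+) : 0 < B n :=
  pos_of_mul_pos_left ((localWeight_nonneg h.pos ∅ n).trans_le (h.localWeight_le_weight_mul hB ∅ n))
    (zero_le_one.trans (one_le_primeDivisorProd h.one_le ∅ n))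

theorem finite_setOf_lt_mul (h : IsTameWeight b a)
    (hB : ∀ n, HasProd (fun p => b p (primeExp n p)) (B n)) {x : ℝ} (hx : 0 ≤ x) :
    {n : ℕ+ | (n : ℝ) < x * B n}.Finite :=
  (finite_setOf_lt_mul_primeDivisorProd h.one_le h.summable
    (x * Real.exp (∑' p, (b p 0 - 1)))).subset fun n hn => lt_of_lt_of_le (a := (n : ℝ)) hn
      ((mul_le_mul_of_nonneg_left (h.weight_le_mul hB n) hx).trans_eq (by ring))

theorem finite_weightedBelow (h : IsTameWeight b a) (S : Finset Nat.Primes) {x : ℝ} (hx : 0 ≤ x) :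
    (weightedBelow b S x).Finite :=
  (finite_setOf_lt_mul_primeDivisorProd h.one_le h.summable
    (x * Real.exp (∑' p, (b p 0 - 1)))).subset fun n hn => lt_of_lt_of_le (a := (n : ℝ)) hn
      ((mul_le_mul_of_nonneg_left (h.localWeight_le_mul S n) hx).trans_eq (by ring))

/-- The error made by dropping the primes outside `S`. -/
noncomputable def cutoffError (b : Nat.Primes → ℕ → ℝ) (a : Nat.Primes → ℝ) (S : Finset Nat.Primes)
    (ε : ℝ) : ℝ :=
  ε⁻¹ * ((Real.exp (∑' p : Nat.Primes, (a p - 1) / ((p : ℕ) : ℝ) -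
    ∑ p ∈ S, (a p - 1) / ((p : ℕ) : ℝ)) - 1) / ε) +
  4 * Real.exp (∑' p : Nat.Primes, (a p ^ 2 - 1) / ((p : ℕ) : ℝ)) *
    Real.exp (∑' p, (b p 0 - 1)) ^ 2 * ε

/-- For fixed ε the first moment term vanishes as `S` exhausts the primes, leaving the O(ε) caused
by the integers beyond x/ε. -/
theorem tendsto_cutoffError (h : IsTameWeight b a) (ε : ℝ) :
    Tendsto (fun S => cutoffError b a S ε) atTop
      (𝓝 (4 * Real.exp (∑' p : Nat.Primes, (a p ^ 2 - 1) / ((p : ℕ) : ℝ)) *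
        Real.exp (∑' p, (b p 0 - 1)) ^ 2 * ε)) := by
  have h1 : Tendsto (fun S : Finset Nat.Primes => ∑ p ∈ S, (a p - 1) / ((p : ℕ) : ℝ)) atTop
      (𝓝 (∑' p : Nat.Primes, (a p - 1) / ((p : ℕ) : ℝ))) :=
    (summable_sub_one_div h.one_le h.summable).hasSum
  have h2 := (Real.continuous_exp.tendsto _).comp
    (h1.const_sub (∑' p : Nat.Primes, (a p - 1) / ((p : ℕ) : ℝ)))
  rw [sub_self, Real.exp_zero] at h2
  have h3 := (((h2.sub_const 1).div_const ε).const_mul ε⁻¹).add_const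
    (4 * Real.exp (∑' p : Nat.Primes, (a p ^ 2 - 1) / ((p : ℕ) : ℝ)) *
        Real.exp (∑' p, (b p 0 - 1)) ^ 2 * ε)
  simpa [cutoffError] using h3

/-- The exceptional integers. -/
theorem ncard_exceptional_le (h : IsTameWeight b a) (S : Finset Nat.Primes) {x ε : ℝ} (hx : 0 < x)
    (hε : 0 < ε) :
    ({n : ℕ+ | (n : ℝ) < (x * Real.exp (∑' p, (b p 0 - 1))) * primeDivisorProd a ∅ n ∧
      1 + ε < primeDivisorProd a S n}.ncard : ℝ) / x ≤ cutoffError b a S ε := by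
  rw [div_le_iff₀ hx]
  refine (ncard_primeDivisorProd_gt_le h.one_le h.summable S (y := ε⁻¹ * x) (by positivity)
    hε).trans_eq ?_
  rw [cutoffError]
  field_simp

/-- Outside the exceptional set the primes not in `S` multiply the weight by at most (1 + ε) times
an exponential close to 1, which is absorbed into x. -/
theorem ncard_le (h : IsTameWeight b a)
    (hB : ∀ n, HasProd (fun p => b p (primeExp n p)) (B n)) (S : Finset Nat.Primes)
    {x ε : ℝ} (hx : 0 < x) (hε : 0 < ε) :
    ({n : ℕ+ | (n : ℝ) < x * B n}.ncard : ℝ) / x ≤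
      ((weightedBelow b S ((1 + ε) *
        Real.exp (∑' p, (b p 0 - 1) - ∑ p ∈ S, (b p 0 - 1)) * x)).ncard : ℝ) / x +
      cutoffError b a S ε := by
  refine le_trans ?_ (add_le_add_right (h.ncard_exceptional_le S hx hε) _)
  rw [← add_div, ← Nat.cast_add]
  gcongr
  refine (Set.ncard_le_ncard ?_ ?_).trans (Set.ncard_union_le _ _)
  · intro n hn
    simp only [Set.mem_ofPred_eq] at hn
    by_cases hA : primeDivisorProd a S n ≤ 1 + ε
    · left
      refine hn.trans_le ((mul_le_mul_of_nonneg_left (h.weight_le_localWeight_mul hB S n)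
        hx.le).trans ?_)
      have h1 := localWeight_nonneg h.pos S n
      calc _ ≤ x * (localWeight b S n * ((1 + ε) *
            Real.exp (∑' p, (b p 0 - 1) - ∑ p ∈ S, (b p 0 - 1)))) := by gcongr
        _ = _ := by ring
    · right
      refine ⟨hn.trans_le ((mul_le_mul_of_nonneg_left (h.weight_le_mul hB n) hx.le).trans_eq ?_),
        not_le.mp hA⟩
      ring
  · exact (h.finite_weightedBelow S (by positivity)).union
      ((finite_setOf_lt_mul_primeDivisorProd h.one_le h.summable _).subset fun n hn => hn.1)

theorem le_ncard (h : IsTameWeight b a)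
    (hB : ∀ n, HasProd (fun p => b p (primeExp n p)) (B n)) (S : Finset Nat.Primes)
    {x ε : ℝ} (hx : 0 < x) (hε : 0 < ε) :
    ((weightedBelow b S ((1 + ε)⁻¹ * x)).ncard : ℝ) / x ≤
      ({n : ℕ+ | (n : ℝ) < x * B n}.ncard : ℝ) / x + cutoffError b a S ε := by
  refine le_trans ?_ (add_le_add_right (h.ncard_exceptional_le S hx hε) _)
  rw [← add_div, ← Nat.cast_add]
  gcongr
  refine (Set.ncard_le_ncard ?_ ?_).trans (Set.ncard_union_le _ _)
  · intro n hn
    simp only [weightedBelow, Set.mem_ofPred_eq] at hn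
    by_cases hA : primeDivisorProd a S n ≤ 1 + ε
    · left
      refine hn.trans_le ((mul_le_mul_of_nonneg_left (h.localWeight_le_weight_mul hB S n)
        (by positivity)).trans ?_)
      have h1 := h.weight_pos hB n
      calc _ ≤ (1 + ε)⁻¹ * x * (B n * (1 + ε)) := by gcongr
        _ = _ := by field_simp
    · right
      refine ⟨hn.trans_le ?_, not_le.mp hA⟩
      have h1 := localWeight_nonneg h.pos S n
      calc _ ≤ 1 * x * localWeight b S n := by
            gcongr
            exact inv_le_one_of_one_le₀ (by linarith)
        _ ≤ x * (primeDivisorProd a ∅ n * Real.exp (∑' p, (b p 0 - 1))) := by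
            rw [one_mul]
            gcongr
            exact h.localWeight_le_mul S n
        _ = _ := by ring
  · exact (h.finite_setOf_lt_mul hB hx.le).union
      ((finite_setOf_lt_mul_primeDivisorProd h.one_le h.summable _).subset fun n hn => hn.1)

theorem tendsto_ncard_weightedBelow_mul (h : IsTameWeight b a) (S : Finset Nat.Primes) {c : ℝ}
    (hc : 0 < c) :
    Tendsto (fun x : ℝ => ((weightedBelow b S (c * x)).ncard : ℝ) / x) atTop
      (𝓝 (c * ∏ p ∈ S, (1 - 1 / ((p : ℕ) : ℝ)) * ∑' k, b p k / ((p : ℕ) : ℝ) ^ k)) := by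
  have h1 : ∀ p k, b p k ≤ max (a p) (b p 0) := fun p k => by
    cases k with
    | zero => exact le_max_right _ _
    | succ k => exact (h.le p k).trans (le_max_left _ _)
  have h2 := ((tendsto_ncard_weightedBelow h.pos h1 S).comp
    (tendsto_id.const_mul_atTop hc)).const_mul c
  refine h2.congr' ?_
  filter_upwards [eventually_gt_atTop 0] with x hx
  simp only [Function.comp, id]
  field_simp

/-- The density of the integers below a tame weight. -/
theorem tendsto_ncard (h : IsTameWeight b a)
    (hB : ∀ n, HasProd (fun p => b p (primeExp n p)) (B n)) {g : ℝ}
    (hg : HasProd (fun p : Nat.Primes =>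
      (1 - 1 / ((p : ℕ) : ℝ)) * ∑' k, b p k / ((p : ℕ) : ℝ) ^ k) g) :
    Tendsto (fun x : ℝ => ({n : ℕ+ | (n : ℝ) < x * B n}.ncard : ℝ) / x) atTop (𝓝 g) := by
  have hg' : Tendsto (fun S : Finset Nat.Primes => ∏ p ∈ S,
      (1 - 1 / ((p : ℕ) : ℝ)) * ∑' k, b p k / ((p : ℕ) : ℝ) ^ k) atTop (𝓝 g) := hg
  set D := 4 * Real.exp (∑' p : Nat.Primes, (a p ^ 2 - 1) / ((p : ℕ) : ℝ)) *
        Real.exp (∑' p, (b p 0 - 1)) ^ 2 with hD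
  have hε : Tendsto (fun ε : ℝ => ε) (𝓝[>] 0) (𝓝 0) := tendsto_nhdsWithin_of_tendsto_nhds tendsto_id
  rw [tendsto_order]
  constructor
  · intro c hc
    have h1 : Tendsto (fun ε : ℝ => (1 + ε)⁻¹ * g - D * ε) (𝓝[>] 0) (𝓝 g) := by
      have := (((hε.const_add 1).inv₀ (by norm_num)).mul_const g).sub (hε.const_mul D)
      simpa using this
    -- The order of choices matters: first ε, then `S` depending on ε, and only then x large.
    obtain ⟨ε, hcε, hε0⟩ := ((h1.eventually (lt_mem_nhds hc)).and self_mem_nhdsWithin).exists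
    have hε0 : 0 < ε := hε0
    have h2 := (hg'.const_mul (1 + ε)⁻¹).sub (h.tendsto_cutoffError ε)
    obtain ⟨S, hS⟩ := (h2.eventually (lt_mem_nhds hcε)).exists
    have h3 := (h.tendsto_ncard_weightedBelow_mul S (c := (1 + ε)⁻¹) (by positivity)).sub_const
      (cutoffError b a S ε)
    filter_upwards [h3.eventually (lt_mem_nhds hS), eventually_gt_atTop 0] with x hx hx0
    linarith [h.le_ncard hB S hx0 hε0]
  · intro c hc
    have h1 : Tendsto (fun ε : ℝ => (1 + ε) * g + D * ε) (𝓝[>] 0) (𝓝 g) := by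
      have := ((hε.const_add 1).mul_const g).add (hε.const_mul D)
      simpa using this
    obtain ⟨ε, hcε, hε0⟩ := ((h1.eventually (gt_mem_nhds hc)).and self_mem_nhdsWithin).exists
    have hε0 : 0 < ε := hε0
    have hK : Tendsto (fun S : Finset Nat.Primes => (1 + ε) *
        Real.exp (∑' p, (b p 0 - 1) - ∑ p ∈ S, (b p 0 - 1))) atTop (𝓝 (1 + ε)) := by
      have h4 : Tendsto (fun S : Finset Nat.Primes => ∑ p ∈ S, (b p 0 - 1)) atTop
        (𝓝 (∑' p, (b p 0 - 1))) := h.summable_zero.hasSum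
      have := ((Real.continuous_exp.tendsto _).comp
        (h4.const_sub (∑' p, (b p 0 - 1)))).const_mul (1 + ε)
      simpa using this
    have h2 := (hK.mul hg').add (h.tendsto_cutoffError ε)
    obtain ⟨S, hS⟩ := (h2.eventually (gt_mem_nhds hcε)).exists
    have h3 := (h.tendsto_ncard_weightedBelow_mul S (c := (1 + ε) *
        Real.exp (∑' p, (b p 0 - 1) - ∑ p ∈ S, (b p 0 - 1))) (by positivity)).add_const
      (cutoffError b a S ε)
    filter_upwards [h3.eventually (gt_mem_nhds hS), eventually_gt_atTop 0] with x hx hx0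
    linarith [h.ncard_le hB S hx0 hε0]

end IsTameWeight


/-! ### From the counting function to the ordered sequence -/

/-- A non-increasing sequence is asymptotically the inverse of its counting function. -/
theorem tendsto_mul_of_tendsto_ncard_div {μ : ℕ → ℝ} (hanti : Antitone μ) (hpos : ∀ k, 0 < μ k)
    (hlim : Tendsto μ atTop (𝓝 0)) {g : ℝ}
    (hN : Tendsto (fun x : ℝ => ({k | 1 < x * μ k}.ncard : ℝ) / x) atTop (𝓝 g)) :
    Tendsto (fun k : ℕ => μ k * (k + 1)) atTop (𝓝 g) := by
  have hfin : ∀ x : ℝ, 0 < x → {k | 1 < x * μ k}.Finite := fun x hx => by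
    have h1 : ∀ᶠ k in cofinite, μ k < x⁻¹ := by
      rw [Nat.cofinite_eq_atTop]
      exact hlim.eventually (gt_mem_nhds (by positivity))
    refine (eventually_cofinite.mp h1).subset fun k hk => ?_
    simp only [Set.mem_ofPred_eq, not_lt] at hk ⊢
    rw [inv_le_iff_one_le_mul₀ hx, mul_comm]
    exact hk.le
  have hinv : Tendsto (fun k => (μ k)⁻¹) atTop atTop :=
    (tendsto_nhdsWithin_iff.mpr ⟨hlim, Eventually.of_forall hpos⟩).inv_tendsto_nhdsGT_zero
  -- The strict inequality μ_j > μ_k allows only j < k.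
  have hle : ∀ k : ℕ, ({j | 1 < (μ k)⁻¹ * μ j}.ncard : ℝ) ≤ k + 1 := fun k => by
    have hsub : {j | 1 < (μ k)⁻¹ * μ j} ⊆ Set.Iio k := fun j hj => by
      by_contra hjk
      have h1 := hanti (not_lt.mp hjk)
      simp only [Set.mem_ofPred_eq] at hj
      rw [inv_mul_eq_div, one_lt_div (hpos k)] at hj
      linarith
    have h2 := Set.ncard_le_ncard hsub (Set.finite_Iio k)
    rw [← Finset.coe_Iio, Set.ncard_coe_finset, Nat.card_Iio] at h2
    have : (({j | 1 < (μ k)⁻¹ * μ j}.ncard : ℕ) : ℝ) ≤ k := by exact_mod_cast h2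
    linarith
  -- The slack 1 + ε is needed for the indices j ≤ k with μ_j = μ_k to be counted.
  have hge : ∀ ε : ℝ, 0 < ε → ∀ k : ℕ,
      (k : ℝ) + 1 ≤ ({j | 1 < ((1 + ε) * (μ k)⁻¹) * μ j}.ncard : ℝ) := fun ε hε k => by
    have hk := hpos k
    have hsub : Set.Iic k ⊆ {j | 1 < ((1 + ε) * (μ k)⁻¹) * μ j} := fun j hj => by
      have h1 := hanti (Set.mem_Iic.mp hj)
      simp only [Set.mem_ofPred_eq]
      rw [mul_assoc, inv_mul_eq_div]
      have h2 : 1 ≤ μ j / μ k := (one_le_div hk).mpr h1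
      nlinarith
    have h2 := Set.ncard_le_ncard hsub (hfin _ (by positivity))
    rw [← Finset.coe_Iic, Set.ncard_coe_finset, Nat.card_Iic] at h2
    exact_mod_cast h2
  have hlower : Tendsto (fun k => ({j | 1 < (μ k)⁻¹ * μ j}.ncard : ℝ) / (μ k)⁻¹) atTop (𝓝 g) :=
    hN.comp hinv
  have hupper : ∀ ε : ℝ, 0 < ε →
      Tendsto (fun k => ({j | 1 < ((1 + ε) * (μ k)⁻¹) * μ j}.ncard : ℝ) / (μ k)⁻¹) atTop
        (𝓝 ((1 + ε) * g)) := fun ε hε => by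
    refine ((hN.comp (hinv.const_mul_atTop (r := 1 + ε) (by positivity))).const_mul
      (1 + ε)).congr fun k => ?_
    have := hpos k
    simp only [Function.comp]
    field_simp
  rw [tendsto_order]
  constructor
  · intro c hc
    filter_upwards [hlower.eventually (lt_mem_nhds hc)] with k hk
    rw [div_inv_eq_mul, mul_comm] at hk
    exact hk.trans_le (mul_le_mul_of_nonneg_left (hle k) (hpos k).le)
  · intro c hc
    have h1 : Tendsto (fun ε : ℝ => (1 + ε) * g) (𝓝[>] 0) (𝓝 g) := by
      have hε : Tendsto (fun ε : ℝ => ε) (𝓝[>] 0) (𝓝 0) :=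
        tendsto_nhdsWithin_of_tendsto_nhds tendsto_id
      simpa using (hε.const_add 1).mul_const g
    obtain ⟨ε, hcε, hε0⟩ := ((h1.eventually (gt_mem_nhds hc)).and self_mem_nhdsWithin).exists
    filter_upwards [(hupper ε hε0).eventually (gt_mem_nhds hcε)] with k hk
    rw [div_inv_eq_mul, mul_comm] at hk
    exact (mul_le_mul_of_nonneg_left (hge ε hε0 k) (hpos k).le).trans_lt hk

/-- Listing the values `B n / n` in non-increasing order. -/
theorem IsTameWeight.exists_equiv_nat {b : Nat.Primes → ℕ → ℝ} {a : Nat.Primes → ℝ}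
    (h : IsTameWeight b a) {B : ℕ+ → ℝ}
    (hB : ∀ n, HasProd (fun p => b p (primeExp n p)) (B n)) {g : ℝ}
    (hg : HasProd (fun p : Nat.Primes =>
      (1 - 1 / ((p : ℕ) : ℝ)) * ∑' k, b p k / ((p : ℕ) : ℝ) ^ k) g) :
    ∃ e : ℕ ≃ ℕ+, Antitone (fun k => B (e k) / (e k : ℝ)) ∧
      Tendsto (fun k => B (e k) / (e k : ℝ)) atTop (𝓝 0) ∧
      Tendsto (fun k : ℕ => B (e k) / (e k : ℝ) * (k + 1)) atTop (𝓝 g) := by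
  have hn : ∀ n : ℕ+, (0 : ℝ) < n := fun n => by exact_mod_cast n.pos
  have hpos : ∀ n : ℕ+, 0 < B n / n := fun n => div_pos (h.weight_pos hB n) (hn n)
  have hfin : ∀ ε > 0, {n : ℕ+ | ε ≤ B n / n}.Finite := fun ε hε => by
    -- The factor 2 turns the weak inequality ε ≤ B(n)/n into a strict one.
    refine (h.finite_setOf_lt_mul hB (x := 2 / ε) (by positivity)).subset fun n hn' => ?_
    simp only [Set.mem_ofPred_eq] at hn' ⊢
    rw [le_div_iff₀ (hn n)] at hn'
    rw [div_mul_eq_mul_div, lt_div_iff₀ hε]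
    linarith [h.weight_pos hB n]
  obtain ⟨e, he⟩ := exists_equiv_nat_antitone (fun n : ℕ+ => B n / n) hpos hfin
  have hlim : Tendsto (fun k => B (e k) / (e k : ℝ)) atTop (𝓝 0) := by
    rw [tendsto_order]
    refine ⟨fun c hc => Eventually.of_forall fun k => hc.trans (hpos (e k)), fun c hc => ?_⟩
    rw [← Nat.cofinite_eq_atTop, eventually_cofinite]
    simp only [not_lt]
    have h1 : (e ⁻¹' {n : ℕ+ | c ≤ B n / n}).Finite := (hfin c hc).preimage e.injective.injOn
    exact h1
  refine ⟨e, he, hlim, tendsto_mul_of_tendsto_ncard_div he (fun k => hpos (e k)) hlim ?_⟩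
  refine (h.tendsto_ncard hB hg).congr fun x => ?_
  rw [← Set.ncard_preimage_of_injective_subset_range e.injective
    (by rw [e.surjective.range_eq]; exact Set.subset_univ _)]
  congr 3
  ext k
  simp only [Set.mem_preimage, Set.mem_ofPred_eq]
  rw [Function.comp_apply, ← mul_div_assoc, one_lt_div (hn _)]


/-! ### The local eigenvalues give a tame weight -/

theorem Real.exp_sub_one_le_mul_exp (t : ℝ) : Real.exp t - 1 ≤ t * Real.exp t := by
  have h1 := Real.add_one_le_exp (-t)
  have h2 := Real.exp_pos t
  have h3 : Real.exp (-t) * Real.exp t = 1 := by rw [← Real.exp_add, neg_add_cancel, Real.exp_zero]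
  nlinarith

theorem inv_one_sub_sq_le_exp {q q₀ : ℝ} (hq : 0 ≤ q) (hq0 : q ≤ q₀) (h : q₀ < 1) :
    (1 - q)⁻¹ ^ 2 ≤ Real.exp (2 / (1 - q₀) * q) := by
  have h1 : 0 < 1 - q := by linarith
  have h2 : 0 < 1 - q₀ := by linarith
  have h3 : (1 - q)⁻¹ ≤ Real.exp (q / (1 - q₀)) := by
    calc (1 - q)⁻¹ = q / (1 - q) + 1 := by field_simp; ring
      _ ≤ q / (1 - q₀) + 1 := by gcongr
      _ ≤ _ := Real.add_one_le_exp _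
  calc (1 - q)⁻¹ ^ 2 ≤ Real.exp (q / (1 - q₀)) ^ 2 := by gcongr
    _ = _ := by
      rw [← Real.exp_nat_mul]
      congr 1
      push_cast
      ring

theorem Summable.rpow_sub_one {α : Type*} {x : α → ℝ} (hx : ∀ p, 1 ≤ x p)
    (h : Summable fun p => x p - 1) {s : ℝ} (hs : 0 < s) : Summable fun p => x p ^ s - 1 := by
  set Z := ∑' p, (x p - 1) with hZ
  refine (h.mul_left (s * Real.exp (s * Z))).of_nonneg_of_le
    (fun p => sub_nonneg.mpr (Real.one_le_rpow (hx p) hs.le)) fun p => ?_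
  have h0 : 0 ≤ x p - 1 := by linarith [hx p]
  have h1 : x p ^ s ≤ Real.exp (s * (x p - 1)) := by
    calc x p ^ s ≤ Real.exp (x p - 1) ^ s :=
          Real.rpow_le_rpow (by linarith [hx p]) (by linarith [Real.add_one_le_exp (x p - 1)]) hs.le
      _ = _ := by rw [← Real.exp_mul, mul_comm]
  have h2 : x p - 1 ≤ Z := h.le_tsum p fun q _ => by linarith [hx q]
  have h3 := Real.exp_sub_one_le_mul_exp (s * (x p - 1))
  calc x p ^ s - 1 ≤ s * (x p - 1) * Real.exp (s * (x p - 1)) := by linarith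
    _ ≤ s * (x p - 1) * Real.exp (s * Z) := by gcongr
    _ = _ := by ring

namespace IsPrimeSpectralData

variable {σ τ : ℝ} {lam : Nat.Primes → ℕ → ℝ} {V : Nat.Primes → ℕ → ℕ → ℂ}

theorem hasEigenvalueSequence (h : IsPrimeSpectralData σ τ lam V) (p : Nat.Primes) :
    HasEigenvalueSequence (localMatrix σ τ p) (lam p) := by
  rw [localMatrix_eq σ τ p.2.pos]
  exact (h p).diagonalizes.hasEigenvalueSequence (h p).antitone (h p).pos (h p).tendsto

/-- The two-sided bounds on λ_k(E_p) p^(ρk), raised to the power 1/ρ, lie between a_p^(-1) and a_p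
with log a_p a constant multiple of p^(-τ/2). Hence (a_p² - 1)/p = O(p^(-1-τ/2)), which is summable
because τ > 0. -/
theorem isTameWeight (h : IsPrimeSpectralData σ τ lam V) (hρ : 0 < τ - 2 * σ)
    (hτρ : 1 < τ + (τ - 2 * σ)) (hτ : 0 < τ) :
    IsTameWeight (fun p k => ((p : ℕ) : ℝ) ^ k * lam p k ^ (1 / (τ - 2 * σ)))
      (fun p => Real.exp (1 / (τ - 2 * σ) * (2 / (1 - (2 : ℝ) ^ (-τ / 2))) *
        ((p : ℕ) : ℝ) ^ (-τ / 2))) := by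
  set s := 1 / (τ - 2 * σ) with hs
  have hs0 : 0 < s := by positivity
  set q₀ := (2 : ℝ) ^ (-τ / 2) with hq₀
  have hq₀1 : q₀ < 1 := Real.rpow_lt_one_of_one_lt_of_neg (by norm_num) (by linarith)
  set c := 2 / (1 - q₀) with hc
  have hc0 : 0 < c := div_pos two_pos (by linarith)
  have hp0 : ∀ p : Nat.Primes, (0 : ℝ) < ((p : ℕ) : ℝ) := fun p => by exact_mod_cast p.2.pos
  have hq0 : ∀ p : Nat.Primes, 0 < ((p : ℕ) : ℝ) ^ (-τ / 2) := fun p => prime_rpow_pos p _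
  have hq1 : ∀ p : Nat.Primes, ((p : ℕ) : ℝ) ^ (-τ / 2) ≤ q₀ := fun p =>
    prime_rpow_le_two_rpow p (by linarith)
  have hexp : ∀ p : Nat.Primes, (1 - ((p : ℕ) : ℝ) ^ (-τ / 2))⁻¹ ^ 2 ≤
      Real.exp (c * ((p : ℕ) : ℝ) ^ (-τ / 2)) := fun p =>
    inv_one_sub_sq_le_exp (hq0 p).le (hq1 p) hq₀1
  have hr : ∀ (p : Nat.Primes) (k : ℕ),
      ((((p : ℕ) : ℝ) ^ (-(τ - 2 * σ) / 2)) ^ (2 * k)) ^ s = (((p : ℕ) : ℝ) ^ k)⁻¹ := fun p k => by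
    rw [← Real.rpow_natCast, ← Real.rpow_mul (hp0 p).le, ← Real.rpow_mul (hp0 p).le,
      ← Real.rpow_natCast, ← Real.rpow_neg (hp0 p).le]
    congr 1
    rw [hs]
    push_cast
    field_simp
  have ha : ∀ p : Nat.Primes, Real.exp (s * c * ((p : ℕ) : ℝ) ^ (-τ / 2)) =
      Real.exp (c * ((p : ℕ) : ℝ) ^ (-τ / 2)) ^ s := fun p => by
    rw [← Real.exp_mul]
    congr 1
    ring
  have hupper : ∀ (p : Nat.Primes) (k : ℕ), ((p : ℕ) : ℝ) ^ k * lam p k ^ s ≤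
      Real.exp (s * c * ((p : ℕ) : ℝ) ^ (-τ / 2)) := fun p k => by
    have hpk := pow_pos (hp0 p) k
    have h1 := Real.rpow_le_rpow ((h p).pos k).le ((h p).upper k) hs0.le
    rw [Real.mul_rpow (by positivity) (by positivity), hr] at h1
    rw [ha, mul_comm, ← le_div_iff₀ hpk, div_eq_mul_inv]
    refine h1.trans ?_
    gcongr
    exact hexp p
  have hlower : ∀ (p : Nat.Primes) (k : ℕ), (Real.exp (s * c * ((p : ℕ) : ℝ) ^ (-τ / 2)))⁻¹ ≤
      ((p : ℕ) : ℝ) ^ k * lam p k ^ s := fun p k => by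
    have hpk := pow_pos (hp0 p) k
    have h1q : 0 < 1 - ((p : ℕ) : ℝ) ^ (-τ / 2) := by linarith [hq1 p]
    have h2q : 0 < 1 + ((p : ℕ) : ℝ) ^ (-τ / 2) := by linarith [hq0 p]
    have h1 := Real.rpow_le_rpow (by positivity) ((h p).lower k) hs0.le
    rw [Real.mul_rpow (by positivity) (by positivity), hr] at h1
    rw [ha, mul_comm (((p : ℕ) : ℝ) ^ k), ← div_le_iff₀ hpk, div_eq_mul_inv, ← Real.inv_rpow (Real.exp_pos _).le]
    refine le_trans ?_ h1
    gcongr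
    -- The upper constant serves from below as well: (1-q)² ≤ (1-q)/(1+q), since (1-q)(1+q) ≤ 1.
    refine (inv_anti₀ (by positivity) (hexp p)).trans ?_
    rw [inv_pow, inv_inv, le_div_iff₀ h2q]
    nlinarith [hq0 p, sq_nonneg (((p : ℕ) : ℝ) ^ (-τ / 2))]
  refine ⟨fun p k => mul_pos (pow_pos (hp0 p) k) (Real.rpow_pos_of_pos ((h p).pos k) _),
    fun p => ?_, ?_, fun p => Real.one_le_exp (by have := hq0 p; positivity),
    fun p k => hupper p _, fun p k => hlower p _, ?_⟩
  · rw [pow_zero, one_mul]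
    exact Real.one_le_rpow (h p).one_le hs0.le
  · simp only [pow_zero, one_mul]
    exact (h.summable hρ hτρ hτ).2.rpow_sub_one (fun p => (h p).one_le) hs0
  · have h1 : Summable fun p : Nat.Primes => ((p : ℕ) : ℝ) ^ (-τ / 2 - 1) :=
      Nat.Primes.summable_rpow.mpr (by linarith)
    refine (h1.mul_left (2 * (s * c) * Real.exp (2 * (s * c)))).of_nonneg_of_le (fun p => ?_)
      fun p => ?_
    · have h2 : 1 ≤ Real.exp (s * c * ((p : ℕ) : ℝ) ^ (-τ / 2)) :=
        Real.one_le_exp (by have := hq0 p; positivity)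
      exact div_nonneg (by nlinarith) (hp0 p).le
    · rw [Real.rpow_sub_one (hp0 p).ne', ← mul_div_assoc _ (((p : ℕ) : ℝ) ^ (-τ / 2)),
        ← Real.exp_nat_mul]
      have := hp0 p
      gcongr
      have h2 := Real.exp_sub_one_le_mul_exp
        (((2 : ℕ) : ℝ) * (s * c * ((p : ℕ) : ℝ) ^ (-τ / 2)))
      have h3 : ((2 : ℕ) : ℝ) * (s * c * ((p : ℕ) : ℝ) ^ (-τ / 2)) ≤ 2 * (s * c) := by
        push_cast
        have h4 : s * c * ((p : ℕ) : ℝ) ^ (-τ / 2) ≤ s * c :=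
          mul_le_of_le_one_right (by positivity) (by linarith [hq1 p])
        linarith
      refine h2.trans ?_
      have h4 := hq0 p
      calc _ ≤ ((2 : ℕ) : ℝ) * (s * c * ((p : ℕ) : ℝ) ^ (-τ / 2)) * Real.exp (2 * (s * c)) := by
            gcongr
        _ = _ := by push_cast; ring

theorem multipliable (h : IsPrimeSpectralData σ τ lam V) (hρ : 0 < τ - 2 * σ)
    (hτρ : 1 < τ + (τ - 2 * σ)) (hτ : 0 < τ) (n : ℕ+) :
    Multipliable fun p => lam p (primeExp n p) :=
  multipliable_finsupp (h.summable hρ hτρ hτ).2.norm (primeExp n)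

/-- Identifies B(n) = n Λ(n)^(1/ρ), so that n < xB(n) is a condition on the eigenvalue Λ(n) alone.
-/
theorem hasProd_weight (h : IsPrimeSpectralData σ τ lam V) (hρ : 0 < τ - 2 * σ)
    (hτρ : 1 < τ + (τ - 2 * σ)) (hτ : 0 < τ) (n : ℕ+) :
    HasProd (fun p : Nat.Primes =>
      ((p : ℕ) : ℝ) ^ primeExp n p * lam p (primeExp n p) ^ (1 / (τ - 2 * σ)))
      ((n : ℝ) * (∏' p, lam p (primeExp n p)) ^ (1 / (τ - 2 * σ))) := by
  have h1 : HasProd (fun p : Nat.Primes => ((p : ℕ) : ℝ) ^ primeExp n p) (n : ℝ) := by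
    have : (n : ℝ) = ∏ p ∈ (primeExp n).support, ((p : ℕ) : ℝ) ^ primeExp n p := by
      exact_mod_cast (prod_pow_primeExp n subset_rfl).symm
    rw [this]
    exact hasProd_prod_of_ne_finset_one fun p hp => by
      rw [Finsupp.notMem_support_iff.mp hp, pow_zero]
  refine h1.mul ?_
  have h2 : Tendsto (fun S : Finset Nat.Primes => (∏ p ∈ S, lam p (primeExp n p)) ^
      (1 / (τ - 2 * σ))) atTop (𝓝 ((∏' p, lam p (primeExp n p)) ^ (1 / (τ - 2 * σ)))) :=
    Tendsto.rpow_const (h.multipliable hρ hτρ hτ n).hasProd (Or.inr (by positivity))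
  refine Tendsto.congr (fun S => ?_) h2
  exact (Real.finsetProd_rpow _ _ (fun p _ => ((h p).pos _).le) _).symm

/-- The eigenvalue asymptotics, given the Euler product. -/
theorem hasEigenvalueAsymptotics (h : IsPrimeSpectralData σ τ lam V) (hρ : 0 < τ - 2 * σ)
    (hτρ : 1 < τ + (τ - 2 * σ)) (hτ : 0 < τ) {g : ℝ} (hg0 : 0 < g)
    (hg : HasProd (fun p : Nat.Primes =>
      (1 - 1 / ((p : ℕ) : ℝ)) * ∑' k : ℕ, lam p k ^ (1 / (τ - 2 * σ))) g) :
    HasEigenvalueAsymptotics (lcmMatrix σ τ) (τ - 2 * σ) (g ^ (τ - 2 * σ)) := by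
  have htame := h.isTameWeight hρ hτρ hτ
  have hB := h.hasProd_weight hρ hτρ hτ
  set Λ : ℕ+ → ℝ := fun n => ∏' p, lam p (primeExp n p) with hΛ
  have hn : ∀ n : ℕ+, (0 : ℝ) < n := fun n => by exact_mod_cast n.pos
  have hΛ0 : ∀ n, 0 ≤ Λ n := fun n =>
    ge_of_tendsto' (h.multipliable hρ hτρ hτ n).hasProd fun S =>
      Finset.prod_nonneg fun p _ => ((h p).pos _).le
  -- An infinite product of positive factors could vanish; the lower bound for tame weights excludes
  -- this.
  have hΛpos : ∀ n, 0 < Λ n := fun n => (hΛ0 n).lt_of_ne' fun h0 => by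
    have h1 : 0 < (n : ℝ) * Λ n ^ (1 / (τ - 2 * σ)) := htame.weight_pos hB n
    rw [h0, Real.zero_rpow (by positivity), mul_zero] at h1
    exact lt_irrefl _ h1
  obtain ⟨e, hanti, hlim, hasymp⟩ := htame.exists_equiv_nat
    (B := fun n => (n : ℝ) * Λ n ^ (1 / (τ - 2 * σ))) hB (g := g) (by
    convert! hg using 5 with p k
    rw [mul_div_cancel_left₀]
    exact pow_ne_zero _ (by exact_mod_cast p.2.ne_zero))
  have hμ : ∀ n : ℕ+, (n : ℝ) * Λ n ^ (1 / (τ - 2 * σ)) / n = Λ n ^ (1 / (τ - 2 * σ)) := fun n =>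
    mul_div_cancel_left₀ _ (hn n).ne'
  simp only [hμ] at hanti hlim hasymp
  have hinv : ∀ n, (Λ n ^ (1 / (τ - 2 * σ))) ^ (τ - 2 * σ) = Λ n := fun n => by
    rw [← Real.rpow_mul (hΛ0 n), one_div_mul_cancel hρ.ne', Real.rpow_one]
  refine ⟨Real.rpow_pos_of_pos hg0 _, Λ ∘ e, ?_, ?_⟩
  · refine ((h.diagonalizes hρ hτρ hτ).comp_equiv (Equiv.refl _) e).hasEigenvalueSequence ?_
      (fun n => hΛpos _) ?_
    · intro j k hjk
      change Λ (e k) ≤ Λ (e j)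
      have := Real.rpow_le_rpow (Real.rpow_nonneg (hΛ0 _) _) (hanti hjk) hρ.le
      simpa only [hinv] using this
    · change Tendsto (fun k => Λ (e k)) atTop (𝓝 0)
      have := hlim.rpow_const (p := τ - 2 * σ) (Or.inr hρ.le)
      simpa only [hinv, Real.zero_rpow hρ.ne'] using this
  · have hk : ∀ k : ℕ, (0 : ℝ) < (k : ℝ) + 1 := fun k => by positivity
    have h1 := (hasymp.rpow_const (p := τ - 2 * σ) (Or.inr hρ.le)).sub_const (g ^ (τ - 2 * σ))
    rw [sub_self] at h1
    rw [isLittleO_iff_tendsto fun k hk0 => absurd hk0 (Real.rpow_pos_of_pos (hk k) _).ne']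
    refine h1.congr fun k => ?_
    have h2 := Real.rpow_pos_of_pos (hk k) (τ - 2 * σ)
    rw [Real.mul_rpow (Real.rpow_nonneg (hΛ0 _) _) (hk k).le, hinv, Real.rpow_neg (hk k).le,
      Function.comp_apply]
    field_simp

end IsPrimeSpectralData


/-! ### The diagonal part -/

theorem diagonalizes_diagonalPart {ι : Type} [DecidableEq ι] (A : ι → ι → ℝ) :
    Diagonalizes (diagonalPart A) (fun i => A i i) (fun k i => if k = i then 1 else 0) where
  rows k l := by
    convert! hasSum_single (f := fun i => (if k = i then (1 : ℂ) else 0) *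
      (starRingEnd ℂ) (if l = i then 1 else 0)) k fun i hi => by simp [hi.symm] using 1
    by_cases h : k = l
    · simp [h]
    · simp [h, Ne.symm h]
  cols i j := by
    convert! hasSum_single (f := fun k => (if k = i then (1 : ℂ) else 0) *
      (starRingEnd ℂ) (if k = j then 1 else 0)) i fun k hk => by simp [hk] using 1
    by_cases h : i = j <;> simp [h]
  diag i j := by
    convert! hasSum_single (f := fun k => (A k k : ℂ) * ((if k = i then (1 : ℂ) else 0) *
      (starRingEnd ℂ) (if k = j then 1 else 0))) i fun k hk => by simp [hk] using 1
    by_cases h : i = j <;> simp [h, diagonalPart]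

theorem lcmMatrix_self (σ τ : ℝ) (n : ℕ+) : lcmMatrix σ τ n n = (n : ℝ) ^ (-(τ - 2 * σ)) := by
  have hn : (0 : ℝ) < n := by exact_mod_cast n.pos
  rw [lcmMatrix, Nat.lcm_self, ← Real.rpow_add hn, ← Real.rpow_sub hn]
  congr 1
  ring

theorem hasEigenvalueAsymptotics_diagonalPart {σ τ : ℝ} (hρ : 0 < τ - 2 * σ) :
    HasEigenvalueAsymptotics (diagonalPart (lcmMatrix σ τ)) (τ - 2 * σ) 1 := by
  have hlam : (fun i => lcmMatrix σ τ i i) ∘ Equiv.pnatEquivNat.symm =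
      fun n : ℕ => ((n : ℝ) + 1) ^ (-(τ - 2 * σ)) := by
    ext n
    rw [Function.comp_apply, lcmMatrix_self]
    congr 1
    exact_mod_cast Nat.succPNat_coe n
  have hk : ∀ k : ℕ, (0 : ℝ) < (k : ℝ) + 1 := fun k => by positivity
  refine ⟨one_pos, fun n : ℕ => ((n : ℝ) + 1) ^ (-(τ - 2 * σ)), ?_, ?_⟩
  · have hD := (diagonalizes_diagonalPart (lcmMatrix σ τ)).comp_equiv (Equiv.refl _)
      Equiv.pnatEquivNat.symm
    rw [hlam] at hD
    refine hD.hasEigenvalueSequence (fun j k hjk => ?_) (fun n => Real.rpow_pos_of_pos (hk n) _) ?_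
    · exact Real.rpow_le_rpow_of_nonpos (hk j) (by gcongr) (by linarith)
    · exact (tendsto_rpow_neg_atTop hρ).comp
        (tendsto_natCast_atTop_atTop.atTop_add tendsto_const_nhds)
  · refine (isLittleO_zero _ _).congr_left fun n => ?_
    beta_reduce
    rw [Real.rpow_neg (hk n).le, one_div, sub_self]

/-! ### Euler products and zeta values -/

theorem le_hasProd_of_one_le {α : Type*} {f : α → ℝ} {a : ℝ} (h : HasProd f a)
    (hf : ∀ i, 1 ≤ f i) (i : α) : f i ≤ a := by
  classical
  refine ge_of_tendsto h ?_
  filter_upwards [eventually_ge_atTop {i}] with S hS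
  rw [← Finset.prod_singleton f i]
  exact Finset.prod_le_prod_of_subset_of_one_le hS (fun j _ => zero_le_one.trans (hf j))
    fun j _ _ => hf j

theorem hasProd_realZeta {s : ℝ} (hs : 1 < s) :
    HasProd (fun p : Nat.Primes => (1 - ((p : ℕ) : ℝ) ^ (-s))⁻¹) (realZeta s) := by
  have h : HasProd (fun p : Nat.Primes => (1 - (p : ℂ) ^ (-(s : ℂ)))⁻¹) (riemannZeta s) :=
    riemannZeta_eulerProduct_hasProd (by simpa using hs)
  refine ((Complex.continuous_re.tendsto _).comp h).congr fun S => ?_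
  have h1 : ∀ p : Nat.Primes, (1 - (p : ℂ) ^ (-(s : ℂ)))⁻¹ =
      (((1 - ((p : ℕ) : ℝ) ^ (-s))⁻¹ : ℝ) : ℂ) := fun p => by
    push_cast
    rw [Complex.ofReal_cpow (Nat.cast_nonneg _)]
    push_cast
    rfl
  simp only [Function.comp, h1]
  rw [← Complex.ofReal_prod, Complex.ofReal_re]

theorem realZeta_pos {s : ℝ} (hs : 1 < s) : 0 < realZeta s := by
  have h1 : ∀ p : Nat.Primes, 1 ≤ (1 - ((p : ℕ) : ℝ) ^ (-s))⁻¹ := fun p =>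
    (one_le_inv₀ (by linarith [prime_rpow_lt_one p (by linarith : -s < 0)])).mpr
      (by linarith [prime_rpow_pos p (-s)])
  exact one_pos.trans_le ((h1 ⟨2, Nat.prime_two⟩).trans
    (le_hasProd_of_one_le (hasProd_realZeta hs) h1 _))

/-- With x = p^(-s) the factor is (1-x)^(-2)/(1-x²)^(-1), a quotient of Euler factors of ζ(s)² and
ζ(2s). -/
theorem hasProd_one_add_div_one_sub {s : ℝ} (hs : 1 < s) :
    HasProd (fun p : Nat.Primes => (1 + ((p : ℕ) : ℝ) ^ (-s)) / (1 - ((p : ℕ) : ℝ) ^ (-s)))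
      (realZeta s ^ 2 / realZeta (2 * s)) := by
  have h2s : 1 < 2 * s := by linarith
  have h : Tendsto (fun S : Finset Nat.Primes => (∏ p ∈ S, (1 - ((p : ℕ) : ℝ) ^ (-s))⁻¹) ^ 2 /
      ∏ p ∈ S, (1 - ((p : ℕ) : ℝ) ^ (-(2 * s)))⁻¹) atTop
      (𝓝 (realZeta s ^ 2 / realZeta (2 * s))) :=
    Tendsto.div (Tendsto.pow (hasProd_realZeta hs) 2) (hasProd_realZeta h2s) (realZeta_pos h2s).ne'
  refine Tendsto.congr (fun S => ?_) h
  rw [← Finset.prod_pow, ← Finset.prod_div_distrib]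
  refine Finset.prod_congr rfl fun p _ => ?_
  have hsq : ((p : ℕ) : ℝ) ^ (-(2 * s)) = (((p : ℕ) : ℝ) ^ (-s)) ^ 2 := by
    rw [← Real.rpow_natCast, ← Real.rpow_mul (Nat.cast_nonneg _)]
    congr 1
    push_cast
    ring
  have h1 := prime_rpow_lt_one p (by linarith : -s < 0)
  have h0 := prime_rpow_pos p (-s)
  rw [hsq]
  have h2 : 1 - ((p : ℕ) : ℝ) ^ (-s) ≠ 0 := by linarith
  have h3 : 1 + ((p : ℕ) : ℝ) ^ (-s) ≠ 0 := by linarith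
  have h4 : 1 - (((p : ℕ) : ℝ) ^ (-s)) ^ 2 ≠ 0 := by
    rw [show 1 - (((p : ℕ) : ℝ) ^ (-s)) ^ 2 =
      (1 - ((p : ℕ) : ℝ) ^ (-s)) * (1 + ((p : ℕ) : ℝ) ^ (-s)) by ring]
    exact mul_ne_zero h2 h3
  field_simp
  ring

/-- All Euler factors exceed 1, so the product is at least the factor at 2. -/
theorem one_lt_realZeta_sq_div {s : ℝ} (hs : 1 < s) : 1 < realZeta s ^ 2 / realZeta (2 * s) := by
  have h1 : ∀ p : Nat.Primes,
      1 < (1 + ((p : ℕ) : ℝ) ^ (-s)) / (1 - ((p : ℕ) : ℝ) ^ (-s)) := fun p => by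
    rw [one_lt_div (by linarith [prime_rpow_lt_one p (by linarith : -s < 0)])]
    linarith [prime_rpow_pos p (-s)]
  exact (h1 ⟨2, Nat.prime_two⟩).trans_le
    (le_hasProd_of_one_le (hasProd_one_add_div_one_sub hs) (fun p => (h1 p).le) _)

/-! ### Closed forms for ρ = 1 and ρ = 1/2 -/

namespace IsPrimeSpectralData

variable {σ τ : ℝ} {lam : Nat.Primes → ℕ → ℝ} {V : Nat.Primes → ℕ → ℕ → ℂ}

/-- The sum is the trace, and r² = 1/p. -/
theorem hasSum_rpow_of_eq_one (h : IsPrimeSpectralData σ τ lam V) (hρ : τ - 2 * σ = 1)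
    (p : Nat.Primes) :
    HasSum (fun k => lam p k ^ (1 / (τ - 2 * σ))) (1 - 1 / ((p : ℕ) : ℝ))⁻¹ := by
  have h1 := (h p).hasSum_one
  have h2 : (((p : ℕ) : ℝ) ^ (-(τ - 2 * σ) / 2)) ^ 2 = 1 / ((p : ℕ) : ℝ) := by
    rw [← Real.rpow_natCast, ← Real.rpow_mul (Nat.cast_nonneg _), hρ, one_div ((p : ℕ) : ℝ),
      ← Real.rpow_neg_one]
    norm_num
  rw [h2] at h1
  simpa [hρ] using h1

/-- The sum is the squared Hilbert–Schmidt norm, with r⁴ = 1/p and (rq)² = p^(-(τ+ρ)) = p^(-(1+2σ)).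
-/
theorem hasSum_rpow_of_eq_half (h : IsPrimeSpectralData σ τ lam V) (hρ : τ - 2 * σ = 1 / 2)
    (p : Nat.Primes) :
    HasSum (fun k => lam p k ^ (1 / (τ - 2 * σ))) ((1 - 1 / ((p : ℕ) : ℝ))⁻¹ *
      ((1 + ((p : ℕ) : ℝ) ^ (-(1 + 2 * σ))) / (1 - ((p : ℕ) : ℝ) ^ (-(1 + 2 * σ))))) := by
  have hp0 : (0 : ℝ) < ((p : ℕ) : ℝ) := by exact_mod_cast p.2.pos
  have h1 := (h p).hasSum_two
  have h2 : (((p : ℕ) : ℝ) ^ (-(τ - 2 * σ) / 2)) ^ 4 = 1 / ((p : ℕ) : ℝ) := by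
    rw [← Real.rpow_natCast, ← Real.rpow_mul hp0.le, hρ, one_div ((p : ℕ) : ℝ),
      ← Real.rpow_neg_one]
    congr 1
    norm_num
  have h3 : (((p : ℕ) : ℝ) ^ (-(τ - 2 * σ) / 2) * ((p : ℕ) : ℝ) ^ (-τ / 2)) ^ 2 =
      ((p : ℕ) : ℝ) ^ (-(1 + 2 * σ)) := by
    rw [← Real.rpow_add hp0, ← Real.rpow_natCast, ← Real.rpow_mul hp0.le]
    congr 1
    push_cast
    linarith
  rw [h2, h3] at h1
  refine h1.of_forall_eq fun k => ?_
  rw [hρ, one_div_one_div]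
  exact Real.rpow_natCast _ 2

theorem isEulerConstant (h : IsPrimeSpectralData σ τ lam V) {s : Nat.Primes → ℝ} {g : ℝ}
    (hs : ∀ p, HasSum (fun k => lam p k ^ (1 / (τ - 2 * σ))) ((1 - 1 / ((p : ℕ) : ℝ))⁻¹ * s p))
    (hg : HasProd s g) :
    IsEulerConstant σ τ g ∧ HasProd (fun p : Nat.Primes =>
      (1 - 1 / ((p : ℕ) : ℝ)) * ∑' k : ℕ, lam p k ^ (1 / (τ - 2 * σ))) g := by
  have h1 : HasProd (fun p : Nat.Primes =>
      (1 - 1 / ((p : ℕ) : ℝ)) * ∑' k : ℕ, lam p k ^ (1 / (τ - 2 * σ))) g := by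
    convert! hg using 2 with p
    have hp1 : (1 : ℝ) < ((p : ℕ) : ℝ) := by exact_mod_cast p.2.one_lt
    rw [(hs p).tsum_eq, mul_inv_cancel_left₀]
    rw [sub_ne_zero, ne_comm, Ne, div_eq_one_iff_eq (by positivity)]
    exact hp1.ne
  exact ⟨⟨lam, h.hasEigenvalueSequence, fun p => (hs p).summable, h1⟩, h1⟩

end IsPrimeSpectralData

theorem mainTheorem5 (σ τ : ℝ) (hρ : 0 < τ - 2 * σ) (hτρ : 1 < τ + (τ - 2 * σ)) (hτ : 0 < τ) :
    (τ - 2 * σ = 1 →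
      ∃ κ g : ℝ, HasEigenvalueAsymptotics (lcmMatrix σ τ) (τ - 2 * σ) κ ∧
        IsEulerConstant σ τ g ∧ κ = g ^ (τ - 2 * σ) ∧
        g = 1 ∧ κ = 1) ∧
    (τ - 2 * σ = 1 / 2 →
      ∃ κ g : ℝ, HasEigenvalueAsymptotics (lcmMatrix σ τ) (τ - 2 * σ) κ ∧
        IsEulerConstant σ τ g ∧ κ = g ^ (τ - 2 * σ) ∧
        g = realZeta (1 + 2 * σ) ^ 2 / realZeta (2 + 4 * σ) ∧
        g ^ (-(τ - 2 * σ)) = √(realZeta (2 + 4 * σ)) / realZeta (1 + 2 * σ) ∧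
        κ = realZeta (1 + 2 * σ) / √(realZeta (2 + 4 * σ)) ∧
        HasEigenvalueAsymptotics (diagonalPart (lcmMatrix σ τ)) (τ - 2 * σ) 1 ∧
        κ ≠ 1) := by
  obtain ⟨lam, V, h⟩ := exists_isPrimeSpectralData hρ hτ
  constructor
  · intro hρ1
    obtain ⟨hE, hg⟩ := h.isEulerConstant (s := fun _ => 1)
      (fun p => by simpa only [mul_one] using h.hasSum_rpow_of_eq_one hρ1 p) hasProd_one
    have hκ := h.hasEigenvalueAsymptotics hρ hτρ hτ one_pos hg
    exact ⟨_, 1, hκ, hE, rfl, rfl, Real.one_rpow _⟩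
  · intro hρ2
    -- For ρ = 1/2 the hypothesis τ + ρ > 1 says exactly this, and it puts the zeta values in the
    -- region of convergence.
    have hs : 1 < 1 + 2 * σ := by linarith
    have h24 : 2 + 4 * σ = 2 * (1 + 2 * σ) := by ring
    obtain ⟨hE, hg⟩ := h.isEulerConstant (h.hasSum_rpow_of_eq_half hρ2)
      (hasProd_one_add_div_one_sub hs)
    have hg1 := one_lt_realZeta_sq_div hs
    rw [← h24] at hE hg hg1
    have hκ := h.hasEigenvalueAsymptotics hρ hτρ hτ (one_pos.trans hg1) hg
    have hz := realZeta_pos hs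
    have hval : (realZeta (1 + 2 * σ) ^ 2 / realZeta (2 + 4 * σ)) ^ (τ - 2 * σ) =
        realZeta (1 + 2 * σ) / √(realZeta (2 + 4 * σ)) := by
      rw [hρ2, ← Real.sqrt_eq_rpow, Real.sqrt_div (by positivity), Real.sqrt_sq hz.le]
    refine ⟨_, _, hκ, hE, rfl, rfl, ?_, hval, hasEigenvalueAsymptotics_diagonalPart hρ,
      (Real.one_lt_rpow hg1 hρ).ne'⟩
    rw [Real.rpow_neg (one_pos.trans hg1).le, hval, inv_div]
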